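/- Consider $N\ge 1$ fermionic modes with annihilation operators $a_1,\dots,a_N$ on the $2^N$-dimensional Fock space and Majorana operators $c_{2j-1}=a_j+a_j^\dagger$, $c_{2j}=i(a_j-a_j^\dagger)$. Let $$\mathcal L(\rho)=-i[H,\rho]+\sum_{\mu=1}^m\left(2L_\mu\rho L_\mu^\dagger-\{L_\mu^\dagger L_\mu,\rho\}\right),\qquad H=\frac i4\sum_{j,k=1}^{2N}\mathbf H_{jk}c_jc_k,\qquad L_\mu=\sum_{j=1}^{2N}\ell_{\mu,j}c_j,$$ where $\mathbf H$ is a real antisymmetric $2N\times 2N$ matrix and $\ell_\mu\in\mathbb C^{2N}$, and put $\mathbf M_{jk}=\sum_\mu \ell_{\mu,j}\overline{\ell_{\mu,k}}$. The covariance matrix of a density operator $\rho$ is $M_{jk}=\frac i2\operatorname{tr}(\rho[c_j,c_k])$. An even Gaussian state is a density operator $\rho$ in the span of the even Majorana monomials such that $i^p\operatorname{tr}(\rho\,c_{j_1}\cdots c_{j_{2p}})=\operatorname{Pf}(M[j_1,\dots,j_{2p}])$ for all $j_1<\dots<j_{2p}$. Running time is measured in a model of exact computation with complex numbers. The operations $+,-,\times,\div$,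 complex conjugation, $\exp$, reading and writing of array entries, tests whether a complex number is zero, the use of rational constants and of $i$, and additions, subtractions and comparisons of array indices take time $1$ each. There is also an instruction that computes the roots, with multiplicity and in unspecified order, of a monic complex polynomial of degree $d$; it is charged $d^3$. Theorem. There are one program and an absolute constant $C$ such that for every $N\ge1$, every $\mathcal L$ as above (with any number $m$ of Lindblad operators), every even Gaussian state $\rho$ with covariance matrix $M(0)$ and every $t\ge0$, the program, given $N$, $t$, $\mathbf H$, $\mathbf M$ and $M(0)$, computes the covariance matrix $M(t)$ of $e^{t\mathcal L}(\rho)$ exactly in time at most $CN^3$. If the vectors $\ell_1,\dots,\ell_m$ are given instead of $\mathbf M$, this can be done (by another program) in time at most $C(N^3+mN^2)$. -/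

import Mathlib

open scoped Matrix ComplexOrder

/-! ### Fermionic modes, Majorana operators, states -/

namespace Fermion

/-- Operators on the Fock space of `N` modes, as matrices in the basis of number states; the number
state `|n₁,…,n_N⟩` is labelled by the set `{j | n_j = 1}` of occupied modes. -/
abbrev Op (N : ℕ) : Type := Matrix (Finset (Fin N)) (Finset (Fin N)) ℂ

/-- The annihilation operator `a_j`, with matrix elements `⟨T| a_j |S⟩`. The sign is the one for
which `|S⟩` is the product of the `a_k†`, `k ∈ S`, in increasing order, applied to the vacuum. -/
def annihilation {N : ℕ} (j : Fin N) : Op N :=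
  fun T S => if j ∈ S ∧ T = S.erase j then (-1) ^ (S.filter (· < j)).card else 0

/-- The creation operator `a_j†`. -/
def creation {N : ℕ} (j : Fin N) : Op N := (annihilation j)ᴴ

/-- The Majorana operators. Indices start at `0`: for a mode `j`, the operators numbered `2 * j` and
`2 * j + 1` are `a_j + a_j†` and `i (a_j - a_j†)`. -/
noncomputable def majorana {N : ℕ} (k : Fin (2 * N)) : Op N :=
  let j : Fin N := ⟨k.val / 2, by omega⟩
  if k.val % 2 = 0 then annihilation j + creation j
  else Complex.I • (annihilation j - creation j)

/-- The product `c_{j_1} ⋯ c_{j_n}` of Majorana operators, in this order. -/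
noncomputable def majoranaProd {N n : ℕ} (j : Fin n → Fin (2 * N)) : Op N :=
  (List.ofFn fun k => majorana (j k)).prod

/-- Density operators. -/
def IsState {N : ℕ} (ρ : Op N) : Prop := ρ.PosSemidef ∧ ρ.trace = 1

/-- Even operators: linear combinations of ordered monomials of even degree in the Majorana
operators. -/
def IsEven {N : ℕ} (ρ : Op N) : Prop :=
  ρ ∈ Submodule.span ℂ
    {A : Op N | ∃ (p : ℕ) (j : Fin (2 * p) → Fin (2 * N)), StrictMono j ∧ A = majoranaProd j}

/-- The covariance matrix `M_{jk} = (i/2) tr (ρ [c_j, c_k])`. -/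
noncomputable def covariance {N : ℕ} (ρ : Op N) : Matrix (Fin (2 * N)) (Fin (2 * N)) ℂ :=
  fun j k => Complex.I / 2 *
    (ρ * (majorana j * majorana k - majorana k * majorana j)).trace

/-- The Pfaffian of a `2p × 2p` matrix,
`(1 / (2^p p!)) ∑_σ sign σ ∏_i A_{σ(2i), σ(2i+1)}` (indices starting at `0`). -/
noncomputable def pfaffian {p : ℕ} (A : Matrix (Fin (2 * p)) (Fin (2 * p)) ℂ) : ℂ :=
  (1 / (2 ^ p * (p.factorial : ℂ))) *
    ∑ σ : Equiv.Perm (Fin (2 * p)), ((Equiv.Perm.sign σ : ℤ) : ℂ) *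
      ∏ i : Fin p, A (σ ⟨2 * i.val, by omega⟩) (σ ⟨2 * i.val + 1, by omega⟩)

/-- Even Gaussian states: even density operators for which Wick's formula
`i^p tr (ρ c_{j_1} ⋯ c_{j_{2p}}) = Pf (M[j_1, …, j_{2p}])` holds for all `j_1 < ⋯ < j_{2p}`. -/
def IsEvenGaussian {N : ℕ} (ρ : Op N) : Prop :=
  IsState ρ ∧ IsEven ρ ∧
    ∀ (p : ℕ) (j : Fin (2 * p) → Fin (2 * N)), StrictMono j →
      Complex.I ^ p * (ρ * majoranaProd j).trace = pfaffian ((covariance ρ).submatrix j j)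

/-! ### The Liouvillian and its semigroup -/

/-- The quadratic Hamiltonian `(i/4) ∑_{j,k} H_{jk} c_j c_k`. -/
noncomputable def hamiltonian {N : ℕ} (H : Matrix (Fin (2 * N)) (Fin (2 * N)) ℝ) : Op N :=
  (Complex.I / 4) • ∑ j, ∑ k, (H j k : ℂ) • (majorana j * majorana k)

/-- The linear Lindblad operator `∑_j ℓ_j c_j`. -/
noncomputable def lindblad {N : ℕ} (l : Fin (2 * N) → ℂ) : Op N := ∑ j, l j • majorana j

/-- The Liouvillian
`ρ ↦ -i [H, ρ] + ∑_μ (2 L_μ ρ L_μ† - {L_μ† L_μ, ρ})`. -/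
noncomputable def liouvillian {N m : ℕ} (H : Matrix (Fin (2 * N)) (Fin (2 * N)) ℝ)
    (l : Matrix (Fin m) (Fin (2 * N)) ℂ) : Op N →ₗ[ℂ] Op N :=
  (-Complex.I) • (LinearMap.mulLeft ℂ (hamiltonian H) - LinearMap.mulRight ℂ (hamiltonian H)) +
    ∑ μ, ((2 : ℂ) • (LinearMap.mulLeft ℂ (lindblad (l μ)) ∘ₗ
            LinearMap.mulRight ℂ (lindblad (l μ))ᴴ) -
          (LinearMap.mulLeft ℂ ((lindblad (l μ))ᴴ * lindblad (l μ)) +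
            LinearMap.mulRight ℂ ((lindblad (l μ))ᴴ * lindblad (l μ))))

/-- The time-evolved operator `exp (t 𝓛) (ρ) = ∑_n (t^n / n!) 𝓛^n (ρ)` (the series converges, since
the space of operators has finite dimension). -/
noncomputable def evolve {N m : ℕ} (H : Matrix (Fin (2 * N)) (Fin (2 * N)) ℝ)
    (l : Matrix (Fin m) (Fin (2 * N)) ℂ) (t : ℝ) (ρ : Op N) : Op N :=
  ∑' n : ℕ, ((t : ℂ) ^ n / (n.factorial : ℂ)) • ((liouvillian H l) ^ n) ρ

/-- The Hermitian matrix `∑_μ ℓ_{μ,j} (ℓ_{μ,k})^*` that parametrizes the Lindblad operators. -/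
def lindbladMatrix {N m : ℕ} (l : Matrix (Fin m) (Fin (2 * N)) ℂ) :
    Matrix (Fin (2 * N)) (Fin (2 * N)) ℂ :=
  fun j k => ∑ μ, l μ j * star (l μ k)

end Fermion

/-! ### Programs with arithmetic on complex numbers, and their running time

One program text handles all problem sizes. Complex numbers are stored exactly. A program may add,
subtract, multiply, divide, conjugate and exponentiate complex numbers, compare them with zero, and
find the roots of a polynomial. Every elementary step takes time one, and the root finding for a
polynomial of degree `d` is charged `d ^ 3`. -/

namespace ComplexRAM

/-- Memory: arrays of natural numbers with one index (for loop counters and indices), and arrays of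
complex numbers with two indices. The first argument is the name of the array. -/
structure Memory where
  nat : ℕ → ℕ → ℕ
  arr : ℕ → ℕ → ℕ → ℂ

/-- Store a natural number. -/
def Memory.setNat (s : Memory) (a i v : ℕ) : Memory :=
  { s with nat := fun b k => if b = a ∧ k = i then v else s.nat b k }

/-- Store a complex number. -/
noncomputable def Memory.setArr (s : Memory) (a i j : ℕ) (v : ℂ) : Memory :=
  { s with arr := fun b k l => if b = a ∧ k = i ∧ l = j then v else s.arr b k l }

/-- Index expressions. -/
inductive NExp where
  | const (n : ℕ)
  | read (a : ℕ) (i : NExp)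
  | add (e f : NExp)
  | sub (e f : NExp)

/-- Value of an index expression (with truncated subtraction). -/
def NExp.eval (s : Memory) : NExp → ℕ
  | .const n => n
  | .read a i => s.nat a (i.eval s)
  | .add e f => e.eval s + f.eval s
  | .sub e f => e.eval s - f.eval s

/-- Time for an index expression: the number of its nodes. -/
def NExp.cost : NExp → ℕ
  | .const _ => 1
  | .read _ i => i.cost + 1
  | .add e f => e.cost + f.cost + 1
  | .sub e f => e.cost + f.cost + 1

/-- Complex expressions. -/
inductive CExp where
  | const (q : ℚ)
  | imag
  | read (a : ℕ) (i j : NExp)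
  | add (e f : CExp)
  | sub (e f : CExp)
  | mul (e f : CExp)
  | div (e f : CExp)
  | conj (e : CExp)
  | exp (e : CExp)

/-- Value of a complex expression (division by zero gives zero). -/
noncomputable def CExp.eval (s : Memory) : CExp → ℂ
  | .const q => (q : ℂ)
  | .imag => Complex.I
  | .read a i j => s.arr a (i.eval s) (j.eval s)
  | .add e f => e.eval s + f.eval s
  | .sub e f => e.eval s - f.eval s
  | .mul e f => e.eval s * f.eval s
  | .div e f => e.eval s / f.eval s
  | .conj e => star (e.eval s)
  | .exp e => Complex.exp (e.eval s)

/-- Time for a complex expression: the number of its nodes, including those of the indices. -/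
def CExp.cost : CExp → ℕ
  | .const _ => 1
  | .imag => 1
  | .read _ i j => i.cost + j.cost + 1
  | .add e f => e.cost + f.cost + 1
  | .sub e f => e.cost + f.cost + 1
  | .mul e f => e.cost + f.cost + 1
  | .div e f => e.cost + f.cost + 1
  | .conj e => e.cost + 1
  | .exp e => e.cost + 1

/-- Programs. -/
inductive Program where
  /-- Do nothing. -/
  | skip
  /-- `nat a i := e` -/
  | setNat (a : ℕ) (i e : NExp)
  /-- `arr a i j := e` -/
  | setArr (a : ℕ) (i j : NExp) (e : CExp)
  /-- Write into `arr b 0 0, …, arr b 0 (d - 1)` the roots of the monic polynomial of degree `d`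
  with lower coefficients `arr a 0 0, …, arr a 0 (d - 1)`. -/
  | roots (a b : ℕ) (d : NExp)
  /-- Execute `P`, then `Q`. -/
  | seq (P Q : Program)
  /-- If `e = 0` then `P` else `Q`. -/
  | ifZero (e : CExp) (P Q : Program)
  /-- If `e < f` then `P` else `Q`. -/
  | ifLt (e f : NExp) (P Q : Program)
  /-- For `nat x 0` from `0` to `e - 1` do `P`, where `e` is evaluated once, on entry. -/
  | loop (x : ℕ) (e : NExp) (P : Program)

/-- A root finder: it returns, in an order of its own choice, all the roots, with multiplicity, of
the monic polynomial `X ^ d + ∑_{k < d} a_k X ^ k`. -/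
structure RootFinder where
  find : (d : ℕ) → (Fin d → ℂ) → Fin d → ℂ
  spec : ∀ (d : ℕ) (a : Fin d → ℂ),
    (Polynomial.X ^ d + ∑ k, Polynomial.C (a k) * Polynomial.X ^ (k : ℕ) : Polynomial ℂ) =
      ∏ k, (Polynomial.X - Polynomial.C (find d a k))

/-- Root finders exist. -/
theorem RootFinder.exists : Nonempty RootFinder := by
  have key : ∀ (d : ℕ) (a : Fin d → ℂ), ∃ z : Fin d → ℂ,
      (Polynomial.X ^ d + ∑ k, Polynomial.C (a k) * Polynomial.X ^ (k : ℕ) : Polynomial ℂ) =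
        ∏ k, (Polynomial.X - Polynomial.C (z k)) := by
    intro d a
    set p : Polynomial ℂ :=
      Polynomial.X ^ d + ∑ k, Polynomial.C (a k) * Polynomial.X ^ (k : ℕ) with hp
    have hlt : (∑ k, Polynomial.C (a k) * Polynomial.X ^ (k : ℕ) : Polynomial ℂ).degree < d :=
      Polynomial.degree_sum_fin_lt a
    have hm : p.Monic := Polynomial.monic_X_pow_add hlt
    have hd : p.natDegree = d := by
      apply Polynomial.natDegree_eq_of_degree_eq_some
      rw [hp, Polynomial.degree_add_eq_left_of_degree_lt (by simpa using hlt),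
        Polynomial.degree_X_pow]
    have hs : p.Splits := IsAlgClosed.splits p
    have hc : p.roots.toList.length = d := by
      rw [Multiset.length_toList, ← hd]
      exact hs.natDegree_eq_card_roots.symm
    refine ⟨fun k => p.roots.toList.get (k.cast hc.symm), ?_⟩
    have hprod : p = (p.roots.map fun x => Polynomial.X - Polynomial.C x).prod := by
      have h := hs.eq_prod_roots
      rwa [hm.leadingCoeff, Polynomial.C_1, one_mul] at h
    have h2 : (p.roots.map fun x => Polynomial.X - Polynomial.C x).prod =
        (p.roots.toList.map fun x => Polynomial.X - Polynomial.C x).prod := by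
      rw [← Multiset.prod_coe, ← Multiset.map_coe, Multiset.coe_toList]
    refine (hprod.trans h2).trans ?_
    rw [← Fin.prod_univ_fun_getElem]
    exact Fintype.prod_equiv (finCongr hc) _ _ (fun k => rfl)
  choose z hz using key
  exact ⟨⟨z, hz⟩⟩

/-- The effect of the root-finding instruction. -/
noncomputable def Memory.storeRoots (R : RootFinder) (s : Memory) (a b d : ℕ) : Memory :=
  { s with arr := fun c i k =>
      if h : c = b ∧ i = 0 ∧ k < d then R.find d (fun r => s.arr a 0 r) ⟨k, h.2.2⟩
      else s.arr c i k }

/-- Apply `f 0`, then `f 1`, …, then `f (n - 1)`. -/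
def iter (f : ℕ → Memory → Memory) : ℕ → Memory → Memory
  | 0, s => s
  | n + 1, s => f n (iter f n s)

/-- The final memory of a program. -/
noncomputable def Program.run (R : RootFinder) : Program → Memory → Memory
  | .skip, s => s
  | .setNat a i e, s => s.setNat a (i.eval s) (e.eval s)
  | .setArr a i j e, s => s.setArr a (i.eval s) (j.eval s) (e.eval s)
  | .roots a b d, s => s.storeRoots R a b (d.eval s)
  | .seq P Q, s => Program.run R Q (Program.run R P s)
  | .ifZero e P Q, s =>
      open Classical in if e.eval s = 0 then Program.run R P s else Program.run R Q s
  | .ifLt e f P Q, s => if e.eval s < f.eval s then Program.run R P s else Program.run R Q s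
  | .loop x e P, s => iter (fun k s' => Program.run R P (s'.setNat x 0 k)) (e.eval s) s

/-- The running time of a program. -/
noncomputable def Program.cost (R : RootFinder) : Program → Memory → ℕ
  | .skip, _ => 1
  | .setNat _ i e, _ => i.cost + e.cost + 1
  | .setArr _ i j e, _ => i.cost + j.cost + e.cost + 1
  | .roots _ _ d, s => d.cost + (d.eval s) ^ 3 + 1
  | .seq P Q, s => Program.cost R P s + Program.cost R Q (Program.run R P s)
  | .ifZero e P Q, s => e.cost + 1 +
      open Classical in if e.eval s = 0 then Program.cost R P s else Program.cost R Q s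
  | .ifLt e f P Q, s => e.cost + f.cost + 1 +
      if e.eval s < f.eval s then Program.cost R P s else Program.cost R Q s
  | .loop x e P, s => e.cost + 1 + ∑ k ∈ Finset.range (e.eval s),
      (1 + Program.cost R P
        ((iter (fun k s' => Program.run R P (s'.setNat x 0 k)) k s).setNat x 0 k))

/-- A matrix as the content of an array. -/
def ofMatrix {m n : ℕ} (A : Matrix (Fin m) (Fin n) ℂ) : ℕ → ℕ → ℂ :=
  fun i j => if h : i < m ∧ j < n then A ⟨i, h.1⟩ ⟨j, h.2⟩ else 0

/-- Initial memory: `nat 0 0` and `nat 0 1` hold two sizes `N` and `m`, `arr 0 0 0` holds a number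
`t`, the arrays `1`, `2`, `3` hold matrices `A`, `B`, `D`; everything else is zero. -/
noncomputable def input {a b c d e f : ℕ} (N m : ℕ) (t : ℝ) (A : Matrix (Fin a) (Fin b) ℂ)
    (B : Matrix (Fin c) (Fin d) ℂ) (D : Matrix (Fin e) (Fin f) ℂ) : Memory where
  nat := fun x i => if x = 0 ∧ i = 0 then N else if x = 0 ∧ i = 1 then m else 0
  arr := fun x i j =>
    if x = 0 ∧ i = 0 ∧ j = 0 then (t : ℂ)
    else if x = 1 then ofMatrix A i j
    else if x = 2 then ofMatrix B i j
    else if x = 3 then ofMatrix D i j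
    else 0

/-- Started in memory `s`, the program stops within time `T` with the matrix `A` in array `4`. -/
def Program.Computes {m n : ℕ} (P : Program) (R : RootFinder) (s : Memory)
    (A : Matrix (Fin m) (Fin n) ℂ) (T : ℕ) : Prop :=
  P.cost R s ≤ T ∧ ∀ (i : Fin m) (j : Fin n), (P.run R s).arr 4 i j = A i j

end ComplexRAM

namespace ComplexRAM

/-! ### Frames: the arrays a program does not write -/

/-! The covariance matrix obeys a closed affine equation. Tested against a product of two Majorana
operators, the Liouvillian produces only commutators of such products with linear operators, and
these are linear again; so second moments are driven by second moments alone. With `X = H - 2 (M +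
Mᵀ)` and `Y = 4i (Mᵀ - M)` the result is `C ↦ X C + C Xᵀ + tr ρ • Y` (`covariance_liouvillian`). Put
`tr ρ • 1` below `C`. The resulting column `Z` evolves by `Z ↦ G Z + Z Xᵀ` with `G = [[X, Y], [0,
-Xᵀ]]`, where left and right multiplication commute, hence `Z(t) = exp(tG) Z exp(tXᵀ)`. Since the
upper left block of `E = exp(tG)` is `exp(tX)`, the covariance matrix at time `t` is `(E₁₁ C + E₁₂)
E₁₁ᵀ` (`covariance_evolve`). Everything is reduced to one exact exponential of a matrix of size `n =
4N` and a few matrix products.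

The exponential is read off from a Jordan form. The form is reached by elementary changes of basis,
each of cost `O(n)`, with `O(n)` of them per column; the matrices `P` and `P⁻¹` of the change of
basis are carried along as borders of the array (`IsConj`).

Danilevsky's elimination gives a block upper triangular matrix with companion blocks
(`companionProg_run`). Their last columns contain the characteristic polynomials, and the charges
for finding the roots add up to at most `n³`, because the sizes of the blocks add up to `n`
(`rootsProg_rootCost`). With the roots known, the basis `b, A b, A² b, …` of a block is replaced by
`b, (A - λ₁) b, (A - λ₂)(A - λ₁) b, …`. The blocks become lower bidiagonal, and the last column of a
block needs no work, since the product of all factors annihilates `b` modulo the earlier blocks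
(`IsShifted.last_eq`). Reversing each block gives an upper triangular matrix (`reverseProg_run`).

The Jordan chains are then built one basis vector `b_j` at a time. Multiples of the earlier vectors
are added to `b_j` until `(A - λ) b_j` is a combination of heads of chains with eigenvalue `λ`
(`IsReduced.head`). The longest of these chains is replaced by its sum with suitable multiples of
the others, after which `(A - λ) b_j` is a multiple of its head (`IsMerging.step`,
`IsMerging.finish`). Each earlier vector is used at most once in either phase, so that `O(n)`
elementary transformations suffice for one column. In Jordan form a column of the exponential
consists of the numbers `exp λ / m!` placed along a chain (`IsJordan.exp_apply`).

For the running time, all loops are bounded by sizes that the main program only reads, and are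
nested at most three deep. `Program.cost_le` and `Program.maxCost_le` turn this syntactic fact into
a cubic bound; only the charge for the roots needs an argument about the data. -/

/-- Whether a program may write into the index array `a`. -/
def Program.writesNat (a : ℕ) : Program → Bool
  | .skip => false
  | .setNat b _ _ => a == b
  | .setArr _ _ _ _ => false
  | .roots _ _ _ => false
  | .seq P Q => P.writesNat a || Q.writesNat a
  | .ifZero _ P Q => P.writesNat a || Q.writesNat a
  | .ifLt _ _ P Q => P.writesNat a || Q.writesNat a
  | .loop x _ P => a == x || P.writesNat a

/-- Whether a program may write into the complex array `a`. -/
def Program.writesArr (a : ℕ) : Program → Bool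
  | .skip => false
  | .setNat _ _ _ => false
  | .setArr b _ _ _ => a == b
  | .roots _ b _ => a == b
  | .seq P Q => P.writesArr a || Q.writesArr a
  | .ifZero _ P Q => P.writesArr a || Q.writesArr a
  | .ifLt _ _ P Q => P.writesArr a || Q.writesArr a
  | .loop _ _ P => P.writesArr a

@[simp] theorem Memory.setNat_nat (s : Memory) (a i v b k : ℕ) :
    (s.setNat a i v).nat b k = if b = a ∧ k = i then v else s.nat b k := rfl

@[simp] theorem Memory.setNat_arr (s : Memory) (a i v : ℕ) : (s.setNat a i v).arr = s.arr := rfl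

@[simp] theorem Memory.setArr_nat (s : Memory) (a i j : ℕ) (v : ℂ) :
    (s.setArr a i j v).nat = s.nat := rfl

@[simp] theorem Memory.setArr_arr (s : Memory) (a i j : ℕ) (v : ℂ) (b k l : ℕ) :
    (s.setArr a i j v).arr b k l = if b = a ∧ k = i ∧ l = j then v else s.arr b k l := rfl

theorem Memory.setNat_nat_of_ne (s : Memory) {a b : ℕ} (i v : ℕ) (h : b ≠ a) :
    (s.setNat a i v).nat b = s.nat b := by
  funext k; simp [h]

theorem Memory.setArr_arr_of_ne (s : Memory) {a b : ℕ} (i j : ℕ) (v : ℂ) (h : b ≠ a) :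
    (s.setArr a i j v).arr b = s.arr b := by
  funext k l; simp [h]

theorem iter_induct {f : ℕ → Memory → Memory} {n : ℕ} {s : Memory} (I : ℕ → Memory → Prop)
    (h0 : I 0 s) (hs : ∀ k s', k < n → I k s' → I (k + 1) (f k s')) : I n (iter f n s) := by
  induction n with
  | zero => exact h0
  | succ n ih => exact hs n _ (by omega) (ih fun k s' hk => hs k s' (by omega))

/-- The hypothesis is decidable and for concrete programs holds by `rfl`. All frame conditions are
discharged in this way. -/
theorem Program.run_nat (R : RootFinder) {a : ℕ} :
    ∀ {P : Program}, P.writesNat a = false → ∀ s : Memory, (P.run R s).nat a = s.nat a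
  | .skip, _, _ => rfl
  | .setNat b i e, h, s => by
      simp only [Program.writesNat, beq_eq_false_iff_ne] at h
      exact Memory.setNat_nat_of_ne _ _ _ h
  | .setArr _ _ _ _, _, _ => rfl
  | .roots _ _ _, _, _ => rfl
  | .seq P Q, h, s => by
      simp only [Program.writesNat, Bool.or_eq_false_iff] at h
      rw [Program.run, run_nat R h.2, run_nat R h.1]
  | .ifZero e P Q, h, s => by
      simp only [Program.writesNat, Bool.or_eq_false_iff] at h
      rw [Program.run]; split_ifs
      · exact run_nat R h.1 s
      · exact run_nat R h.2 s
  | .ifLt e f P Q, h, s => by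
      simp only [Program.writesNat, Bool.or_eq_false_iff] at h
      rw [Program.run]; split_ifs
      · exact run_nat R h.1 s
      · exact run_nat R h.2 s
  | .loop x e P, h, s => by
      simp only [Program.writesNat, Bool.or_eq_false_iff, beq_eq_false_iff_ne] at h
      rw [Program.run]
      refine iter_induct (fun _ s' => s'.nat a = s.nat a) rfl fun k s' _ hs => ?_
      rw [run_nat R h.2, Memory.setNat_nat_of_ne _ _ _ h.1, hs]

theorem Program.run_arr (R : RootFinder) {a : ℕ} :
    ∀ {P : Program}, P.writesArr a = false → ∀ s : Memory, (P.run R s).arr a = s.arr a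
  | .skip, _, _ => rfl
  | .setNat b i e, _, s => rfl
  | .setArr _ _ _ _, h, s => by
      simp only [Program.writesArr, beq_eq_false_iff_ne] at h
      exact Memory.setArr_arr_of_ne _ _ _ _ h
  | .roots _ _ _, h, s => by
      simp only [Program.writesArr, beq_eq_false_iff_ne] at h
      funext i k
      simp [Program.run, Memory.storeRoots, h]
  | .seq P Q, h, s => by
      simp only [Program.writesArr, Bool.or_eq_false_iff] at h
      rw [Program.run, run_arr R h.2, run_arr R h.1]
  | .ifZero e P Q, h, s => by
      simp only [Program.writesArr, Bool.or_eq_false_iff] at h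
      rw [Program.run]; split_ifs
      · exact run_arr R h.1 s
      · exact run_arr R h.2 s
  | .ifLt e f P Q, h, s => by
      simp only [Program.writesArr, Bool.or_eq_false_iff] at h
      rw [Program.run]; split_ifs
      · exact run_arr R h.1 s
      · exact run_arr R h.2 s
  | .loop x e P, h, s => by
      simp only [Program.writesArr] at h
      rw [Program.run]
      refine iter_induct (fun _ s' => s'.arr a = s.arr a) rfl fun k s' _ hs => ?_
      rw [run_arr R h, Memory.setNat_arr, hs]

/-- Loop invariants; arrays that the body does not write keep their value throughout. -/
theorem Program.loop_induct (R : RootFinder) {x : ℕ} {e : NExp} {P : Program} {s : Memory}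
    (n : ℕ) (hn : e.eval s = n) (I : ℕ → Memory → Prop) (h0 : I 0 s)
    (hs : ∀ k s', k < n → (∀ a, (x == a || P.writesNat a) = false → s'.nat a = s.nat a) →
      (∀ a, P.writesArr a = false → s'.arr a = s.arr a) → I k s' →
      I (k + 1) (P.run R (s'.setNat x 0 k))) : I n ((Program.loop x e P).run R s) := by
  subst hn
  have := iter_induct (f := fun k s' => P.run R (s'.setNat x 0 k)) (n := e.eval s) (s := s)
    (fun k s' => (∀ a, (x == a || P.writesNat a) = false → s'.nat a = s.nat a) ∧
      (∀ a, P.writesArr a = false → s'.arr a = s.arr a) ∧ I k s')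
    ⟨fun _ _ => rfl, fun _ _ => rfl, h0⟩ (by
      rintro k s' hk ⟨h1, h2, h3⟩
      refine ⟨fun a ha => ?_, fun a ha => ?_, hs k s' hk h1 h2 h3⟩
      · have ha' := ha
        simp only [Bool.or_eq_false_iff, beq_eq_false_iff_ne] at ha'
        rw [Program.run_nat R ha'.2, Memory.setNat_nat_of_ne _ _ _ (Ne.symm ha'.1), h1 a ha]
      · rw [Program.run_arr R ha, Memory.setNat_arr, h2 a ha])
  exact this.2.2

/-! ### Bounds for the running time -/

/-- All loop bounds of the program are `nat a 0` with `ro a`, and no array `a` with `ro a` is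
written. -/
def Program.LoopsIn (ro : ℕ → Bool) : Program → Bool
  | .skip => true
  | .setNat b _ _ => !ro b
  | .setArr _ _ _ _ => true
  | .roots _ _ _ => true
  | .seq P Q => P.LoopsIn ro && Q.LoopsIn ro
  | .ifZero _ P Q => P.LoopsIn ro && Q.LoopsIn ro
  | .ifLt _ _ P Q => P.LoopsIn ro && Q.LoopsIn ro
  | .loop x (.read a (.const 0)) P => !ro x && ro a && P.LoopsIn ro
  | .loop _ _ _ => false

/-- An upper bound for the running time, without the charges for root finding, of a program whose
loops have bounds `nat a 0 ≤ b a`. -/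
def Program.maxCost (b : ℕ → ℕ) : Program → ℕ
  | .skip => 1
  | .setNat _ i e => i.cost + e.cost + 1
  | .setArr _ i j e => i.cost + j.cost + e.cost + 1
  | .roots _ _ d => d.cost + 1
  | .seq P Q => P.maxCost b + Q.maxCost b
  | .ifZero e P Q => e.cost + 1 + (P.maxCost b + Q.maxCost b)
  | .ifLt e f P Q => e.cost + f.cost + 1 + (P.maxCost b + Q.maxCost b)
  | .loop _ (.read a _) P => 3 + b a * (1 + P.maxCost b)
  | .loop _ _ _ => 0

/-- The total charge for the root-finding instructions executed by a program, apart from the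
evaluation of the degrees. -/
noncomputable def Program.rootCost (R : RootFinder) : Program → Memory → ℕ
  | .skip, _ => 0
  | .setNat _ _ _, _ => 0
  | .setArr _ _ _ _, _ => 0
  | .roots _ _ d, s => (d.eval s) ^ 3
  | .seq P Q, s => P.rootCost R s + Q.rootCost R (P.run R s)
  | .ifZero e P Q, s => open Classical in if e.eval s = 0 then P.rootCost R s else Q.rootCost R s
  | .ifLt e f P Q, s => if e.eval s < f.eval s then P.rootCost R s else Q.rootCost R s
  | .loop x e P, s => ∑ k ∈ Finset.range (e.eval s), P.rootCost R
        ((iter (fun k s' => Program.run R P (s'.setNat x 0 k)) k s).setNat x 0 k)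

/-- Whether a program contains root-finding instructions. -/
def Program.hasRoots : Program → Bool
  | .skip => false
  | .setNat _ _ _ => false
  | .setArr _ _ _ _ => false
  | .roots _ _ _ => true
  | .seq P Q => P.hasRoots || Q.hasRoots
  | .ifZero _ P Q => P.hasRoots || Q.hasRoots
  | .ifLt _ _ P Q => P.hasRoots || Q.hasRoots
  | .loop _ _ P => P.hasRoots

theorem Program.rootCost_eq_zero (R : RootFinder) :
    ∀ {P : Program}, P.hasRoots = false → ∀ s : Memory, P.rootCost R s = 0
  | .skip, _, _ => rfl
  | .setNat _ _ _, _, _ => rfl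
  | .setArr _ _ _ _, _, _ => rfl
  | .roots _ _ _, h, _ => by simp [Program.hasRoots] at h
  | .seq P Q, h, s => by
      simp only [Program.hasRoots, Bool.or_eq_false_iff] at h
      rw [Program.rootCost, rootCost_eq_zero R h.1, rootCost_eq_zero R h.2]
  | .ifZero e P Q, h, s => by
      simp only [Program.hasRoots, Bool.or_eq_false_iff] at h
      rw [Program.rootCost, rootCost_eq_zero R h.1, rootCost_eq_zero R h.2, ite_self]
  | .ifLt e f P Q, h, s => by
      simp only [Program.hasRoots, Bool.or_eq_false_iff] at h
      rw [Program.rootCost, rootCost_eq_zero R h.1, rootCost_eq_zero R h.2, ite_self]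
  | .loop x e P, h, s => by
      simp only [Program.hasRoots] at h
      rw [Program.rootCost]
      exact Finset.sum_eq_zero fun k _ => rootCost_eq_zero R h _

theorem Program.writesNat_of_loopsIn {ro : ℕ → Bool} {a : ℕ} (ha : ro a = true) :
    ∀ {P : Program}, P.LoopsIn ro = true → P.writesNat a = false
  | .skip, _ => rfl
  | .setNat b _ _, h => by
      simp only [Program.LoopsIn, Bool.not_eq_true'] at h
      simp only [Program.writesNat, beq_eq_false_iff_ne]
      rintro rfl; simp [ha] at h
  | .setArr _ _ _ _, _ => rfl
  | .roots _ _ _, _ => rfl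
  | .seq P Q, h => by
      simp only [Program.LoopsIn, Bool.and_eq_true] at h
      simp [Program.writesNat, writesNat_of_loopsIn ha h.1, writesNat_of_loopsIn ha h.2]
  | .ifZero _ P Q, h => by
      simp only [Program.LoopsIn, Bool.and_eq_true] at h
      simp [Program.writesNat, writesNat_of_loopsIn ha h.1, writesNat_of_loopsIn ha h.2]
  | .ifLt _ _ P Q, h => by
      simp only [Program.LoopsIn, Bool.and_eq_true] at h
      simp [Program.writesNat, writesNat_of_loopsIn ha h.1, writesNat_of_loopsIn ha h.2]
  | .loop x (.read b (.const 0)) P, h => by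
      simp only [Program.LoopsIn, Bool.and_eq_true, Bool.not_eq_true'] at h
      simp only [Program.writesNat, writesNat_of_loopsIn ha h.2, Bool.or_false,
        beq_eq_false_iff_ne]
      rintro rfl; simp [ha] at h
  | .loop _ (.const _) _, h => by simp [Program.LoopsIn] at h
  | .loop _ (.add _ _) _, h => by simp [Program.LoopsIn] at h
  | .loop _ (.sub _ _) _, h => by simp [Program.LoopsIn] at h
  | .loop _ (.read _ (.const (_ + 1))) _, h => by simp [Program.LoopsIn] at h
  | .loop _ (.read _ (.add _ _)) _, h => by simp [Program.LoopsIn] at h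
  | .loop _ (.read _ (.sub _ _)) _, h => by simp [Program.LoopsIn] at h
  | .loop _ (.read _ (.read _ _)) _, h => by simp [Program.LoopsIn] at h

/-- The bounds of loops are never overwritten, so the number of passes can be bounded from the
initial memory alone; of a conditional both branches are counted. Only the degrees of polynomials
depend on computed data, and their charge stays separate. -/
theorem Program.cost_le (R : RootFinder) {ro : ℕ → Bool} {b : ℕ → ℕ} :
    ∀ {P : Program}, P.LoopsIn ro = true → ∀ {s : Memory},
      (∀ a, ro a = true → s.nat a 0 ≤ b a) → P.cost R s ≤ P.maxCost b + P.rootCost R s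
  | .skip, _, _, _ => le_rfl
  | .setNat _ _ _, _, _, _ => le_rfl
  | .setArr _ _ _ _, _, _, _ => le_rfl
  | .roots _ _ d, _, _, _ => by simp only [Program.cost, Program.maxCost, Program.rootCost]; omega
  | .seq P Q, h, s, hs => by
      simp only [Program.LoopsIn, Bool.and_eq_true] at h
      have h1 := cost_le R h.1 hs
      have h2 := cost_le R h.2 (s := P.run R s) (b := b) fun a ha => by
        rw [Program.run_nat R (writesNat_of_loopsIn ha h.1)]; exact hs a ha
      simp only [Program.cost, Program.maxCost, Program.rootCost]; omega
  | .ifZero e P Q, h, s, hs => by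
      simp only [Program.LoopsIn, Bool.and_eq_true] at h
      have h1 := cost_le R h.1 hs
      have h2 := cost_le R h.2 hs
      simp only [Program.cost, Program.maxCost, Program.rootCost]; split_ifs <;> omega
  | .ifLt e f P Q, h, s, hs => by
      simp only [Program.LoopsIn, Bool.and_eq_true] at h
      have h1 := cost_le R h.1 hs
      have h2 := cost_le R h.2 hs
      simp only [Program.cost, Program.maxCost, Program.rootCost]; split_ifs <;> omega
  | .loop x (.read a (.const 0)) P, h, s, hs => by
      simp only [Program.LoopsIn, Bool.and_eq_true, Bool.not_eq_true'] at h
      obtain ⟨⟨hx, ha⟩, hP⟩ := h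
      simp only [Program.cost, Program.maxCost, Program.rootCost, NExp.cost, NExp.eval]
      -- The bounds of inner loops are the same at the start of every pass.
      have key : ∀ k, ∀ a, ro a = true →
          ((iter (fun k s' => Program.run R P (s'.setNat x 0 k)) k s).setNat x 0 k).nat a 0 ≤ b a :=
        by
        intro k a ha
        have hne : a ≠ x := by rintro rfl; simp [ha] at hx
        rw [Memory.setNat_nat_of_ne _ _ _ hne]
        refine iter_induct (fun _ s' => s'.nat a 0 ≤ b a) (hs a ha) fun k s' _ hs' => ?_
        rwa [Program.run_nat R (writesNat_of_loopsIn ha hP), Memory.setNat_nat_of_ne _ _ _ hne]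
      have h1 : ∀ k ∈ Finset.range (s.nat a 0), 1 + P.cost R
          ((iter (fun k s' => Program.run R P (s'.setNat x 0 k)) k s).setNat x 0 k) ≤
          (1 + P.maxCost b) + P.rootCost R
          ((iter (fun k s' => Program.run R P (s'.setNat x 0 k)) k s).setNat x 0 k) := by
        intro k _
        have := cost_le R hP (key k)
        omega
      have h2 := (Finset.sum_le_sum h1).trans_eq Finset.sum_add_distrib
      rw [Finset.sum_const, Finset.card_range, smul_eq_mul] at h2
      have h3 := Nat.mul_le_mul_right (1 + P.maxCost b) (hs a ha)
      omega
  | .loop _ (.const _) _, h, _, _ => by simp [Program.LoopsIn] at h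
  | .loop _ (.add _ _) _, h, _, _ => by simp [Program.LoopsIn] at h
  | .loop _ (.sub _ _) _, h, _, _ => by simp [Program.LoopsIn] at h
  | .loop _ (.read _ (.const (_ + 1))) _, h, _, _ => by simp [Program.LoopsIn] at h
  | .loop _ (.read _ (.add _ _)) _, h, _, _ => by simp [Program.LoopsIn] at h
  | .loop _ (.read _ (.sub _ _)) _, h, _, _ => by simp [Program.LoopsIn] at h
  | .loop _ (.read _ (.read _ _)) _, h, _, _ => by simp [Program.LoopsIn] at h

/-- The nesting depth of loops. -/
def Program.depth : Program → ℕ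
  | .seq P Q => max P.depth Q.depth
  | .ifZero _ P Q => max P.depth Q.depth
  | .ifLt _ _ P Q => max P.depth Q.depth
  | .loop _ _ P => P.depth + 1
  | _ => 0

/-- Each level of nesting contributes one factor `B`, and `1 ≤ B` absorbs the lower powers. The
constant is the cost with all loop bounds equal to one. -/
theorem Program.maxCost_le (B : ℕ) (hB : 1 ≤ B) : ∀ (P : Program),
    P.maxCost (fun _ => B) ≤ P.maxCost (fun _ => 1) * B ^ P.depth
  | .skip => by simp [Program.maxCost, Program.depth]
  | .setNat _ _ _ => by simp [Program.maxCost, Program.depth]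
  | .setArr _ _ _ _ => by simp [Program.maxCost, Program.depth]
  | .roots _ _ _ => by simp [Program.maxCost, Program.depth]
  | .seq P Q => by
      have h1 := maxCost_le B hB P
      have h2 := maxCost_le B hB Q
      have e1 : B ^ P.depth ≤ B ^ max P.depth Q.depth := Nat.pow_le_pow_right hB (le_max_left _ _)
      have e2 : B ^ Q.depth ≤ B ^ max P.depth Q.depth := Nat.pow_le_pow_right hB (le_max_right _ _)
      simp only [Program.maxCost, Program.depth]
      nlinarith [Nat.mul_le_mul_left (P.maxCost fun _ => 1) e1,
        Nat.mul_le_mul_left (Q.maxCost fun _ => 1) e2]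
  | .ifZero e P Q => by
      have h1 := maxCost_le B hB P
      have h2 := maxCost_le B hB Q
      have e1 : B ^ P.depth ≤ B ^ max P.depth Q.depth := Nat.pow_le_pow_right hB (le_max_left _ _)
      have e2 : B ^ Q.depth ≤ B ^ max P.depth Q.depth := Nat.pow_le_pow_right hB (le_max_right _ _)
      have e0 : 1 ≤ B ^ max P.depth Q.depth := Nat.one_le_pow _ _ hB
      simp only [Program.maxCost, Program.depth]
      nlinarith [Nat.mul_le_mul_left (P.maxCost fun _ => 1) e1,
        Nat.mul_le_mul_left (Q.maxCost fun _ => 1) e2, Nat.mul_le_mul_left (e.cost + 1) e0]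
  | .ifLt e f P Q => by
      have h1 := maxCost_le B hB P
      have h2 := maxCost_le B hB Q
      have e1 : B ^ P.depth ≤ B ^ max P.depth Q.depth := Nat.pow_le_pow_right hB (le_max_left _ _)
      have e2 : B ^ Q.depth ≤ B ^ max P.depth Q.depth := Nat.pow_le_pow_right hB (le_max_right _ _)
      have e0 : 1 ≤ B ^ max P.depth Q.depth := Nat.one_le_pow _ _ hB
      simp only [Program.maxCost, Program.depth]
      nlinarith [Nat.mul_le_mul_left (P.maxCost fun _ => 1) e1,
        Nat.mul_le_mul_left (Q.maxCost fun _ => 1) e2,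
        Nat.mul_le_mul_left (e.cost + f.cost + 1) e0]
  | .loop x (.read a i) P => by
      have h1 := maxCost_le B hB P
      have e0 : 1 ≤ B ^ P.depth := Nat.one_le_pow _ _ hB
      simp only [Program.maxCost, Program.depth, pow_succ]
      nlinarith [Nat.mul_le_mul_left B h1, Nat.mul_le_mul hB e0, Nat.mul_le_mul_left B e0]
  -- Loops with other kinds of bounds have `maxCost` zero by convention; `LoopsIn` excludes them.
  | .loop _ (.const _) _ => by simp [Program.maxCost]
  | .loop _ (.add _ _) _ => by simp [Program.maxCost]
  | .loop _ (.sub _ _) _ => by simp [Program.maxCost]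

end ComplexRAM

namespace ComplexRAM

/-! ### Elementary similarity transformations

A matrix `A` of size `n` is transformed together with the two matrices of the change of basis: if
`Q = P⁻¹`, the blocks of `[[Q A P, Q], [P, 0]]` change by column operations on the first `n` columns
and by the inverse row operations on the first `n` rows. -/

/-- Add `κ` times the `q`-th basis vector to the `p`-th one, in a matrix of size `m`. -/
def addConj (m p q : ℕ) (κ : ℂ) (G : ℕ → ℕ → ℂ) : ℕ → ℕ → ℂ :=
  let F : ℕ → ℕ → ℂ := fun i j => if i < m ∧ j = p then G i j + κ * G i q else G i j
  fun i j => if i = q ∧ j < m then F i j - κ * F p j else F i j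

/-- Multiply the `p`-th basis vector by `κ`, in a matrix of size `m`. -/
noncomputable def scaleConj (m p : ℕ) (κ : ℂ) (G : ℕ → ℕ → ℂ) : ℕ → ℕ → ℂ :=
  let F : ℕ → ℕ → ℂ := fun i j => if i < m ∧ j = p then κ * G i j else G i j
  fun i j => if i = p ∧ j < m then F i j / κ else F i j

theorem addConj_apply {m p q : ℕ} {κ : ℂ} {G : ℕ → ℕ → ℂ} {i j : ℕ} (hi : i < m) (hj : j < m)
    (hp : p < m) : addConj m p q κ G i j =
      (if j = p then G i j + κ * G i q else G i j) -
        if i = q then κ * (if j = p then G p j + κ * G p q else G p j) else 0 := by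
  simp only [addConj, hi, hj, hp, true_and, and_true]
  split_ifs <;> ring

/-- The columns of `G` that are not changed. -/
theorem addConj_col {m p q : ℕ} {κ : ℂ} {G : ℕ → ℕ → ℂ} {i j : ℕ} (hi : i < m) (hj : j < m)
    (hp : p < m) (hjp : j ≠ p) (h : G p j = 0) : addConj m p q κ G i j = G i j := by
  rw [addConj_apply hi hj hp]; simp [hjp, h]

theorem addConj_row {m p q : ℕ} {κ : ℂ} {G : ℕ → ℕ → ℂ} {i j : ℕ} (hi : i < m) (hj : j < m)
    (hp : p < m) (hjp : j ≠ p) (h : i ≠ q) : addConj m p q κ G i j = G i j := by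
  rw [addConj_apply hi hj hp]; simp [hjp, h]

theorem scaleConj_apply {m p : ℕ} {κ : ℂ} {G : ℕ → ℕ → ℂ} {i j : ℕ} (hi : i < m) (hj : j < m)
    (hκ : κ ≠ 0) : scaleConj m p κ G i j =
      if i = p then (if j = p then G i j else G i j / κ) else if j = p then κ * G i j else G i j := by
  simp only [scaleConj, hi, hj, true_and, and_true]
  split_ifs <;> field_simp

/-- `G` is `[[Q A P, Q], [P, *]]` for some `P` and `Q = P⁻¹`. -/
def IsConj {n : ℕ} (A : Matrix (Fin n) (Fin n) ℂ) (G : ℕ → ℕ → ℂ) : Prop :=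
  ∃ P Q : Matrix (Fin n) (Fin n) ℂ, P * Q = 1 ∧ ∀ i j : Fin n,
    G i j = (Q * A * P) i j ∧ G i (n + j) = Q i j ∧ G (n + i) j = P i j

/-- `P` is multiplied on the right by a transvection and `Q` on the left by its inverse. Working on
all `2 * n` rows and columns performs this on `Q A P` and on both borders at once. -/
theorem IsConj.addConj {n : ℕ} {A : Matrix (Fin n) (Fin n) ℂ} {G : ℕ → ℕ → ℂ} (h : IsConj A G)
    {p q : ℕ} (hp : p < n) (hq : q < n) (hpq : p ≠ q) (κ : ℂ) :
    IsConj A (addConj (2 * n) p q κ G) := by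
  obtain ⟨P, Q, hPQ, hG⟩ := h
  have hpq' : (⟨q, hq⟩ : Fin n) ≠ ⟨p, hp⟩ := by simpa [Fin.ext_iff] using hpq.symm
  refine ⟨P * Matrix.transvection ⟨q, hq⟩ ⟨p, hp⟩ κ, Matrix.transvection ⟨q, hq⟩ ⟨p, hp⟩ (-κ) * Q,
    ?_, fun i j => ?_⟩
  · rw [Matrix.mul_assoc, ← Matrix.mul_assoc _ _ Q,
      Matrix.transvection_mul_transvection_same _ _ hpq', add_neg_cancel, Matrix.transvection_zero,
      Matrix.one_mul, hPQ]
  · have hi := i.2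
    have hj := j.2
    obtain ⟨h1, h2, h3⟩ := hG i j
    have e1 := (hG i ⟨q, hq⟩).1
    have e2 := (hG ⟨p, hp⟩ j).1
    have e3 := (hG ⟨p, hp⟩ ⟨q, hq⟩).1
    have e4 := (hG ⟨p, hp⟩ j).2.1
    have e5 := (hG i ⟨q, hq⟩).2.2
    have e6 := (hG ⟨p, hp⟩ ⟨p, hp⟩).1
    simp only at e1 e2 e3 e4 e5 e6
    refine ⟨?_, ?_, ?_⟩
    · have : Matrix.transvection ⟨q, hq⟩ ⟨p, hp⟩ (-κ) * Q * A *
          (P * Matrix.transvection ⟨q, hq⟩ ⟨p, hp⟩ κ) =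
          Matrix.transvection ⟨q, hq⟩ ⟨p, hp⟩ (-κ) *
            ((Q * A * P) * Matrix.transvection ⟨q, hq⟩ ⟨p, hp⟩ κ) := by
        simp only [Matrix.mul_assoc]
      rw [this, addConj_apply (by omega) (by omega) (by omega)]
      by_cases hjp : j = ⟨p, hp⟩
      · subst hjp
        by_cases hiq : i = ⟨q, hq⟩
        · subst hiq
          rw [Matrix.transvection_mul_apply_same, Matrix.mul_transvection_apply_same,
            Matrix.mul_transvection_apply_same]
          simp [h1, e1, e3, e6]; ring
        · rw [Matrix.transvection_mul_apply_of_ne _ _ _ _ hiq, Matrix.mul_transvection_apply_same]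
          have : (i : ℕ) ≠ q := fun h => hiq (Fin.ext h)
          simp [h1, e1, this]
      · have hj' : (j : ℕ) ≠ p := fun h => hjp (Fin.ext h)
        by_cases hiq : i = ⟨q, hq⟩
        · subst hiq
          rw [Matrix.transvection_mul_apply_same, Matrix.mul_transvection_apply_of_ne _ _ _ _ hjp,
            Matrix.mul_transvection_apply_of_ne _ _ _ _ hjp]
          simp [h1, e2, hj']; ring
        · rw [Matrix.transvection_mul_apply_of_ne _ _ _ _ hiq,
            Matrix.mul_transvection_apply_of_ne _ _ _ _ hjp]
          have : (i : ℕ) ≠ q := fun h => hiq (Fin.ext h)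
          simp [h1, this, hj']
    · rw [addConj_apply (by omega) (by omega) (by omega)]
      have : n + (j : ℕ) ≠ p := by omega
      by_cases hiq : i = ⟨q, hq⟩
      · subst hiq
        rw [Matrix.transvection_mul_apply_same]
        simp [h2, e4, this]; ring
      · rw [Matrix.transvection_mul_apply_of_ne _ _ _ _ hiq]
        have hh : (i : ℕ) ≠ q := fun h => hiq (Fin.ext h)
        simp [h2, this, hh]
    · rw [addConj_apply (by omega) (by omega) (by omega)]
      have : n + (i : ℕ) ≠ q := by omega
      by_cases hjp : j = ⟨p, hp⟩
      · subst hjp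
        rw [Matrix.mul_transvection_apply_same]
        simp [h3, e5, this]
      · rw [Matrix.mul_transvection_apply_of_ne _ _ _ _ hjp]
        have hj' : (j : ℕ) ≠ p := fun h => hjp (Fin.ext h)
        simp [h3, this, hj']

theorem IsConj.scaleConj {n : ℕ} {A : Matrix (Fin n) (Fin n) ℂ} {G : ℕ → ℕ → ℂ} (h : IsConj A G)
    {p : ℕ} (hp : p < n) {κ : ℂ} (hκ : κ ≠ 0) : IsConj A (scaleConj (2 * n) p κ G) := by
  obtain ⟨P, Q, hPQ, hG⟩ := h
  refine ⟨P * Matrix.diagonal fun i => if i = ⟨p, hp⟩ then κ else 1,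
    (Matrix.diagonal fun i => if i = ⟨p, hp⟩ then κ⁻¹ else 1) * Q, ?_, fun i j => ?_⟩
  · rw [Matrix.mul_assoc, ← Matrix.mul_assoc _ _ Q, Matrix.diagonal_mul_diagonal]
    have : (fun i : Fin n => (if i = ⟨p, hp⟩ then κ else 1) * if i = ⟨p, hp⟩ then κ⁻¹ else 1) =
        fun _ => 1 := by
      funext i; split_ifs <;> simp [hκ]
    rw [this, Matrix.diagonal_one, Matrix.one_mul, hPQ]
  · have hi := i.2
    have hj := j.2
    obtain ⟨h1, h2, h3⟩ := hG i j
    refine ⟨?_, ?_, ?_⟩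
    · have : (Matrix.diagonal fun i => if i = ⟨p, hp⟩ then κ⁻¹ else 1) * Q * A *
          (P * Matrix.diagonal fun i => if i = ⟨p, hp⟩ then κ else 1) =
          (Matrix.diagonal fun i => if i = ⟨p, hp⟩ then κ⁻¹ else 1) *
            ((Q * A * P) * Matrix.diagonal fun i => if i = ⟨p, hp⟩ then κ else 1) := by
        simp only [Matrix.mul_assoc]
      rw [this, scaleConj_apply (by omega) (by omega) hκ, Matrix.diagonal_mul,
        Matrix.mul_diagonal, ← h1]
      simp only [Fin.ext_iff]
      split_ifs <;> field_simp
    · rw [scaleConj_apply (by omega) (by omega) hκ, Matrix.diagonal_mul, ← h2]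
      have : n + (j : ℕ) ≠ p := by omega
      simp only [Fin.ext_iff, this, if_false]
      split_ifs <;> field_simp
    · rw [scaleConj_apply (by omega) (by omega) hκ, Matrix.mul_diagonal, ← h3]
      have : n + (i : ℕ) ≠ p := by omega
      simp only [Fin.ext_iff, this, if_false]
      split_ifs <;> field_simp

/-! ### Programs for the elementary transformations

The sizes `n` and `2 * n` are held in `nat 1 0` and `nat 2 0`, the matrix is array `10`. -/

/-- The index variable held in `nat a 0`. -/
abbrev nv (a : ℕ) : NExp := .read a (.const 0)

/-- The complex variable held in `arr a 0 0`. -/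
abbrev cv (a : ℕ) : CExp := .read a (.const 0) (.const 0)

/-- The program `addConj`, with `p`, `q`, `κ` held in `nat 11 0`, `nat 12 0`, `arr 11 0 0`. -/
def addConjCore : Program :=
  .seq
    (.loop 13 (nv 2) (.setArr 10 (nv 13) (nv 11)
      (.add (.read 10 (nv 13) (nv 11)) (.mul (cv 11) (.read 10 (nv 13) (nv 12))))))
    (.loop 13 (nv 2) (.setArr 10 (nv 12) (nv 13)
      (.sub (.read 10 (nv 12) (nv 13)) (.mul (cv 11) (.read 10 (nv 11) (nv 13))))))

/-- Add `κ` times the basis vector `q` to the basis vector `p`. -/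
def addConjProg (p q : NExp) (κ : CExp) : Program :=
  .seq (.setNat 11 (.const 0) p) (.seq (.setNat 12 (.const 0) q)
    (.seq (.setArr 11 (.const 0) (.const 0) κ) addConjCore))

/-- The program `scaleConj`, with `p`, `κ` held in `nat 11 0`, `arr 11 0 0`. -/
def scaleConjCore : Program :=
  .seq
    (.loop 13 (nv 2) (.setArr 10 (nv 13) (nv 11)
      (.mul (cv 11) (.read 10 (nv 13) (nv 11)))))
    (.loop 13 (nv 2) (.setArr 10 (nv 11) (nv 13)
      (.div (.read 10 (nv 11) (nv 13)) (cv 11))))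

/-- Multiply the basis vector `p` by `κ`. -/
def scaleConjProg (p : NExp) (κ : CExp) : Program :=
  .seq (.setNat 11 (.const 0) p)
    (.seq (.setArr 11 (.const 0) (.const 0) κ) scaleConjCore)

/-- The array is updated in place. Since the two indices differ, neither the column read by the
first loop nor the row read by the second is being overwritten. -/
theorem addConjCore_run (R : RootFinder) (s : Memory) (h : s.nat 11 0 ≠ s.nat 12 0) :
    (addConjCore.run R s).arr 10 =
      addConj (s.nat 2 0) (s.nat 11 0) (s.nat 12 0) (s.arr 11 0 0) (s.arr 10) := by
  rw [addConjCore, Program.run]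
  set F : ℕ → ℕ → ℂ := fun i j => if i < s.nat 2 0 ∧ j = s.nat 11 0 then
    s.arr 10 i j + s.arr 11 0 0 * s.arr 10 i (s.nat 12 0) else s.arr 10 i j with hF
  have h1 := Program.loop_induct R (x := 13) (e := nv 2) (P := .setArr 10 (nv 13) (nv 11)
      (.add (.read 10 (nv 13) (nv 11)) (.mul (cv 11) (.read 10 (nv 13) (nv 12))))) (s := s)
    (s.nat 2 0) rfl (fun k s' => s'.arr 10 = fun i j => if i < k ∧ j = s.nat 11 0 then
    s.arr 10 i j + s.arr 11 0 0 * s.arr 10 i (s.nat 12 0) else s.arr 10 i j) (by simp)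
    (by
      intro k s' hk hn ha hI
      have e1 := congrFun (hn 11 rfl) 0
      have e2 := congrFun (hn 12 rfl) 0
      have e3 := congrFun (congrFun (ha 11 rfl) 0) 0
      funext i j
      simp only [Program.run, CExp.eval, NExp.eval, Memory.setArr_arr, Memory.setNat_arr,
        Memory.setNat_nat, e1, e2, e3, hI, true_and]
      have h' : s.nat 12 0 ≠ s.nat 11 0 := h.symm
      simp [h']
      grind)
  set s1 := (Program.loop 13 (nv 2) (.setArr 10 (nv 13) (nv 11)
      (.add (.read 10 (nv 13) (nv 11)) (.mul (cv 11) (.read 10 (nv 13) (nv 12)))))).run R s with hs1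
  have f1 : s1.nat 11 = s.nat 11 := Program.run_nat R rfl s
  have f2 : s1.nat 12 = s.nat 12 := Program.run_nat R rfl s
  have f3 : s1.nat 2 = s.nat 2 := Program.run_nat R rfl s
  have f4 : s1.arr 11 = s.arr 11 := Program.run_arr R rfl s
  rw [← hF] at h1
  refine Program.loop_induct R (x := 13) (e := nv 2) (s := s1)
    (s.nat 2 0) (congrFun f3 0) (fun k s' => s'.arr 10 = fun i j => if i = s.nat 12 0 ∧ j < k then
    F i j - s.arr 11 0 0 * F (s.nat 11 0) j else F i j) (by simpa using h1)
    (by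
      intro k s' hk hn ha hI
      have e1 := congrFun ((hn 11 rfl).trans f1) 0
      have e2 := congrFun ((hn 12 rfl).trans f2) 0
      have e3 := congrFun (congrFun ((ha 11 rfl).trans f4) 0) 0
      funext i j
      simp only [Program.run, CExp.eval, NExp.eval, Memory.setArr_arr, Memory.setNat_arr,
        Memory.setNat_nat, e3, hI, true_and]
      simp [e1, e2, h]
      grind)

theorem scaleConjCore_run (R : RootFinder) (s : Memory) :
    (scaleConjCore.run R s).arr 10 =
      scaleConj (s.nat 2 0) (s.nat 11 0) (s.arr 11 0 0) (s.arr 10) := by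
  rw [scaleConjCore, Program.run]
  set F : ℕ → ℕ → ℂ := fun i j => if i < s.nat 2 0 ∧ j = s.nat 11 0 then
    s.arr 11 0 0 * s.arr 10 i j else s.arr 10 i j with hF
  have h1 := Program.loop_induct R (x := 13) (e := nv 2) (P := .setArr 10 (nv 13) (nv 11)
      (.mul (cv 11) (.read 10 (nv 13) (nv 11)))) (s := s)
    (s.nat 2 0) rfl (fun k s' => s'.arr 10 = fun i j => if i < k ∧ j = s.nat 11 0 then
    s.arr 11 0 0 * s.arr 10 i j else s.arr 10 i j) (by simp)
    (by
      intro k s' hk hn ha hI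
      have e1 := congrFun (hn 11 rfl) 0
      have e3 := congrFun (congrFun (ha 11 rfl) 0) 0
      funext i j
      simp only [Program.run, CExp.eval, NExp.eval, Memory.setArr_arr, Memory.setNat_arr,
        Memory.setNat_nat, e3, hI, true_and]
      simp [e1]
      grind)
  set s1 := (Program.loop 13 (nv 2) (.setArr 10 (nv 13) (nv 11)
      (.mul (cv 11) (.read 10 (nv 13) (nv 11))))).run R s with hs1
  have f1 : s1.nat 11 = s.nat 11 := Program.run_nat R rfl s
  have f3 : s1.nat 2 = s.nat 2 := Program.run_nat R rfl s
  have f4 : s1.arr 11 = s.arr 11 := Program.run_arr R rfl s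
  rw [← hF] at h1
  refine Program.loop_induct R (x := 13) (e := nv 2) (s := s1)
    (s.nat 2 0) (congrFun f3 0) (fun k s' => s'.arr 10 = fun i j => if i = s.nat 11 0 ∧ j < k then
    F i j / s.arr 11 0 0 else F i j) (by simpa using h1)
    (by
      intro k s' hk hn ha hI
      have e1 := congrFun ((hn 11 rfl).trans f1) 0
      have e3 := congrFun (congrFun ((ha 11 rfl).trans f4) 0) 0
      funext i j
      simp only [Program.run, CExp.eval, NExp.eval, Memory.setArr_arr, Memory.setNat_arr,
        Memory.setNat_nat, e3, hI, true_and]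
      simp [e1]
      grind)

/-- The arguments are evaluated one after the other, so the second and the third see a memory in
which the earlier ones have already been stored. -/
theorem addConjProg_run (R : RootFinder) (s : Memory) {p q : NExp} {κ : CExp} {m p' q' : ℕ} {c : ℂ}
    (hm : s.nat 2 0 = m) (hp : p.eval s = p') (hq : q.eval (s.setNat 11 0 p') = q')
    (hκ : κ.eval ((s.setNat 11 0 p').setNat 12 0 q') = c) (h : p' ≠ q') :
    ((addConjProg p q κ).run R s).arr 10 = addConj m p' q' c (s.arr 10) := by
  simp only [addConjProg, Program.run, NExp.eval, hp, hq, hκ]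
  rw [addConjCore_run] <;> simp [hm, h, Memory.setArr_arr_of_ne]

theorem scaleConjProg_run (R : RootFinder) (s : Memory) {p : NExp} {κ : CExp} {m p' : ℕ} {c : ℂ}
    (hm : s.nat 2 0 = m) (hp : p.eval s = p') (hκ : κ.eval (s.setNat 11 0 p') = c) :
    ((scaleConjProg p κ).run R s).arr 10 = scaleConj m p' c (s.arr 10) := by
  simp only [scaleConjProg, Program.run, NExp.eval, hp, hκ]
  rw [scaleConjCore_run]; simp [hm, Memory.setArr_arr_of_ne]

end ComplexRAM

namespace ComplexRAM

/-! ### Danilevsky's reduction to block triangular form with companion blocks -/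

/-- The index `k + 1`, where `k` is held in `nat 16 0`. -/
abbrev nextCol : NExp := .add (nv 16) (.const 1)

/-- Find a nonzero entry below the diagonal in column `k`, and put its row into `nat 20 0`. -/
def pivotSearch : Program :=
  .seq (.setNat 20 (.const 0) (.const 0))
    (.loop 21 (nv 1) (.ifLt (nv 16) (nv 21)
      (.ifZero (.read 10 (nv 21) (nv 16)) .skip (.setNat 20 (.const 0) (nv 21))) .skip))

/-- Make `b_{k+1}` the image of `b_k`. -/
def clearColumn : Program :=
  .loop 22 (nv 1) (.ifLt (nv 22) nextCol
    (addConjProg nextCol (nv 22) (.read 10 (nv 22) (nv 16)))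
    (.ifLt nextCol (nv 22)
      (addConjProg nextCol (nv 22) (.read 10 (nv 22) (nv 16))) .skip))

/-- Treat column `k`. -/
def companionStep : Program :=
  .seq pivotSearch (.ifLt (.const 0) (nv 20)
    (.seq (.ifZero (.read 10 nextCol (nv 16)) (addConjProg (nv 20) nextCol (.const (-1))) .skip)
      (.seq (scaleConjProg nextCol (.read 10 nextCol (nv 16)))
        (.seq clearColumn
          (.seq (.setNat 23 (nv 16) (.const 0)) (.setNat 24 nextCol (.read 24 (nv 16)))))))
    (.seq (.setNat 23 (nv 16) (.const 1)) (.setNat 24 nextCol nextCol)))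

/-- Danilevsky's reduction. Array `nat 23` marks the last columns of the blocks, and `nat 24` holds
the starting position of the block of a column. -/
def companionProg : Program := .loop 16 (nv 1) companionStep

/-- The first `k` columns are in block triangular form with companion blocks. -/
structure IsCompanion (n k : ℕ) (cl st : ℕ → ℕ) (G : ℕ → ℕ → ℂ) : Prop where
  st_zero : st 0 = 0
  st_succ : ∀ c < k, st (c + 1) = if cl c = 0 then st c else c + 1
  lt : ∀ c < k, cl c = 0 → c + 1 < n
  inner : ∀ c < k, cl c = 0 → ∀ i < n, G i c = if i = c + 1 then 1 else 0
  last : ∀ c < k, cl c ≠ 0 → ∀ i < n, c < i → G i c = 0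

theorem IsCompanion.eq_zero {n k : ℕ} {cl st : ℕ → ℕ} {G : ℕ → ℕ → ℂ} (h : IsCompanion n k cl st G)
    {c i : ℕ} (hc : c < k) (hi : i < n) (hci : c + 1 < i) : G i c = 0 := by
  by_cases h0 : cl c = 0
  · rw [h.inner c hc h0 i hi, if_neg (by omega)]
  · exact h.last c hc h0 i hi (by omega)

theorem IsCompanion.eq_zero' {n k : ℕ} {cl st : ℕ → ℕ} {G : ℕ → ℕ → ℂ} (h : IsCompanion n k cl st G)
    {c i : ℕ} (hc : c < k) (hi : i < n) (hci : k < i) : G i c = 0 :=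
  h.eq_zero hc hi (by omega)

theorem IsCompanion.congr {n k : ℕ} {cl st : ℕ → ℕ} {G G' : ℕ → ℕ → ℂ} (h : IsCompanion n k cl st G)
    (hG : ∀ c < k, ∀ i < n, G' i c = G i c) : IsCompanion n k cl st G' where
  st_zero := h.st_zero
  st_succ := h.st_succ
  lt := h.lt
  inner c hc h0 i hi := by rw [hG c hc i hi, h.inner c hc h0 i hi]
  last c hc h0 i hi hci := by rw [hG c hc i hi, h.last c hc h0 i hi hci]

/-- The value `0` can stand for "no pivot", because a pivot row lies below the diagonal and so has a
positive index. -/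
theorem pivotSearch_run (R : RootFinder) (s : Memory) :
    ((pivotSearch.run R s).nat 20 0 = 0 ∧
        ∀ i < s.nat 1 0, s.nat 16 0 < i → s.arr 10 i (s.nat 16 0) = 0) ∨
      (s.nat 16 0 < (pivotSearch.run R s).nat 20 0 ∧ (pivotSearch.run R s).nat 20 0 < s.nat 1 0 ∧
        s.arr 10 ((pivotSearch.run R s).nat 20 0) (s.nat 16 0) ≠ 0) := by
  rw [pivotSearch, Program.run]
  refine Program.loop_induct R (s.nat 1 0) (by simp [Program.run, NExp.eval]) (fun k s' =>
    (s'.nat 20 0 = 0 ∧ ∀ i < k, s.nat 16 0 < i → s.arr 10 i (s.nat 16 0) = 0) ∨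
      (s.nat 16 0 < s'.nat 20 0 ∧ s'.nat 20 0 < s.nat 1 0 ∧
        s.arr 10 (s'.nat 20 0) (s.nat 16 0) ≠ 0)) (by simp [Program.run, NExp.eval]) ?_
  intro k s' hk hn ha hI
  have e1 : s'.nat 16 0 = s.nat 16 0 := by
    rw [hn 16 rfl]; simp [Program.run]
  have e2 : s'.arr 10 = s.arr 10 := by
    rw [ha 10 rfl]; simp [Program.run]
  simp only [Program.run, NExp.eval, CExp.eval, Memory.setNat_nat, Memory.setNat_arr, e1, e2]
  simp only [show (16 : ℕ) ≠ 21 by decide, false_and, if_false, and_self, if_true]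
  split_ifs with h1 h2
  · rcases hI with hI | hI
    · left
      refine ⟨by simpa using hI.1, fun i hi hi' => ?_⟩
      rcases Nat.lt_succ_iff_lt_or_eq.1 hi with hi | rfl
      · exact hI.2 i hi hi'
      · exact h2
    · right; simpa using hI
  · right
    simp [h1, h2, hk]
  · rcases hI with hI | hI
    · left
      refine ⟨by simpa using hI.1, fun i hi hi' => ?_⟩
      rcases Nat.lt_succ_iff_lt_or_eq.1 hi with hi | rfl
      · exact hI.2 i hi hi'
      · exact absurd hi' h1
    · right; simpa using hI

/-- Row `k + 1` has the entry `1` in column `k` and zeros before it. Subtracting multiples of it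
therefore clears column `k` and leaves the earlier columns alone; the inverse column operations
touch only column `k + 1`. -/
theorem clearColumn_run (R : RootFinder) (s : Memory) {n k : ℕ} {A : Matrix (Fin n) (Fin n) ℂ}
    (hn : s.nat 1 0 = n) (h2n : s.nat 2 0 = 2 * n) (hk : s.nat 16 0 = k) (hA : IsConj A (s.arr 10))
    (hkn : k + 1 < n) (h1 : s.arr 10 (k + 1) k = 1) (h0 : ∀ c < k, s.arr 10 (k + 1) c = 0) :
    IsConj A ((clearColumn.run R s).arr 10) ∧
      (∀ c < k, ∀ i < n, (clearColumn.run R s).arr 10 i c = s.arr 10 i c) ∧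
      ∀ i < n, (clearColumn.run R s).arr 10 i k = if i = k + 1 then 1 else 0 := by
  have key := Program.loop_induct R (x := 22) (e := nv 1) (P := .ifLt (nv 22) nextCol
    (addConjProg nextCol (nv 22) (.read 10 (nv 22) (nv 16)))
    (.ifLt nextCol (nv 22)
      (addConjProg nextCol (nv 22) (.read 10 (nv 22) (nv 16))) .skip)) (s := s) n hn
    (fun q s' => IsConj A (s'.arr 10) ∧
      (∀ c < k, ∀ i < n, s'.arr 10 i c = s.arr 10 i c) ∧ s'.arr 10 (k + 1) k = 1 ∧
      ∀ i < n, i < q → i ≠ k + 1 → s'.arr 10 i k = 0)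
    ⟨hA, fun _ _ _ _ => rfl, h1, by simp⟩ ?_
  · refine ⟨key.1, key.2.1, fun i hi => ?_⟩
    split_ifs with h
    · rw [h]; exact key.2.2.1
    · exact key.2.2.2 i hi hi h
  · rintro q s' hq hn' ha ⟨i1, i2, i3, i4⟩
    have e1 : s'.nat 16 0 = k := by rw [hn' 16 rfl, hk]
    have e2 : s'.nat 2 0 = 2 * n := by rw [hn' 2 rfl, h2n]
    have main : q ≠ k + 1 → ∀ s'' : Memory, s'' = (addConjProg nextCol (nv 22)
        (.read 10 (nv 22) (nv 16))).run R (s'.setNat 22 0 q) → IsConj A (s''.arr 10) ∧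
        (∀ c < k, ∀ i < n, s''.arr 10 i c = s.arr 10 i c) ∧ s''.arr 10 (k + 1) k = 1 ∧
        ∀ i < n, i < q + 1 → i ≠ k + 1 → s''.arr 10 i k = 0 := by
      rintro hqk s'' rfl
      rw [addConjProg_run R _ (m := 2 * n) (p' := k + 1) (q' := q) (c := s'.arr 10 q k)
        (by simp [e2]) (by simp [NExp.eval, e1]) (by simp [NExp.eval])
        (by simp [NExp.eval, CExp.eval, e1]) (by omega)]
      simp only [Memory.setNat_arr]
      refine ⟨i1.addConj hkn hq (by omega) _, fun c hc i hi => ?_, ?_, fun i hi hiq hik => ?_⟩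
      · rw [addConj_col (by omega) (by omega) (by omega) (by omega), i2 c hc i hi]
        rw [i2 c hc _ hkn, h0 c hc]
      · rw [addConj_row (by omega) (by omega) (by omega) (by omega) (by omega), i3]
      -- Column `k` itself is not changed by the column operation, so the row operation subtracts `κ
      -- * 1`, with `κ` the entry to be removed.
      · rw [addConj_apply (by omega) (by omega) (by omega), i3]
        rcases Nat.lt_succ_iff_lt_or_eq.1 hiq with hi' | rfl
        · simp [i4 i hi hi' hik, hi'.ne]
        · simp
    simp only [Program.run]
    split_ifs with c1 c2
    · refine main ?_ _ rfl
      simp [NExp.eval, e1] at c1; omega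
    · refine main ?_ _ rfl
      simp [NExp.eval, e1] at c2; omega
    · simp [NExp.eval, e1] at c1 c2
      exact ⟨i1, i2, i3, fun i hi hiq hik => i4 i hi (by omega) hik⟩

/-- If column `k` has no entry below the diagonal, the first `k + 1` basis vectors span an invariant
subspace and a block ends. Otherwise a pivot is brought into row `k + 1`, normalized and used to
clear the column. Rows below `k` vanish in the finished columns, so these survive. -/
theorem companionProg_run (R : RootFinder) (s : Memory) {n : ℕ} {A : Matrix (Fin n) (Fin n) ℂ}
    (hn : s.nat 1 0 = n) (h2n : s.nat 2 0 = 2 * n) (hst : s.nat 24 0 = 0)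
    (hA : IsConj A (s.arr 10)) :
    IsConj A ((companionProg.run R s).arr 10) ∧ IsCompanion n n ((companionProg.run R s).nat 23)
      ((companionProg.run R s).nat 24) ((companionProg.run R s).arr 10) := by
  refine Program.loop_induct R (x := 16) (e := nv 1) n hn (fun k s' => IsConj A (s'.arr 10) ∧
    IsCompanion n k (s'.nat 23) (s'.nat 24) (s'.arr 10)) ⟨hA, hst, by simp, by simp, by simp,
      by simp⟩ ?_
  rintro k s' hk hn' - ⟨i1, i2⟩
  have e1 : s'.nat 1 0 = n := by rw [hn' 1 rfl, hn]
  have e2 : s'.nat 2 0 = 2 * n := by rw [hn' 2 rfl, h2n]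
  rw [companionStep, Program.run]
  have hp := pivotSearch_run R (s'.setNat 16 0 k)
  set s1 := pivotSearch.run R (s'.setNat 16 0 k) with hs1
  have f1 : s1.arr 10 = s'.arr 10 := by rw [hs1, Program.run_arr R rfl]; rfl
  have f2 : s1.nat 16 0 = k := by rw [hs1, Program.run_nat R rfl]; simp
  have f3 : s1.nat 2 0 = 2 * n := by rw [hs1, Program.run_nat R rfl]; simp [e2]
  have f4 : s1.nat 1 0 = n := by rw [hs1, Program.run_nat R rfl]; simp [e1]
  have f5 : s1.nat 23 = s'.nat 23 := by
    rw [hs1, Program.run_nat R rfl, Memory.setNat_nat_of_ne _ _ _ (by decide)]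
  have f6 : s1.nat 24 = s'.nat 24 := by
    rw [hs1, Program.run_nat R rfl, Memory.setNat_nat_of_ne _ _ _ (by decide)]
  simp only [Memory.setNat_nat, Memory.setNat_arr, show (1 : ℕ) ≠ 16 by decide, false_and,
    if_false, and_self, if_true, e1] at hp
  simp only [Program.run, NExp.eval]
  rcases hp with ⟨hp0, hp⟩ | ⟨hp0, hp1, hp⟩
  · simp only [hp0, f2, lt_self_iff_false, if_false, Memory.setNat_arr, Memory.setNat_nat, f1,
      and_true, show (16 : ℕ) ≠ 23 by decide, false_and]
    refine ⟨i1, ?_, ?_, ?_, ?_, ?_⟩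
    · simp [Memory.setNat_nat, f6, i2.st_zero]
    · intro c hc
      rcases Nat.lt_succ_iff_lt_or_eq.1 hc with hc | rfl
      · simp [f5, f6, hc.ne, i2.st_succ c hc, show c ≠ k + 1 by omega]
      · simp
    · intro c hc
      rcases Nat.lt_succ_iff_lt_or_eq.1 hc with hc | rfl
      · simpa [f5, hc.ne] using i2.lt c hc
      · simp
    · intro c hc
      rcases Nat.lt_succ_iff_lt_or_eq.1 hc with hc | rfl
      · simpa [f5, hc.ne] using i2.inner c hc
      · simp
    · intro c hc
      rcases Nat.lt_succ_iff_lt_or_eq.1 hc with hc | rfl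
      · simpa [f5, hc.ne] using i2.last c hc
      · simpa using hp
  · have hpos : 0 < s1.nat 20 0 := by omega
    simp only [hpos, if_true]
    set piv := s1.nat 20 0 with hpiv
    -- the first transformation
    set s2 := (Program.ifZero (.read 10 nextCol (nv 16))
      (addConjProg (nv 20) nextCol (.const (-1))) .skip).run R s1 with hs2
    have hs2' : (if (CExp.read 10 nextCol (nv 16)).eval s1 = 0 then
      (addConjProg (nv 20) nextCol (.const (-1))).run R s1 else s1) = s2 := by
      rw [hs2, Program.run, Program.run]
    have g1 : IsConj A (s2.arr 10) ∧ (∀ c < k, ∀ i < n, s2.arr 10 i c = s'.arr 10 i c) ∧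
        s2.arr 10 (k + 1) k ≠ 0 := by
      rw [← hs2']
      split_ifs with hz
      · have hz' : s'.arr 10 (k + 1) k = 0 := by simpa [CExp.eval, NExp.eval, f1, f2] using hz
        have hne : piv ≠ k + 1 := by rintro h; rw [h] at hp; exact hp hz'
        rw [addConjProg_run R _ (m := 2 * n) (p' := piv) (q' := k + 1) (c := -1)
          f3 (by simp [NExp.eval, hpiv]) (by simp [NExp.eval, f2])
          (by simp [CExp.eval]) hne, f1]
        refine ⟨i1.addConj hp1 (by omega) hne _, fun c hc i hi => ?_, ?_⟩
        · rw [addConj_col (by omega) (by omega) (by omega) (by omega)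
            (i2.eq_zero' hc hp1 hp0)]
        -- With `κ = -1` the row operation adds the pivot row to row `k + 1`, whose entry in column
        -- `k` was zero.
        · rw [addConj_apply (by omega) (by omega) (by omega)]
          simp [hz', hp0.ne, hp]
      · have hz' : s'.arr 10 (k + 1) k ≠ 0 := by simpa [CExp.eval, NExp.eval, f1, f2] using hz
        rw [f1]
        exact ⟨i1, fun _ _ _ _ => rfl, hz'⟩
    rw [hs2']
    have k2 : s2.nat 16 0 = k := by rw [hs2, Program.run_nat R rfl, f2]
    have k3 : s2.nat 2 0 = 2 * n := by rw [hs2, Program.run_nat R rfl, f3]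
    have k4 : s2.nat 1 0 = n := by rw [hs2, Program.run_nat R rfl, f4]
    have k5 : s2.nat 23 = s'.nat 23 := by rw [hs2, Program.run_nat R rfl, f5]
    have k6 : s2.nat 24 = s'.nat 24 := by rw [hs2, Program.run_nat R rfl, f6]
    clear_value s2
    set s3 := (scaleConjProg nextCol (.read 10 nextCol (nv 16))).run R s2 with hs3
    have g2 : IsConj A (s3.arr 10) ∧ (∀ c < k, ∀ i < n, s3.arr 10 i c = s'.arr 10 i c) ∧
        s3.arr 10 (k + 1) k = 1 := by
      obtain ⟨j1, j2, j3⟩ := g1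
      rw [hs3, scaleConjProg_run R _ (m := 2 * n) (p' := k + 1) (c := s2.arr 10 (k + 1) k) k3
        (by simp [NExp.eval, k2]) (by simp [CExp.eval, NExp.eval, k2])]
      refine ⟨j1.scaleConj (by omega) j3, fun c hc i hi => ?_, ?_⟩
      · rw [scaleConj_apply (by omega) (by omega) j3, if_neg (show c ≠ k + 1 by omega),
          if_neg (show c ≠ k + 1 by omega), j2 c hc i hi]
        split_ifs with h
        · rw [h, i2.eq_zero' hc (by omega) (by omega), zero_div]
        · rfl
      · rw [scaleConj_apply (by omega) (by omega) j3]
        simp [j3]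
    have l2 : s3.nat 16 0 = k := by rw [hs3, Program.run_nat R rfl, k2]
    have l3 : s3.nat 2 0 = 2 * n := by rw [hs3, Program.run_nat R rfl, k3]
    have l4 : s3.nat 1 0 = n := by rw [hs3, Program.run_nat R rfl, k4]
    have l5 : s3.nat 23 = s'.nat 23 := by rw [hs3, Program.run_nat R rfl, k5]
    have l6 : s3.nat 24 = s'.nat 24 := by rw [hs3, Program.run_nat R rfl, k6]
    clear_value s3
    obtain ⟨j1, j2, j3⟩ := g2
    obtain ⟨m1, m2, m3⟩ := clearColumn_run R s3 l4 l3 l2 j1 (by omega) j3 (fun c hc => by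
      rw [j2 c hc _ (by omega), i2.eq_zero' hc (by omega) (by omega)])
    set s4 := clearColumn.run R s3 with hs4
    have n2 : s4.nat 16 0 = k := by rw [hs4, Program.run_nat R rfl, l2]
    have n5 : s4.nat 23 = s'.nat 23 := by rw [hs4, Program.run_nat R rfl, l5]
    have n6 : s4.nat 24 = s'.nat 24 := by rw [hs4, Program.run_nat R rfl, l6]
    clear_value s4
    simp only [Memory.setNat_arr, Memory.setNat_nat, n2,
      and_true, show (16 : ℕ) ≠ 23 by decide, show (24 : ℕ) ≠ 23 by decide, false_and, if_false]
    have i3 : IsCompanion n k (s'.nat 23) (s'.nat 24) (s4.arr 10) := i2.congr fun c hc i hi => by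
      rw [m2 c hc i hi, j2 c hc i hi]
    refine ⟨m1, ?_, ?_, ?_, ?_, ?_⟩
    · simp [n6, i2.st_zero]
    · intro c hc
      rcases Nat.lt_succ_iff_lt_or_eq.1 hc with hc | rfl
      · simp [n5, n6, hc.ne, i2.st_succ c hc, show c ≠ k + 1 by omega]
      · simp [n6]
    · intro c hc
      rcases Nat.lt_succ_iff_lt_or_eq.1 hc with hc | rfl
      · simpa [n5, hc.ne] using i3.lt c hc
      · simp; omega
    · intro c hc
      rcases Nat.lt_succ_iff_lt_or_eq.1 hc with hc | rfl
      · simpa [n5, hc.ne] using i3.inner c hc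
      · simpa using m3
    · intro c hc
      rcases Nat.lt_succ_iff_lt_or_eq.1 hc with hc | rfl
      · simpa [n5, hc.ne] using i3.last c hc
      · simp

end ComplexRAM

namespace ComplexRAM

/-! ### The eigenvalues of the companion blocks -/

/-- The size of the block that ends with column `k`. -/
abbrev blockSize : NExp := .sub nextCol (.read 24 (nv 16))

/-- Copy the coefficients of the characteristic polynomial of the block that ends with column `k`. -/
def copyCoeffs : Program :=
  .loop 21 (nv 1) (.ifLt (nv 21) blockSize
    (.setArr 20 (.const 0) (nv 21)
      (.sub (.const 0) (.read 10 (.add (.read 24 (nv 16)) (nv 21)) (nv 16)))) .skip)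

/-- Store the roots of the characteristic polynomial of the block that ends with column `k`. -/
def copyRoots : Program :=
  .loop 21 (nv 1) (.ifLt (nv 21) blockSize
    (.setArr 22 (.const 0) (.add (.read 24 (nv 16)) (nv 21)) (.read 21 (.const 0) (nv 21))) .skip)

/-- Compute the roots of the characteristic polynomial of the block that ends with column `k`. -/
def blockRoots : Program :=
  .seq copyCoeffs (.seq (.roots 20 21 blockSize) copyRoots)

theorem Memory.storeRoots_arr (R : RootFinder) (s : Memory) (a b d : ℕ) {l : ℕ} (hl : l < d) :
    (s.storeRoots R a b d).arr b 0 l = R.find d (fun r => s.arr a 0 r) ⟨l, hl⟩ := by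
  simp [Memory.storeRoots, hl]

/-- Compute the eigenvalues, and store them in array `22`. -/
def rootsProg : Program :=
  .loop 16 (nv 1) (.ifLt (.const 0) (.read 23 (nv 16)) blockRoots .skip)

theorem IsCompanion.st_le {n m : ℕ} {cl st : ℕ → ℕ} {G : ℕ → ℕ → ℂ} (h : IsCompanion n m cl st G)
    {k : ℕ} (hk : k ≤ m) : st k ≤ k := by
  induction k with
  | zero => simp [h.st_zero]
  | succ k ih =>
    have := ih (by omega)
    rw [h.st_succ k (by omega)]; split_ifs <;> omega

/-- Blocks are consecutive intervals: a later block starts only after an earlier one has ended. This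
separates the data of different blocks. -/
theorem IsCompanion.lt_st {n m : ℕ} {cl st : ℕ → ℕ} {G : ℕ → ℕ → ℂ} (h : IsCompanion n m cl st G)
    {c k : ℕ} (hk : k ≤ m) (hck : c < k) (hc : cl c ≠ 0) : c < st k := by
  induction k with
  | zero => omega
  | succ k ih =>
    rw [h.st_succ k (by omega)]
    rcases Nat.lt_succ_iff_lt_or_eq.1 hck with h' | rfl
    · have := ih (by omega) h'
      split_ifs <;> omega
    · simp [hc]

/-- The roots of the characteristic polynomials of the blocks. -/
def IsBlockRoots (k : ℕ) (cl st : ℕ → ℕ) (G : ℕ → ℕ → ℂ) (lam : ℕ → ℂ) : Prop :=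
  ∀ c < k, cl c ≠ 0 →
    (Polynomial.X ^ (c + 1 - st c) + ∑ l : Fin (c + 1 - st c),
        Polynomial.C (-G (st c + l) c) * Polynomial.X ^ (l : ℕ) : Polynomial ℂ) =
      ∏ l : Fin (c + 1 - st c), (Polynomial.X - Polynomial.C (lam (st c + l)))

/-- The characteristic polynomial of a companion block has the negated last column as its lower
coefficients. The second part protects the roots that were stored for earlier blocks. -/
theorem blockRoots_run (R : RootFinder) (s : Memory) {n k : ℕ} (hn : s.nat 1 0 = n)
    (hk : s.nat 16 0 = k) (hkn : k < n) :
    (Polynomial.X ^ (k + 1 - s.nat 24 k) + ∑ l : Fin (k + 1 - s.nat 24 k),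
        Polynomial.C (-s.arr 10 (s.nat 24 k + l) k) * Polynomial.X ^ (l : ℕ) : Polynomial ℂ) =
      ∏ l : Fin (k + 1 - s.nat 24 k),
        (Polynomial.X - Polynomial.C ((blockRoots.run R s).arr 22 0 (s.nat 24 k + l))) ∧
    ∀ x < s.nat 24 k, (blockRoots.run R s).arr 22 0 x = s.arr 22 0 x := by
  rw [blockRoots, Program.run, Program.run]
  have h1 : ∀ l < n, l < k + 1 - s.nat 24 k →
      (copyCoeffs.run R s).arr 20 0 l = -s.arr 10 (s.nat 24 k + l) k :=
    Program.loop_induct R (x := 21) (e := nv 1) (s := s) n hn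
    (fun q s' => ∀ l < q, l < k + 1 - s.nat 24 k → s'.arr 20 0 l = -s.arr 10 (s.nat 24 k + l) k)
    (by simp) (by
      intro q s' hq hn' ha hI l hl hl'
      have e1 : s'.nat 16 0 = k := by rw [hn' 16 rfl, hk]
      have e2 : s'.nat 24 = s.nat 24 := hn' 24 rfl
      have e3 : s'.arr 10 = s.arr 10 := ha 10 rfl
      simp only [Program.run, NExp.eval, CExp.eval, Memory.setNat_nat, e1, e2, Memory.setNat_arr,
        e3, and_self, if_true, show (16 : ℕ) ≠ 21 by decide, show (24 : ℕ) ≠ 21 by decide,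
        false_and, if_false]
      rcases Nat.lt_succ_iff_lt_or_eq.1 hl with hl | rfl
      · split_ifs
        · simp [hl.ne, hI l hl hl']
        · simp [hI l hl hl']
      · simp [hl'])
  set s1 := copyCoeffs.run R s with hs1
  have f1 : s1.nat 16 0 = k := by rw [hs1, Program.run_nat R rfl, hk]
  have f2 : s1.nat 24 = s.nat 24 := by rw [hs1, Program.run_nat R rfl]
  have f3 : s1.nat 1 0 = n := by rw [hs1, Program.run_nat R rfl, hn]
  have f4 : s1.arr 22 = s.arr 22 := by rw [hs1, Program.run_arr R rfl]
  clear_value s1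
  set s2 := (Program.roots 20 21 blockSize).run R s1 with hs2
  have g1 : s2.nat 16 0 = k := f1
  have g2 : s2.nat 24 = s.nat 24 := f2
  have g3 : s2.nat 1 0 = n := f3
  have g4 : s2.arr 22 = s.arr 22 := by rw [hs2, Program.run_arr R rfl, f4]
  have hev : blockSize.eval s1 = k + 1 - s.nat 24 k := by simp [NExp.eval, f1, f2]
  have g5 : ∀ l (hl : l < k + 1 - s.nat 24 k), s2.arr 21 0 l =
      R.find (k + 1 - s.nat 24 k) (fun r => -s.arr 10 (s.nat 24 k + r) k) ⟨l, hl⟩ := by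
    intro l hl
    rw [hs2, Program.run, hev, Memory.storeRoots_arr R s1 20 21 _ hl]
    exact congrFun (congrArg (R.find _) (funext fun r => h1 r (by omega) r.2)) _
  clear_value s2
  have h2 : (∀ l < n, l < k + 1 - s.nat 24 k →
      (copyRoots.run R s2).arr 22 0 (s.nat 24 k + l) = s2.arr 21 0 l) ∧
      ∀ x < s.nat 24 k, (copyRoots.run R s2).arr 22 0 x = s2.arr 22 0 x :=
    Program.loop_induct R (x := 21) (e := nv 1) (s := s2) n g3
    (fun q s' => (∀ l < q, l < k + 1 - s.nat 24 k → s'.arr 22 0 (s.nat 24 k + l) = s2.arr 21 0 l) ∧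
      ∀ x < s.nat 24 k, s'.arr 22 0 x = s2.arr 22 0 x)
    (by simp) (by
      rintro q s' hq hn' ha ⟨hI1, hI2⟩
      have e1 : s'.nat 16 0 = k := by rw [hn' 16 rfl, g1]
      have e2 : s'.nat 24 = s.nat 24 := by rw [hn' 24 rfl, g2]
      have e3 : s'.arr 21 = s2.arr 21 := ha 21 rfl
      simp only [Program.run, NExp.eval, CExp.eval, Memory.setNat_nat, e1, e2, Memory.setNat_arr,
        e3, and_self, if_true, show (16 : ℕ) ≠ 21 by decide, show (24 : ℕ) ≠ 21 by decide,
        false_and, if_false]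
      constructor
      · intro l hl hl'
        rcases Nat.lt_succ_iff_lt_or_eq.1 hl with hl | rfl
        · split_ifs
          · simp [hl.ne, hI1 l hl hl']
          · simp [hI1 l hl hl']
        · simp [hl']
      · intro x hx
        split_ifs
        · simp [show x ≠ s.nat 24 k + q by omega, hI2 x hx]
        · simp [hI2 x hx])
  refine ⟨?_, fun x hx => by rw [h2.2 x hx, g4]⟩
  rw [R.spec]
  refine Finset.prod_congr rfl fun l _ => ?_
  rw [h2.1 l (by omega) l.2, g5 l l.2]

theorem rootsProg_run (R : RootFinder) (s : Memory) {n : ℕ} (hn : s.nat 1 0 = n)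
    (h : IsCompanion n n (s.nat 23) (s.nat 24) (s.arr 10)) :
    IsBlockRoots n (s.nat 23) (s.nat 24) (s.arr 10) ((rootsProg.run R s).arr 22 0) := by
  refine Program.loop_induct R (x := 16) (e := nv 1) n hn (fun k s' =>
    IsBlockRoots k (s.nat 23) (s.nat 24) (s.arr 10) (s'.arr 22 0)) (by simp [IsBlockRoots]) ?_
  intro k s' hk hn' ha hI
  have e1 : s'.nat 1 0 = n := by rw [hn' 1 rfl, hn]
  have e2 : s'.nat 24 = s.nat 24 := hn' 24 rfl
  have e3 : s'.arr 10 = s.arr 10 := ha 10 rfl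
  have e4 : s'.nat 23 = s.nat 23 := hn' 23 rfl
  have hb := blockRoots_run R (s'.setNat 16 0 k) (n := n) (k := k) (by simp [e1]) (by simp) hk
  rw [Memory.setNat_nat_of_ne _ _ _ (show 24 ≠ 16 by decide), Memory.setNat_arr, e2, e3] at hb
  simp only [Program.run, NExp.eval, Memory.setNat_nat, and_self, if_true,
    show (23 : ℕ) ≠ 16 by decide, false_and, if_false, e4]
  intro c hc hc0
  rcases Nat.lt_succ_iff_lt_or_eq.1 hc with hc | rfl
  · split_ifs with hcl
    · rw [hI c hc hc0]
      refine Finset.prod_congr rfl fun l _ => ?_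
      have := h.lt_st hk.le hc hc0
      rw [hb.2 _ (by omega)]
    · exact hI c hc hc0
  · rw [if_pos (Nat.pos_of_ne_zero hc0), hb.1]

/-- The sizes of the blocks add up to at most `n`, and cubes are superadditive. -/
theorem rootsProg_rootCost (R : RootFinder) (s : Memory) {n : ℕ} (hn : s.nat 1 0 = n)
    (h : IsCompanion n n (s.nat 23) (s.nat 24) (s.arr 10)) : rootsProg.rootCost R s ≤ n ^ 3 := by
  rw [rootsProg, Program.rootCost]
  have hb : (nv 1).eval s = n := hn
  rw [hb]
  have h1 : ∀ k, Program.rootCost R (.ifLt (.const 0) (.read 23 (nv 16)) blockRoots .skip)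
      ((iter (fun k s' => Program.run R (.ifLt (.const 0) (.read 23 (nv 16)) blockRoots .skip)
        (s'.setNat 16 0 k)) k s).setNat 16 0 k) =
      if s.nat 23 k = 0 then 0 else (k + 1 - s.nat 24 k) ^ 3 := by
    intro k
    set s' := (iter (fun k s' => Program.run R (.ifLt (.const 0) (.read 23 (nv 16)) blockRoots
      .skip) (s'.setNat 16 0 k)) k s).setNat 16 0 k with hs'
    have key : ∀ a, a ≠ 16 → a ≠ 21 → s'.nat a = s.nat a := by
      intro a ha ha'
      rw [hs', Memory.setNat_nat_of_ne _ _ _ ha]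
      refine iter_induct (fun _ s' => s'.nat a = s.nat a) rfl fun k s' _ hs' => ?_
      rw [Program.run_nat R, Memory.setNat_nat_of_ne _ _ _ ha, hs']
      simp [Program.writesNat, blockRoots, copyCoeffs, copyRoots, ha']
    have e1 : s'.nat 16 0 = k := by simp [hs']
    have e2 := key 23 (by decide) (by decide)
    have e3 := key 24 (by decide) (by decide)
    clear_value s'
    simp only [Program.rootCost, NExp.eval, e1, e2, Nat.pos_iff_ne_zero, ite_not]
    split_ifs with hc
    · rfl
    · have f1 := Program.run_nat R (a := 16) (P := copyCoeffs) rfl s'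
      have f2 := Program.run_nat R (a := 24) (P := copyCoeffs) rfl s'
      rw [blockRoots, Program.rootCost, Program.rootCost, Program.rootCost,
        Program.rootCost_eq_zero R (P := copyCoeffs) rfl,
        Program.rootCost_eq_zero R (P := copyRoots) rfl]
      simp [NExp.eval, f1, f2, e1, e3]
  -- The blocks completed before column `k` fill exactly the positions below `st k`; the cube of
  -- this number is the inductive bound.
  have h2 : ∀ k ≤ n, ∑ c ∈ Finset.range k, (if s.nat 23 c = 0 then 0 else
      (c + 1 - s.nat 24 c) ^ 3) ≤ (s.nat 24 k) ^ 3 := by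
    intro k hk
    induction k with
    | zero => simp
    | succ k ih =>
      rw [Finset.sum_range_succ, h.st_succ k hk]
      have ih' := ih (by omega)
      split_ifs with hc
      · simpa using ih'
      · have hle : s.nat 24 k ≤ k := h.st_le (by omega)
        obtain ⟨d, hd⟩ := Nat.exists_eq_add_of_le hle
        have e : k + 1 - s.nat 24 k = d + 1 := by omega
        have e' : k + 1 = s.nat 24 k + (d + 1) := by omega
        rw [e, e']
        have : (s.nat 24 k) ^ 3 + (d + 1) ^ 3 ≤ (s.nat 24 k + (d + 1)) ^ 3 := by
          ring_nf; omega
        omega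
  calc _ = ∑ c ∈ Finset.range n, (if s.nat 23 c = 0 then 0 else (c + 1 - s.nat 24 c) ^ 3) :=
        Finset.sum_congr rfl fun k _ => h1 k
    _ ≤ (s.nat 24 n) ^ 3 := h2 n le_rfl
    _ ≤ n ^ 3 := Nat.pow_le_pow_left (h.st_le le_rfl) 3

end ComplexRAM

namespace ComplexRAM

/-! ### From companion blocks to bidiagonal blocks -/

theorem aeval_semiconj {n : ℕ} {T T' U : Matrix (Fin n) (Fin n) ℂ} (h : U * T = T' * U)
    (f : Polynomial ℂ) : U * Polynomial.aeval T f = Polynomial.aeval T' f * U := by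
  induction f using Polynomial.induction_on' with
  | add f g hf hg => simp only [map_add, mul_add, add_mul, hf, hg]
  | monomial k a =>
    have : U * T ^ k = T' ^ k * U := (SemiconjBy.pow_right (a := U) (x := T) (y := T') h k).eq
    simp only [Polynomial.aeval_monomial, ← Algebra.smul_def, mul_smul_comm, smul_mul_assoc, this]

/-- The leading `n × n` block. -/
def toMatrix (n : ℕ) (G : ℕ → ℕ → ℂ) : Matrix (Fin n) (Fin n) ℂ := Matrix.of fun i j => G i j

/-- The `x`-th basis vector. -/
def basisVec (n x : ℕ) : Fin n → ℂ := fun i => if (i : ℕ) = x then 1 else 0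

theorem toMatrix_mulVec {n x : ℕ} (hx : x < n) (G : ℕ → ℕ → ℂ) :
    toMatrix n G *ᵥ basisVec n x = fun i : Fin n => G i x := by
  have : basisVec n x = Pi.single (⟨x, hx⟩ : Fin n) 1 := by
    funext i; simp [basisVec, Pi.single_apply, Fin.ext_iff]
  rw [this, Matrix.mulVec_single_one]
  rfl

theorem transvection_mulVec {n : ℕ} (q p : Fin n) (κ : ℂ) (y : Fin n → ℂ) :
    Matrix.transvection q p κ *ᵥ y = fun i => y i + if i = q then κ * y p else 0 := by
  funext i
  rw [Matrix.transvection, Matrix.add_mulVec, Matrix.one_mulVec, Matrix.single_mulVec]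
  simp [Function.update_apply]

/-- The similarity is stated as an intertwining relation, the form in which `aeval_semiconj` carries
it over to polynomials. -/
theorem toMatrix_addConj {n p q : ℕ} (hp : p < n) (hq : q < n) (hpq : p ≠ q)
    (κ : ℂ) (G : ℕ → ℕ → ℂ) :
    Matrix.transvection ⟨q, hq⟩ ⟨p, hp⟩ (-κ) * toMatrix n G =
      toMatrix n (addConj (2 * n) p q κ G) * Matrix.transvection ⟨q, hq⟩ ⟨p, hp⟩ (-κ) := by
  ext i j
  have hi := i.2
  have hj := j.2
  by_cases hiq : i = ⟨q, hq⟩ <;> by_cases hjp : j = ⟨p, hp⟩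
  · subst hiq hjp
    rw [Matrix.transvection_mul_apply_same, Matrix.mul_transvection_apply_same]
    simp only [toMatrix, Matrix.of_apply]
    rw [addConj_apply (by omega) (by omega) (by omega),
      addConj_apply (by omega) (by omega) (by omega)]
    simp [hpq.symm]; ring
  · subst hiq
    have hj' : (j : ℕ) ≠ p := fun h => hjp (Fin.ext h)
    rw [Matrix.transvection_mul_apply_same, Matrix.mul_transvection_apply_of_ne _ _ _ _ hjp]
    simp only [toMatrix, Matrix.of_apply]
    rw [addConj_apply (by omega) (by omega) (by omega)]
    simp [hj']; ring
  · subst hjp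
    have hi' : (i : ℕ) ≠ q := fun h => hiq (Fin.ext h)
    rw [Matrix.transvection_mul_apply_of_ne _ _ _ _ hiq, Matrix.mul_transvection_apply_same]
    simp only [toMatrix, Matrix.of_apply]
    rw [addConj_apply (by omega) (by omega) (by omega),
      addConj_apply (by omega) (by omega) (by omega)]
    simp [hi', hpq.symm]
  · have hi' : (i : ℕ) ≠ q := fun h => hiq (Fin.ext h)
    have hj' : (j : ℕ) ≠ p := fun h => hjp (Fin.ext h)
    rw [Matrix.transvection_mul_apply_of_ne _ _ _ _ hiq,
      Matrix.mul_transvection_apply_of_ne _ _ _ _ hjp]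
    simp only [toMatrix, Matrix.of_apply]
    rw [addConj_apply (by omega) (by omega) (by omega)]
    simp [hi', hj']

/-- The product of `X - lam (s + l)` for `l < d`. -/
noncomputable def rootsPoly (lam : ℕ → ℂ) (s d : ℕ) : Polynomial ℂ :=
  ∏ l ∈ Finset.range d, (Polynomial.X - Polynomial.C (lam (s + l)))

/-- The product of the factors `T - lam` for the block that ends with column `c` maps the first
basis vector of the block into the span of the previous blocks. -/
def Annihilates (n : ℕ) (cl st : ℕ → ℕ) (lam : ℕ → ℂ) (G : ℕ → ℕ → ℂ) : Prop :=
  ∀ c < n, cl c ≠ 0 → ∀ i : Fin n, st c ≤ i →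
    (Polynomial.aeval (toMatrix n G) (rootsPoly lam (st c) (c + 1 - st c)) *ᵥ
      basisVec n (st c)) i = 0

/-- The transvection is upper triangular, since `q < p`, hence preserves the spans of the previous
blocks; as `p` is not the start of a block, it also fixes the first basis vector of each block. -/
theorem Annihilates.addConj {n : ℕ} {cl st : ℕ → ℕ} {lam : ℕ → ℂ} {G : ℕ → ℕ → ℂ}
    (h : Annihilates n cl st lam G) {p q : ℕ} (hp : p < n) (hq : q < p)
    (hst : ∀ c < n, cl c ≠ 0 → st c ≠ p) (κ : ℂ) :
    Annihilates n cl st lam (addConj (2 * n) p q κ G) := by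
  intro c hc hc0 i hi
  have h1 := aeval_semiconj (toMatrix_addConj hp (hq.trans hp) hq.ne' κ G)
    (rootsPoly lam (st c) (c + 1 - st c))
  have h2 : Matrix.transvection (⟨q, hq.trans hp⟩ : Fin n) ⟨p, hp⟩ (-κ) *ᵥ basisVec n (st c) =
      basisVec n (st c) := by
    rw [transvection_mulVec]
    funext i
    simp [basisVec, (hst c hc hc0).symm]
  rw [← h2, Matrix.mulVec_mulVec, ← h1, ← Matrix.mulVec_mulVec, transvection_mulVec]
  simp only
  rw [h c hc hc0 i hi]
  split_ifs with hiq
  -- Component `q` receives a multiple of component `p`, which vanishes too because `st c ≤ q < p`.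
  · rw [h c hc hc0 ⟨p, hp⟩ (by simp [hiq] at hi ⊢; omega)]; simp
  · simp

theorem IsCompanion.eq_zero_of_st_le {n m : ℕ} {cl st : ℕ → ℕ} {G : ℕ → ℕ → ℂ}
    (h : IsCompanion n m cl st G) {c x : ℕ} (hc : c ≤ m) (h1 : st c ≤ x) (h2 : x < c) :
    cl x = 0 := by
  by_contra h0
  have := h.lt_st hc h2 h0
  omega

/-- The shift of an inner column `k` modifies the basis vector `k + 1`; this vector never starts a
block. -/
theorem IsCompanion.st_ne {n m : ℕ} {cl st : ℕ → ℕ} {G : ℕ → ℕ → ℂ}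
    (h : IsCompanion n m cl st G) {c k : ℕ} (hc : c ≤ m) (hk : cl k = 0) : st c ≠ k + 1 := by
  induction c with
  | zero => simp [h.st_zero]
  | succ c ih =>
    rw [h.st_succ c (by omega)]
    split_ifs with h0
    · exact ih (by omega)
    · rintro he
      obtain rfl : c = k := by omega
      exact h0 hk

theorem IsCompanion.pow_mulVec {n m : ℕ} {cl st : ℕ → ℕ} {G : ℕ → ℕ → ℂ}
    (h : IsCompanion n m cl st G) {c : ℕ} (hc : c < m) (hm : m ≤ n) (l : ℕ) (hl : st c + l ≤ c) :
    (toMatrix n G) ^ l *ᵥ basisVec n (st c) = basisVec n (st c + l) := by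
  induction l with
  | zero => simp
  | succ l ih =>
    rw [pow_succ', ← Matrix.mulVec_mulVec, ih (by omega), toMatrix_mulVec (by omega)]
    funext i
    rw [h.inner _ (by omega) (h.eq_zero_of_st_le hc.le (by omega) (by omega)) i i.2]
    rfl

/-- The Cayley–Hamilton theorem in a cyclic basis: the powers of the matrix map the first vector of
a block to the later ones and finally to the last column of the block. Subtracting the entries of
that column inside the block leaves only components in earlier blocks. -/
theorem IsCompanion.annihilates {n : ℕ} {cl st : ℕ → ℕ} {G : ℕ → ℕ → ℂ} {lam : ℕ → ℂ}
    (h : IsCompanion n n cl st G) (hr : IsBlockRoots n cl st G lam) :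
    Annihilates n cl st lam G := by
  intro c hc hc0 i hi
  have hst : st c ≤ c := h.st_le hc.le
  have e : rootsPoly lam (st c) (c + 1 - st c) = Polynomial.X ^ (c + 1 - st c) +
      ∑ l ∈ Finset.range (c + 1 - st c), Polynomial.C (-G (st c + l) c) * Polynomial.X ^ l := by
    rw [rootsPoly, ← Fin.prod_univ_eq_prod_range
      (fun l => Polynomial.X - Polynomial.C (lam (st c + l))), ← hr c hc hc0,
      ← Fin.sum_univ_eq_sum_range
      (fun l => Polynomial.C (-G (st c + l) c) * (Polynomial.X : Polynomial ℂ) ^ l)]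
  have e2 : c + 1 - st c = (c - st c) + 1 := by omega
  rw [e, map_add, map_sum, Matrix.add_mulVec, Matrix.sum_mulVec]
  simp only [map_mul, map_pow, Polynomial.aeval_X, Polynomial.aeval_C, ← Algebra.smul_def,
    Matrix.smul_mulVec]
  rw [Finset.sum_congr rfl (g := fun l => (-G (st c + l) c) • basisVec n (st c + l)) (fun l hl => by
    rw [Finset.mem_range] at hl
    rw [h.pow_mulVec hc le_rfl l (by omega)])]
  have e3 : (toMatrix n G) ^ (c + 1 - st c) *ᵥ basisVec n (st c) = fun i : Fin n => G i c := by
    rw [e2, pow_succ', ← Matrix.mulVec_mulVec, h.pow_mulVec hc le_rfl _ (by omega),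
      Nat.add_sub_cancel' hst, toMatrix_mulVec hc]
  rw [e3, Pi.add_apply, Finset.sum_apply]
  simp only [Pi.smul_apply, basisVec, smul_eq_mul, mul_ite, mul_one, mul_zero]
  by_cases hic : (i : ℕ) ≤ c
  · rw [Finset.sum_eq_single ((i : ℕ) - st c)]
    · rw [Nat.add_sub_cancel' hi]; simp
    · intro l hl hne
      rw [if_neg (by omega)]
    · intro hl
      rw [Finset.mem_range] at hl; omega
  · rw [Finset.sum_eq_zero, h.last c hc hc0 i i.2 (by omega), add_zero]
    intro l hl
    rw [Finset.mem_range] at hl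
    rw [if_neg (by omega)]

/-! ### Shifting the companion blocks column by column -/

/-- The first `k` columns are those of bidiagonal blocks, except for the last columns of blocks. -/
structure IsShifted (n k : ℕ) (cl : ℕ → ℕ) (lam : ℕ → ℂ) (G : ℕ → ℕ → ℂ) : Prop where
  done : ∀ c < k, cl c = 0 → ∀ i < n, G i c = if i = c then lam c else if i = c + 1 then 1 else 0
  todo : ∀ c < n, k ≤ c → cl c = 0 → ∀ i < n, c < i → G i c = if i = c + 1 then 1 else 0
  last : ∀ c < n, cl c ≠ 0 → ∀ i < n, c < i → G i c = 0

theorem IsShifted.eq_zero {n k : ℕ} {cl : ℕ → ℕ} {lam : ℕ → ℂ} {G : ℕ → ℕ → ℂ}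
    (h : IsShifted n k cl lam G) {c i : ℕ} (hc : c < n) (hi : i < n) (hci : c + 1 < i) :
    G i c = 0 := by
  by_cases h0 : cl c = 0
  · by_cases hk : c < k
    · rw [h.done c hk h0 i hi, if_neg (by omega), if_neg (by omega)]
    · rw [h.todo c hc (by omega) h0 i hi (by omega), if_neg (by omega)]
  · exact h.last c hc h0 i hi (by omega)

/-- Finished columns vanish in row `k + 1`, hence do not feel the row operation. In the others only
entries below the diagonal are prescribed, and there column `q ≤ k` has nothing to contribute to
column `k + 1`. -/
theorem IsShifted.addConj {n k q : ℕ} {cl : ℕ → ℕ} {lam : ℕ → ℂ} {G : ℕ → ℕ → ℂ}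
    (h : IsShifted n k cl lam G) (hk : k + 1 < n) (hq : q ≤ k) (κ : ℂ) :
    IsShifted n k cl lam (addConj (2 * n) (k + 1) q κ G) where
  done c hc h0 i hi := by
    rw [addConj_col (by omega) (by omega) (by omega) (by omega), h.done c hc h0 i hi]
    exact h.eq_zero (by omega) hk (by omega)
  todo c hc hkc h0 i hi hci := by
    rw [addConj_apply (by omega) (by omega) (by omega), if_neg (show ¬ i = q by omega), sub_zero]
    split_ifs with h1 h2 h2
    · rw [h.todo c hc hkc h0 i hi hci, if_pos h2, h.eq_zero (c := q) (by omega) hi (by omega)]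
      simp
    · rw [h.todo c hc hkc h0 i hi hci, if_neg h2, h.eq_zero (c := q) (by omega) hi (by omega)]
      simp
    · rw [h.todo c hc hkc h0 i hi hci, if_pos h2]
    · rw [h.todo c hc hkc h0 i hi hci, if_neg h2]
  last c hc h0 i hi hci := by
    by_cases hck : c < k
    · rw [addConj_col (by omega) (by omega) (by omega) (by omega), h.last c hc h0 i hi hci]
      exact h.last c hc h0 _ hk (by omega)
    · rw [addConj_apply (by omega) (by omega) (by omega), if_neg (show ¬ i = q by omega), sub_zero]
      split_ifs with h1
      · rw [h.last c hc h0 i hi hci, h.eq_zero (c := q) (by omega) hi (by omega)]; simp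
      · exact h.last c hc h0 i hi hci

/-- A bidiagonal column says that `T - λ` maps its basis vector to the next one, so the factors of
`rootsPoly` walk through the block one step at a time. -/
theorem IsShifted.pow_mulVec {n : ℕ} {cl : ℕ → ℕ} {lam : ℕ → ℂ} {G : ℕ → ℕ → ℂ}
    (h : IsShifted n n cl lam G) {s : ℕ} (l : ℕ) (hl : s + l < n)
    (h0 : ∀ x, s ≤ x → x < s + l → cl x = 0) :
    Polynomial.aeval (toMatrix n G) (rootsPoly lam s l) *ᵥ basisVec n s = basisVec n (s + l) := by
  induction l with
  | zero => simp [rootsPoly]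
  | succ l ih =>
    have ih' := ih (by omega) fun x hx hx' => h0 x hx (by omega)
    rw [rootsPoly, Finset.prod_range_succ, mul_comm, ← rootsPoly, map_mul, ← Matrix.mulVec_mulVec,
      ih', map_sub, Polynomial.aeval_X, Polynomial.aeval_C, Matrix.sub_mulVec,
      toMatrix_mulVec (by omega), Algebra.algebraMap_eq_smul_one, Matrix.smul_mulVec,
      Matrix.one_mulVec]
    funext i
    rw [Pi.sub_apply, h.done _ (by omega) (h0 _ (by omega) (by omega)) i i.2]
    simp only [basisVec, Pi.smul_apply, smul_eq_mul]
    rcases Nat.lt_trichotomy i (s + l) with h1 | h1 | h1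
    · simp [h1.ne, show (i : ℕ) ≠ s + (l + 1) by omega, show (i : ℕ) ≠ s + l + 1 by omega]
    · simp [h1]
    · simp [h1.ne', Nat.add_assoc]

/-- All factors except the last carry the first vector of the block to its last vector. The
annihilation relation then says that `T - λ` maps this last vector into the earlier blocks, which
determines the column inside the block without any computation. -/
theorem IsShifted.last_eq {n : ℕ} {cl st : ℕ → ℕ} {lam : ℕ → ℂ} {G G₀ : ℕ → ℕ → ℂ}
    (h : IsShifted n n cl lam G) (h₀ : IsCompanion n n cl st G₀)
    (hZ : Annihilates n cl st lam G) {c : ℕ} (hc : c < n) (hc0 : cl c ≠ 0) {i : ℕ} (hi : i < n)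
    (hsi : st c ≤ i) : G i c = if i = c then lam c else 0 := by
  have hst : st c ≤ c := h₀.st_le hc.le
  have h1 := hZ c hc hc0 ⟨i, hi⟩ hsi
  have e2 : c + 1 - st c = (c - st c) + 1 := by omega
  rw [e2, rootsPoly, Finset.prod_range_succ, mul_comm, ← rootsPoly, map_mul,
    ← Matrix.mulVec_mulVec, h.pow_mulVec _ (by omega)
      (fun x hx hx' => h₀.eq_zero_of_st_le hc.le hx (by omega)),
    Nat.add_sub_cancel' hst, map_sub, Polynomial.aeval_X, Polynomial.aeval_C, Matrix.sub_mulVec,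
    toMatrix_mulVec hc, Algebra.algebraMap_eq_smul_one, Matrix.smul_mulVec,
    Matrix.one_mulVec] at h1
  simpa [basisVec, sub_eq_zero] using h1

/-- Make column `k` the one of a bidiagonal block. -/
def shiftColumn : Program :=
  .loop 22 (nv 1) (.ifLt (nv 22) (nv 16)
    (addConjProg nextCol (nv 22) (.read 10 (nv 22) (nv 16)))
    (.ifLt (nv 16) (nv 22) .skip
      (addConjProg nextCol (nv 22)
        (.sub (.read 10 (nv 22) (nv 16)) (.read 22 (.const 0) (nv 16))))))

/-- Transform companion blocks into bidiagonal blocks. -/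
def shiftProg : Program :=
  .loop 16 (nv 1) (.ifLt (.const 0) (.read 23 (nv 16)) .skip shiftColumn)

/-- The new basis vector `k + 1` is `(A - λ_k) b_k`; all terms of `A b_k` with index at most `k`,
except `λ_k b_k`, are absorbed into it. -/
theorem shiftColumn_run (R : RootFinder) (s : Memory) {n k : ℕ} {A : Matrix (Fin n) (Fin n) ℂ}
    {cl st : ℕ → ℕ} {lam : ℕ → ℂ}
    (hn : s.nat 1 0 = n) (h2n : s.nat 2 0 = 2 * n) (hk : s.nat 16 0 = k) (hA : IsConj A (s.arr 10))
    (hlam : s.arr 22 0 = lam) (hcl : cl k = 0)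
    (hkn : k + 1 < n) (hS : IsShifted n k cl lam (s.arr 10))
    (hst : ∀ c < n, cl c ≠ 0 → st c ≠ k + 1) (hZ : Annihilates n cl st lam (s.arr 10)) :
    IsConj A ((shiftColumn.run R s).arr 10) ∧ Annihilates n cl st lam ((shiftColumn.run R s).arr 10) ∧
      IsShifted n (k + 1) cl lam ((shiftColumn.run R s).arr 10) := by
  have key : IsConj A ((shiftColumn.run R s).arr 10) ∧
      Annihilates n cl st lam ((shiftColumn.run R s).arr 10) ∧
      IsShifted n k cl lam ((shiftColumn.run R s).arr 10) ∧
      ∀ i < n, i ≤ k → (shiftColumn.run R s).arr 10 i k = if i = k then lam k else 0 := by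
    refine Program.loop_induct R (x := 22) (e := nv 1) (s := s) n hn
      (fun q s' => IsConj A (s'.arr 10) ∧ Annihilates n cl st lam (s'.arr 10) ∧
        IsShifted n k cl lam (s'.arr 10) ∧
        ∀ i < q, i ≤ k → s'.arr 10 i k = if i = k then lam k else 0)
      ⟨hA, hZ, hS, by simp⟩ ?_
    rintro q s' hq hn' ha ⟨i1, i2, i3, i4⟩
    have e1 : s'.nat 16 0 = k := by rw [hn' 16 rfl, hk]
    have e2 : s'.nat 2 0 = 2 * n := by rw [hn' 2 rfl, h2n]
    have e3 : s'.arr 22 0 = lam := by rw [ha 22 rfl, hlam]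
    -- Above the diagonal the entry is removed, and on the diagonal it is lowered to the eigenvalue;
    -- the conditional treats both cases together.
    have main : ∀ G', q ≤ k → G' = ComplexRAM.addConj (2 * n) (k + 1) q
        (s'.arr 10 q k - if q = k then lam k else 0) (s'.arr 10) →
        IsConj A G' ∧ Annihilates n cl st lam G' ∧ IsShifted n k cl lam G' ∧
        ∀ i < q + 1, i ≤ k → G' i k = if i = k then lam k else 0 := by
      rintro G' hqk rfl
      refine ⟨i1.addConj hkn hq (by omega) _, i2.addConj hkn (by omega) hst _,
        i3.addConj hkn hqk _, fun i hi hik => ?_⟩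
      rw [addConj_apply (by omega) (by omega) (by omega)]
      have h1 : s'.arr 10 (k + 1) k = 1 := by
        rw [i3.todo k (by omega) le_rfl hcl _ hkn (by omega), if_pos rfl]
      simp only [show k ≠ k + 1 by omega, if_false, h1]
      rcases Nat.lt_succ_iff_lt_or_eq.1 hi with hi | rfl
      · simp [hi.ne, i4 i hi hik]
      · simp
    simp only [Program.run]
    split_ifs with c1 c2
    · simp [NExp.eval, e1] at c1
      refine main _ (by omega) ?_
      rw [addConjProg_run R _ (m := 2 * n) (p' := k + 1) (q' := q) (c := s'.arr 10 q k)
        (by simp [e2]) (by simp [NExp.eval, e1]) (by simp [NExp.eval])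
        (by simp [NExp.eval, CExp.eval, e1]) (by omega)]
      simp [c1.ne]
    · simp [NExp.eval, e1] at c2
      exact ⟨i1, i2, i3, fun i hi hik => i4 i (by omega) hik⟩
    · simp [NExp.eval, e1] at c1 c2
      obtain rfl : q = k := by omega
      refine main _ (by omega) ?_
      rw [addConjProg_run R _ (m := 2 * n) (p' := q + 1) (q' := q) (c := s'.arr 10 q q - lam q)
        (by simp [e2]) (by simp [NExp.eval, e1]) (by simp [NExp.eval])
        (by simp [NExp.eval, CExp.eval, e1, e3]) (by omega)]
      simp
  obtain ⟨k1, k2, k3, k4⟩ := key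
  refine ⟨k1, k2, ?_, ?_, k3.last⟩
  · intro c hc h0 i hi
    rcases Nat.lt_succ_iff_lt_or_eq.1 hc with hc | rfl
    · exact k3.done c hc h0 i hi
    · by_cases hic : i ≤ c
      · rw [k4 i hi hic, if_neg (show ¬ i = c + 1 by omega)]
      · rw [k3.todo c (by omega) le_rfl h0 i hi (by omega), if_neg (show ¬ i = c by omega)]
  · intro c hc hkc
    exact k3.todo c hc (by omega)

theorem shiftProg_run (R : RootFinder) (s : Memory) {n : ℕ} {A : Matrix (Fin n) (Fin n) ℂ}
    (hn : s.nat 1 0 = n) (h2n : s.nat 2 0 = 2 * n) (hA : IsConj A (s.arr 10))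
    {G₀ : ℕ → ℕ → ℂ} (hG₀ : s.arr 10 = G₀)
    (h : IsCompanion n n (s.nat 23) (s.nat 24) G₀)
    (hr : IsBlockRoots n (s.nat 23) (s.nat 24) G₀ (s.arr 22 0)) :
    IsConj A ((shiftProg.run R s).arr 10) ∧
      (∀ c < n, s.nat 23 c = 0 → ∀ i < n, (shiftProg.run R s).arr 10 i c =
        if i = c then s.arr 22 0 c else if i = c + 1 then 1 else 0) ∧
      (∀ c < n, s.nat 23 c ≠ 0 → ∀ i < n, s.nat 24 c ≤ i → (shiftProg.run R s).arr 10 i c =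
        if i = c then s.arr 22 0 c else 0) := by
  have key : IsConj A ((shiftProg.run R s).arr 10) ∧
      Annihilates n (s.nat 23) (s.nat 24) (s.arr 22 0) ((shiftProg.run R s).arr 10) ∧
      IsShifted n n (s.nat 23) (s.arr 22 0) ((shiftProg.run R s).arr 10) := by
    refine Program.loop_induct R (x := 16) (e := nv 1) n hn (fun k s' => IsConj A (s'.arr 10) ∧
      Annihilates n (s.nat 23) (s.nat 24) (s.arr 22 0) (s'.arr 10) ∧
      IsShifted n k (s.nat 23) (s.arr 22 0) (s'.arr 10)) ⟨hA, ?_, ?_⟩ ?_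
    · rw [hG₀]; exact h.annihilates hr
    · refine ⟨by simp, fun c hc _ h0 i hi hci => ?_, fun c hc h0 i hi hci => ?_⟩
      · rw [hG₀, h.inner c hc h0 i hi]
      · rw [hG₀, h.last c hc h0 i hi hci]
    · rintro k s' hk hn' ha ⟨i1, i2, i3⟩
      have e1 : s'.nat 1 0 = n := by rw [hn' 1 rfl, hn]
      have e2 : s'.nat 2 0 = 2 * n := by rw [hn' 2 rfl, h2n]
      have e3 : s'.nat 23 = s.nat 23 := hn' 23 rfl
      have e5 : s'.arr 22 = s.arr 22 := ha 22 rfl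
      simp only [Program.run, NExp.eval, Memory.setNat_nat, and_self, if_true,
        show (23 : ℕ) ≠ 16 by decide, false_and, if_false, e3]
      split_ifs with hc
      · refine ⟨i1, i2, ?_, ?_, i3.last⟩
        · intro c hc' h0
          rcases Nat.lt_succ_iff_lt_or_eq.1 hc' with hc' | rfl
          · exact i3.done c hc' h0
          · omega
        · exact fun c hcn hkc => i3.todo c hcn (by omega)
      · have hc0 : s.nat 23 k = 0 := by omega
        exact shiftColumn_run R _ (by simp [e1]) (by simp [e2]) (by simp) i1 (by simp [e5]) hc0
          (h.lt k hk hc0) i3 (fun c hc _ => h.st_ne hc.le hc0) i2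
  exact ⟨key.1, key.2.2.done, fun c hc hc0 i hi hsi => key.2.2.last_eq h key.2.1 hc hc0 hi hsi⟩

end ComplexRAM

namespace ComplexRAM

/-! ### Filling arrays -/

/-- `arr d (ro + x) (co + y) := f` for all `x < nat a 0` and `y < nat b 0`, where `x` and `y` are held
in `nat 17 0` and `nat 18 0`. -/
def fill (d a b : ℕ) (ro co : NExp) (f : CExp) : Program :=
  .loop 17 (nv a) (.loop 18 (nv b) (.setArr d (.add ro (nv 17)) (.add co (nv 18)) f))

/-- `arr d x y := arr d x y + f` for all `x < nat a 0`, `y < nat b 0` and `z < nat e 0`, where `x`,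
`y`, `z` are held in `nat 17 0`, `nat 18 0`, `nat 19 0`. -/
def accumulate (d a b e : ℕ) (f : CExp) : Program :=
  .loop 17 (nv a) (.loop 18 (nv b) (.loop 19 (nv e)
    (.setArr d (nv 17) (nv 18) (.add (.read d (nv 17) (nv 18)) f))))

/-- Offsets and entries are evaluated in changing memories. The hypotheses ask for their values in
every memory that agrees with `s` apart from the counters and, for the entries, the target array. -/
theorem fill_run (R : RootFinder) (s : Memory) {d a b : ℕ} {ro co : NExp} {f : CExp}
    (hb : b ≠ 17 ∧ b ≠ 18) {na nb r c : ℕ}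
    (hna : s.nat a 0 = na) (hnb : s.nat b 0 = nb)
    (hr : ∀ s' : Memory, (∀ x, x ≠ 17 → x ≠ 18 → s'.nat x = s.nat x) → ro.eval s' = r)
    (hc : ∀ s' : Memory, (∀ x, x ≠ 17 → x ≠ 18 → s'.nat x = s.nat x) → co.eval s' = c)
    (v : ℕ → ℕ → ℂ) (hf : ∀ s' : Memory, (∀ x, x ≠ 17 → x ≠ 18 → s'.nat x = s.nat x) →
      (∀ x, x ≠ d → s'.arr x = s.arr x) → s'.nat 17 0 < na → s'.nat 18 0 < nb →
      f.eval s' = v (s'.nat 17 0) (s'.nat 18 0)) :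
    ((fill d a b ro co f).run R s).arr d = fun i j =>
      if (r ≤ i ∧ i < r + na) ∧ (c ≤ j ∧ j < c + nb) then v (i - r) (j - c) else s.arr d i j := by
  have key := Program.loop_induct R (x := 17) (e := nv a)
    (P := .loop 18 (nv b) (.setArr d (.add ro (nv 17)) (.add co (nv 18)) f)) (s := s) na hna
    (fun k s' => s'.arr d = fun i j =>
      if (r ≤ i ∧ i < r + k) ∧ (c ≤ j ∧ j < c + nb) then v (i - r) (j - c) else s.arr d i j)
    (by funext i j; rw [if_neg (by omega)]) ?_
  · exact key
  · intro k s' hk hn1 ha1 hI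
    have h17 : ∀ x, x ≠ 17 → x ≠ 18 → s'.nat x = s.nat x := fun x h1 h2 => hn1 x (by
      simp [Program.writesNat, h1.symm, h2])
    have := Program.loop_induct R (x := 18) (e := nv b)
      (P := .setArr d (.add ro (nv 17)) (.add co (nv 18)) f) (s := s'.setNat 17 0 k) nb
      (by simp [NExp.eval, hb.1, h17 b hb.1 hb.2, hnb])
      (fun q s'' => s''.arr d = fun i j =>
      if (r ≤ i ∧ i < r + k) ∧ (c ≤ j ∧ j < c + nb) ∨ i = r + k ∧ c ≤ j ∧ j < c + q
        then v (i - r) (j - c) else s.arr d i j)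
      (by
        rw [Memory.setNat_arr, hI]; funext i j
        have : ¬ (i = r + k ∧ c ≤ j ∧ j < c + 0) := by omega
        simp only [this, or_false]) ?_
    · rw [this]
      funext i j
      congr 1
      apply propext
      omega
    · intro q s'' hq hn2 ha2 hI2
      have g1 : ∀ x, x ≠ 17 → x ≠ 18 → (s''.setNat 18 0 q).nat x = s.nat x := fun x h1 h2 => by
        rw [Memory.setNat_nat_of_ne _ _ _ h2, hn2 x (by simp [Program.writesNat, h2.symm]),
          Memory.setNat_nat_of_ne _ _ _ h1, h17 x h1 h2]
      have g2 : ∀ x, x ≠ d → (s''.setNat 18 0 q).arr x = s.arr x := fun x h1 => by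
        rw [Memory.setNat_arr, ha2 x (by simp [Program.writesArr, h1]), Memory.setNat_arr,
          ha1 x (by simp [Program.writesArr, h1])]
      have e17 : (s''.setNat 18 0 q).nat 17 0 = k := by
        rw [Memory.setNat_nat_of_ne _ _ _ (by decide), hn2 17 rfl]; simp
      have e18 : (s''.setNat 18 0 q).nat 18 0 = q := by simp
      simp only [Program.run, NExp.eval]
      rw [hr _ g1, hc _ g1, hf _ g1 g2 (by omega) (by omega), e17, e18]
      funext i j
      simp only [Memory.setArr_arr, Memory.setNat_arr, hI2, true_and]
      by_cases h1 : i = r + k ∧ j = c + q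
      · rw [if_pos h1, if_pos (by omega), h1.1, h1.2]; simp
      · rw [if_neg h1]
        congr 1
        apply propext
        omega

theorem accumulate_run (R : RootFinder) (s : Memory) {d a b e : ℕ} {f : CExp}
    (hb : b ≠ 17 ∧ b ≠ 18 ∧ b ≠ 19)
    (he : e ≠ 17 ∧ e ≠ 18 ∧ e ≠ 19) {na nb ne : ℕ}
    (hna : s.nat a 0 = na) (hnb : s.nat b 0 = nb) (hne : s.nat e 0 = ne)
    (v : ℕ → ℕ → ℕ → ℂ) (hf : ∀ s' : Memory,
      (∀ x, x ≠ 17 → x ≠ 18 → x ≠ 19 → s'.nat x = s.nat x) →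
      (∀ x, x ≠ d → s'.arr x = s.arr x) → s'.nat 17 0 < na → s'.nat 18 0 < nb →
      s'.nat 19 0 < ne → f.eval s' = v (s'.nat 17 0) (s'.nat 18 0) (s'.nat 19 0)) :
    ((accumulate d a b e f).run R s).arr d = fun i j =>
      if i < na ∧ j < nb then s.arr d i j + ∑ l ∈ Finset.range ne, v i j l else s.arr d i j := by
  have key := Program.loop_induct R (x := 17) (e := nv a)
    (P := .loop 18 (nv b) (.loop 19 (nv e)
    (.setArr d (nv 17) (nv 18) (.add (.read d (nv 17) (nv 18)) f)))) (s := s) na hna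
    (fun k s' => s'.arr d = fun i j =>
      if i < k ∧ j < nb then s.arr d i j + ∑ l ∈ Finset.range ne, v i j l else s.arr d i j)
    (by funext i j; rw [if_neg (by omega)]) ?_
  · exact key
  · intro k s' hk hn1 ha1 hI
    have h17 : ∀ x, x ≠ 17 → x ≠ 18 → x ≠ 19 → s'.nat x = s.nat x := fun x h1 h2 h3 => hn1 x (by
      simp [Program.writesNat, h1.symm, h2, h3])
    have := Program.loop_induct R (x := 18) (e := nv b)
      (P := .loop 19 (nv e)
        (.setArr d (nv 17) (nv 18) (.add (.read d (nv 17) (nv 18)) f)))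
      (s := s'.setNat 17 0 k) nb
      (by simp [NExp.eval, hb.1, h17 b hb.1 hb.2.1 hb.2.2, hnb])
      (fun q s'' => s''.arr d = fun i j =>
      if i < k ∧ j < nb ∨ i = k ∧ j < q
        then s.arr d i j + ∑ l ∈ Finset.range ne, v i j l else s.arr d i j)
      (by
        rw [Memory.setNat_arr, hI]; funext i j
        have : ¬ (i = k ∧ j < 0) := by omega
        simp only [this, or_false]) ?_
    · rw [this]
      funext i j
      congr 1
      apply propext
      omega
    · intro q s'' hq hn2 ha2 hI2
      have g1 : ∀ x, x ≠ 17 → x ≠ 18 → x ≠ 19 → (s''.setNat 18 0 q).nat x = s.nat x :=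
        fun x h1 h2 h3 => by
          rw [Memory.setNat_nat_of_ne _ _ _ h2, hn2 x (by simp [Program.writesNat, h2.symm, h3]),
            Memory.setNat_nat_of_ne _ _ _ h1, h17 x h1 h2 h3]
      have g2 : ∀ x, x ≠ d → (s''.setNat 18 0 q).arr x = s.arr x := fun x h1 => by
        rw [Memory.setNat_arr, ha2 x (by simp [Program.writesArr, h1]), Memory.setNat_arr,
          ha1 x (by simp [Program.writesArr, h1])]
      have e17 : (s''.setNat 18 0 q).nat 17 0 = k := by
        rw [Memory.setNat_nat_of_ne _ _ _ (by decide), hn2 17 rfl]; simp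
      have e18 : (s''.setNat 18 0 q).nat 18 0 = q := by simp
      have := Program.loop_induct R (x := 19) (e := nv e)
        (P := .setArr d (nv 17) (nv 18) (.add (.read d (nv 17) (nv 18)) f))
        (s := s''.setNat 18 0 q) ne
        (by rw [← hne, ← g1 e he.1 he.2.1 he.2.2]; rfl)
        -- Three kinds of positions: those completed, the current one with a partial sum, and the
        -- untouched ones.
        (fun p s3 => s3.arr d = fun i j =>
          if i < k ∧ j < nb ∨ i = k ∧ j < q then s.arr d i j + ∑ l ∈ Finset.range ne, v i j l
          else if i = k ∧ j = q then s.arr d i j + ∑ l ∈ Finset.range p, v i j l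
          else s.arr d i j)
        (by
          rw [Memory.setNat_arr, hI2]; funext i j
          simp) ?_
      · rw [this]
        funext i j
        by_cases h1 : i < k ∧ j < nb ∨ i = k ∧ j < q
        · rw [if_pos h1, if_pos (by omega)]
        · rw [if_neg h1]
          congr 1
          apply propext
          omega
      · intro p s3 hp hn3 ha3 hI3
        have k1 : ∀ x, x ≠ 17 → x ≠ 18 → x ≠ 19 → (s3.setNat 19 0 p).nat x = s.nat x :=
          fun x h1 h2 h3 => by
            rw [Memory.setNat_nat_of_ne _ _ _ h3, hn3 x (by simp [Program.writesNat, h3.symm]),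
              g1 x h1 h2 h3]
        have k2 : ∀ x, x ≠ d → (s3.setNat 19 0 p).arr x = s.arr x := fun x h1 => by
          rw [Memory.setNat_arr, ha3 x (by simp [Program.writesArr, h1]), g2 x h1]
        have m17 : (s3.setNat 19 0 p).nat 17 0 = k := by
          rw [Memory.setNat_nat_of_ne _ _ _ (by decide), hn3 17 rfl, e17]
        have m18 : (s3.setNat 19 0 p).nat 18 0 = q := by
          rw [Memory.setNat_nat_of_ne _ _ _ (by decide), hn3 18 rfl, e18]
        have m19 : (s3.setNat 19 0 p).nat 19 0 = p := by simp
        simp only [Program.run, NExp.eval, CExp.eval]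
        rw [hf _ k1 k2 (by omega) (by omega) (by omega), m17, m18, m19]
        funext i j
        simp only [Memory.setArr_arr, Memory.setNat_arr, hI3, true_and]
        by_cases h1 : i = k ∧ j = q
        · rw [if_pos h1, if_neg (by omega), if_pos trivial, if_neg (by omega), if_pos h1,
            Finset.sum_range_succ, h1.1, h1.2, add_assoc]
        · rw [if_neg h1, if_neg h1, if_neg h1]

/-! ### Reversing the blocks -/

/-- Put the permutation that reverses all blocks into `nat 25`. -/
def orderProg : Program :=
  .seq (.loop 16 (nv 1) (.setNat 25 (.add (nv 1) (nv 16)) (.add (nv 1) (nv 16))))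
    (.loop 16 (nv 1) (.ifLt (.const 0) (.read 23 (nv 16))
      (.loop 21 (nv 1) (.ifLt (nv 21) (.read 24 (nv 16)) .skip (.ifLt (nv 16) (nv 21) .skip
        (.setNat 25 (nv 21) (.sub (.add (.read 24 (nv 16)) (nv 16)) (nv 21)))))) .skip))

/-- Reverse all blocks. -/
def reverseProg : Program :=
  .seq orderProg
    (.seq (fill 12 2 2 (.const 0) (.const 0) (.read 10 (.read 25 (nv 17)) (.read 25 (nv 18))))
      (fill 10 2 2 (.const 0) (.const 0) (.read 12 (nv 17) (nv 18))))

/-- The indices from `n` on are fixed, because they label the original coordinates in the borders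
`P` and `Q`, which a change of basis does not permute. -/
theorem orderProg_run (R : RootFinder) (s : Memory) {n : ℕ} {G : ℕ → ℕ → ℂ}
    (hn : s.nat 1 0 = n) (h : IsCompanion n n (s.nat 23) (s.nat 24) G) :
    (∀ x < n, (orderProg.run R s).nat 25 (n + x) = n + x) ∧
    ∀ k < n, s.nat 23 k ≠ 0 → ∀ x, s.nat 24 k ≤ x → x ≤ k →
      (orderProg.run R s).nat 25 x = s.nat 24 k + k - x := by
  rw [orderProg, Program.run]
  have h1 := Program.loop_induct R (x := 16) (e := nv 1)
    (P := .setNat 25 (.add (nv 1) (nv 16)) (.add (nv 1) (nv 16))) (s := s) n hn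
    (fun k s' => ∀ x < k, s'.nat 25 (n + x) = n + x) (by simp) (by
      intro k s' hk hn' ha hI x hx
      have e1 : s'.nat 1 0 = n := by rw [hn' 1 rfl, hn]
      rcases Nat.lt_succ_iff_lt_or_eq.1 hx with hx | rfl
      · simp [Program.run, NExp.eval, e1, hx.ne, hI x hx]
      · simp [Program.run, NExp.eval, e1])
  set s1 := (Program.loop 16 (nv 1) (.setNat 25 (.add (nv 1) (nv 16)) (.add (nv 1) (nv 16)))).run R s
    with hs1
  have f1 : s1.nat 1 0 = n := by rw [hs1, Program.run_nat R rfl, hn]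
  have f2 : s1.nat 23 = s.nat 23 := by rw [hs1, Program.run_nat R rfl]
  have f3 : s1.nat 24 = s.nat 24 := by rw [hs1, Program.run_nat R rfl]
  clear_value s1
  refine Program.loop_induct R (x := 16) (e := nv 1) (s := s1) n f1
    (fun k s' => (∀ x < n, s'.nat 25 (n + x) = n + x) ∧
      ∀ c < k, s.nat 23 c ≠ 0 → ∀ x, s.nat 24 c ≤ x → x ≤ c →
        s'.nat 25 x = s.nat 24 c + c - x) ⟨h1, by simp⟩ ?_
  rintro k s' hk hn' - ⟨hI1, hI2⟩
  have e1 : s'.nat 1 0 = n := by rw [hn' 1 rfl, f1]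
  have e2 : s'.nat 23 = s.nat 23 := by rw [hn' 23 rfl, f2]
  have e3 : s'.nat 24 = s.nat 24 := by rw [hn' 24 rfl, f3]
  have red : Program.run R (.ifLt (.const 0) (.read 23 (nv 16))
      (.loop 21 (nv 1) (.ifLt (nv 21) (.read 24 (nv 16)) .skip (.ifLt (nv 16) (nv 21) .skip
        (.setNat 25 (nv 21) (.sub (.add (.read 24 (nv 16)) (nv 16)) (nv 21)))))) .skip)
      (s'.setNat 16 0 k) = if s.nat 23 k = 0 then s'.setNat 16 0 k else
      Program.run R (.loop 21 (nv 1) (.ifLt (nv 21) (.read 24 (nv 16)) .skip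
        (.ifLt (nv 16) (nv 21) .skip
        (.setNat 25 (nv 21) (.sub (.add (.read 24 (nv 16)) (nv 16)) (nv 21))))))
      (s'.setNat 16 0 k) := by
    rw [Program.run, Program.run]
    simp only [NExp.eval, Memory.setNat_nat, and_self, if_true, show (23 : ℕ) ≠ 16 by decide,
      false_and, if_false, e2, Nat.pos_iff_ne_zero, ite_not]
  rw [red]
  split_ifs with hc
  · refine ⟨by simpa using hI1, fun c hc' hc0 => ?_⟩
    rcases Nat.lt_succ_iff_lt_or_eq.1 hc' with hc' | rfl
    · simpa using hI2 c hc' hc0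
    · exact absurd hc hc0
  · have := Program.loop_induct R (x := 21) (e := nv 1)
      (P := .ifLt (nv 21) (.read 24 (nv 16)) .skip (.ifLt (nv 16) (nv 21) .skip
        (.setNat 25 (nv 21) (.sub (.add (.read 24 (nv 16)) (nv 16)) (nv 21)))))
      (s := s'.setNat 16 0 k) n (by simp [NExp.eval, e1])
      (fun q s'' => (∀ x < n, s''.nat 25 (n + x) = n + x) ∧
        (∀ c < k, s.nat 23 c ≠ 0 → ∀ x, s.nat 24 c ≤ x → x ≤ c →
          s''.nat 25 x = s.nat 24 c + c - x) ∧
        ∀ x < q, s.nat 24 k ≤ x → x ≤ k → s''.nat 25 x = s.nat 24 k + k - x)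
      (by simpa using ⟨hI1, hI2⟩) (by
        rintro q s'' hq hn2 - ⟨j1, j2, j3⟩
        have g1 : s''.nat 16 0 = k := by rw [hn2 16 rfl]; simp
        have g2 : s''.nat 24 = s.nat 24 := by
          rw [hn2 24 rfl, Memory.setNat_nat_of_ne _ _ _ (by decide), e3]
        simp only [Program.run, NExp.eval, Memory.setNat_nat, g1, g2, and_self, if_true,
          show (24 : ℕ) ≠ 21 by decide, show (16 : ℕ) ≠ 21 by decide, false_and, if_false]
        split_ifs with c1 c2
        · refine ⟨by simpa using j1, by simpa using j2, fun x hx h1 h2 => ?_⟩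
          simpa using j3 x (by omega) h1 h2
        · refine ⟨by simpa using j1, by simpa using j2, fun x hx h1 h2 => ?_⟩
          simpa using j3 x (by omega) h1 h2
        · refine ⟨fun x hx => ?_, fun c hc' hc0 x h1 h2 => ?_, fun x hx h1 h2 => ?_⟩
          · simp [show n + x ≠ q by omega, j1 x hx]
          -- Earlier blocks end before block `k` begins, so their part of the permutation is not
          -- overwritten.
          · have := h.lt_st hk.le hc' hc0
            simp [show x ≠ q by omega, j2 c hc' hc0 x h1 h2]
          · rcases Nat.lt_succ_iff_lt_or_eq.1 hx with hx | rfl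
            · simp [hx.ne, j3 x hx h1 h2]
            · simp)
    refine ⟨this.1, fun c hc' hc0 x h1 h2 => ?_⟩
    rcases Nat.lt_succ_iff_lt_or_eq.1 hc' with hc' | rfl
    · exact this.2.1 c hc' hc0 x h1 h2
    · exact this.2.2 x (by omega) h1 h2

/-- Only the columns of `P` and the rows of `Q` are permuted, and the product `P * Q` does not
change. -/
theorem IsConj.permute {n : ℕ} {A : Matrix (Fin n) (Fin n) ℂ} {G G' : ℕ → ℕ → ℂ} (h : IsConj A G)
    {o : ℕ → ℕ} (ho1 : ∀ x < n, o x < n) (ho2 : ∀ x < n, o (o x) = x)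
    (ho3 : ∀ x < n, o (n + x) = n + x)
    (hG : ∀ i < 2 * n, ∀ j < 2 * n, G' i j = G (o i) (o j)) : IsConj A G' := by
  obtain ⟨P, Q, hPQ, hG0⟩ := h
  let e : Fin n ≃ Fin n :=
    { toFun := fun x => ⟨o x, ho1 x x.2⟩
      invFun := fun x => ⟨o x, ho1 x x.2⟩
      left_inv := fun x => Fin.ext (ho2 x x.2)
      right_inv := fun x => Fin.ext (ho2 x x.2) }
  have he : ∀ x, ((e x : Fin n) : ℕ) = o x := fun x => rfl
  refine ⟨P.submatrix id e, Q.submatrix e id, ?_, fun i j => ?_⟩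
  · rw [Matrix.submatrix_mul_equiv, hPQ]; rfl
  · have hi := i.2
    have hj := j.2
    rw [hG _ (by omega) _ (by omega), hG _ (by omega) _ (by omega), hG _ (by omega) _ (by omega),
      ho3 i hi, ho3 j hj, ← he, ← he]
    refine ⟨?_, (hG0 _ _).2.1, (hG0 _ _).2.2⟩
    rw [(hG0 _ _).1]
    rfl

theorem IsCompanion.exists_block {n : ℕ} {cl st : ℕ → ℕ} {G : ℕ → ℕ → ℂ}
    (h : IsCompanion n n cl st G) {x : ℕ} (hx : x < n) :
    ∃ k < n, x ≤ k ∧ cl k ≠ 0 ∧ st k ≤ x := by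
  suffices ∃ k < n, x ≤ k ∧ cl k ≠ 0 ∧ st k = st x by
    obtain ⟨k, h1, h2, h3, h4⟩ := this
    exact ⟨k, h1, h2, h3, h4.trans_le (h.st_le hx.le)⟩
  induction hd : n - x using Nat.strong_induction_on generalizing x with
  | _ d ih =>
    by_cases h0 : cl x = 0
    · have h1 := h.lt x hx h0
      obtain ⟨k, k1, k2, k3, k4⟩ := ih (n - (x + 1)) (by omega) h1 rfl
      exact ⟨k, k1, by omega, k3, by rw [k4, h.st_succ x hx, if_pos h0]⟩
    · exact ⟨x, hx, le_rfl, h0, rfl⟩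

/-- The matrix is block upper triangular with lower bidiagonal diagonal blocks. Reversing the order
inside each block makes these upper bidiagonal and preserves the order of the blocks. -/
theorem reverseProg_run (R : RootFinder) (s : Memory) {n : ℕ} {A : Matrix (Fin n) (Fin n) ℂ}
    {G₀ : ℕ → ℕ → ℂ} {lam : ℕ → ℂ}
    (hn : s.nat 1 0 = n) (h2n : s.nat 2 0 = 2 * n) (hA : IsConj A (s.arr 10))
    (h : IsCompanion n n (s.nat 23) (s.nat 24) G₀)
    (h1 : ∀ c < n, s.nat 23 c = 0 → ∀ i < n, s.arr 10 i c =
        if i = c then lam c else if i = c + 1 then 1 else 0)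
    (h2 : ∀ c < n, s.nat 23 c ≠ 0 → ∀ i < n, s.nat 24 c ≤ i → s.arr 10 i c =
        if i = c then lam c else 0) :
    IsConj A ((reverseProg.run R s).arr 10) ∧
      ∀ i < n, ∀ j < i, (reverseProg.run R s).arr 10 i j = 0 := by
  obtain ⟨o1, o2⟩ := orderProg_run R s hn h
  rw [reverseProg, Program.run, Program.run]
  set s1 := orderProg.run R s with hs1
  have f2 : s1.nat 2 0 = 2 * n := by rw [hs1, Program.run_nat R rfl, h2n]
  have f3 : s1.arr 10 = s.arr 10 := by rw [hs1, Program.run_arr R rfl]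
  clear_value s1
  have g1 := fill_run R s1 (d := 12) (a := 2) (b := 2) (ro := .const 0) (co := .const 0)
    (f := .read 10 (.read 25 (nv 17)) (.read 25 (nv 18))) (by decide) f2 f2
    (r := 0) (c := 0) (fun _ _ => rfl) (fun _ _ => rfl)
    (fun i j => s.arr 10 (s1.nat 25 i) (s1.nat 25 j)) (by
      intro s' k1 k2 _ _
      simp only [CExp.eval, NExp.eval, k1 25 (by decide) (by decide), k2 10 (by decide), f3])
  set s2 := (fill 12 2 2 (.const 0) (.const 0)
    (.read 10 (.read 25 (nv 17)) (.read 25 (nv 18)))).run R s1 with hs2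
  have f4 : s2.nat 2 0 = 2 * n := by rw [hs2, Program.run_nat R rfl, f2]
  have f5 : s2.arr 10 = s.arr 10 := by rw [hs2, Program.run_arr R rfl, f3]
  clear_value s2
  have g2 := fill_run R s2 (d := 10) (a := 2) (b := 2) (ro := .const 0) (co := .const 0)
    (f := .read 12 (nv 17) (nv 18)) (by decide) f4 f4
    (r := 0) (c := 0) (fun _ _ => rfl) (fun _ _ => rfl)
    (fun i j => s2.arr 12 i j) (by
      intro s' k1 k2 _ _
      simp only [CExp.eval, NExp.eval, k2 12 (by decide)])
  set s3 := (fill 10 2 2 (.const 0) (.const 0) (.read 12 (nv 17) (nv 18))).run R s2 with hs3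
  have key : ∀ i < 2 * n, ∀ j < 2 * n, s3.arr 10 i j = s.arr 10 (s1.nat 25 i) (s1.nat 25 j) := by
    intro i hi j hj
    rw [g2, g1]
    simp [hi, hj]
  clear_value s3
  constructor
  · refine hA.permute (o := s1.nat 25) (fun x hx => ?_) (fun x hx => ?_) o1 key
    · obtain ⟨k, k1, k2, k3, k4⟩ := h.exists_block hx
      rw [o2 k k1 k3 x k4 k2]; omega
    · obtain ⟨k, k1, k2, k3, k4⟩ := h.exists_block hx
      rw [o2 k k1 k3 x k4 k2, o2 k k1 k3 _ (by omega) (by omega)]; omega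
  · intro i hi j hj
    rw [key i (by omega) j (by omega)]
    obtain ⟨k, k1, k2, k3, k4⟩ := h.exists_block hi
    obtain ⟨k', k1', k2', k3', k4'⟩ := h.exists_block (x := j) (by omega)
    rw [o2 k k1 k3 i k4 k2, o2 k' k1' k3' j k4' k2']
    -- As `j < i`, the block of `j` cannot come after that of `i`.
    have hkk : k' ≤ k := by
      by_contra hlt
      have := h.lt_st k1'.le (show k < k' by omega) k3
      omega
    have hlt : k' < k → k' < s.nat 24 k := fun hlt => h.lt_st k1.le hlt k3'
    by_cases h0 : s.nat 23 (s.nat 24 k' + k' - j) = 0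
    · have hle : s.nat 24 k' + k' - j < k' := by
        rcases (show s.nat 24 k' + k' - j ≤ k' by omega).lt_or_eq with h3 | h3
        · exact h3
        · rw [h3] at h0; exact absurd h0 k3'
      rw [h1 _ (by omega) h0 _ (by omega)]
      rcases hkk.lt_or_eq with h3 | h3
      · have := hlt h3
        rw [if_neg (by omega), if_neg (by omega)]
      · subst h3
        rw [if_neg (by omega), if_neg (by omega)]
    · have hst : s.nat 24 k' + k' - j = k' := by
        by_contra hne
        have := h.lt_st k1'.le (show s.nat 24 k' + k' - j < k' by omega) h0
        omega
      rw [hst]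
      rcases hkk.lt_or_eq with h3 | h3
      · have := hlt h3
        rw [h2 _ (by omega) k3' _ (by omega) (by omega), if_neg (by omega)]
      · subst h3
        rw [h2 _ (by omega) k3' _ (by omega) (by omega), if_neg (by omega)]

end ComplexRAM

namespace ComplexRAM

/-! ### Jordan form of a triangular matrix: the combinatorics of chains

The first `j` basis vectors form Jordan chains: `nx p = r + 1` means that `b_r` is the successor of
`b_p`, i.e. `(A - λ) b_p = b_r`, and `nx p = 0` that `(A - λ) b_p = 0`. `len p` is the number of vectors
in the chain from `b_p` on, `tl p` is the last index of this chain. -/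

/-- Chains on the indices below `j`. -/
structure IsForest (j : ℕ) (nx len tl : ℕ → ℕ) : Prop where
  nx_le : ∀ p < j, nx p ≤ p
  len_pos : ∀ p < j, 0 < len p
  len_zero : ∀ p < j, nx p = 0 → len p = 1
  len_succ : ∀ p < j, ∀ r, nx p = r + 1 → len p = len r + 1
  tl_succ : ∀ p < j, ∀ r, nx p = r + 1 → tl r = tl p
  inj : ∀ p < j, ∀ q < j, tl p = tl q → len p = len q → p = q

/-- The field `inj` makes the trees paths: a vector is determined by the end of its chain and its
distance from there, so it has at most one predecessor. -/
theorem IsForest.nx_inj {j : ℕ} {nx len tl : ℕ → ℕ} (h : IsForest j nx len tl) {p q r : ℕ}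
    (hp : p < j) (hq : q < j) (h1 : nx p = r + 1) (h2 : nx q = r + 1) : p = q :=
  h.inj p hp q hq (by rw [← h.tl_succ p hp r h1, h.tl_succ q hq r h2])
    (by rw [h.len_succ p hp r h1, h.len_succ q hq r h2])

/-- The first `j` columns of an upper triangular matrix are in Jordan form. -/
structure IsJordan (n j : ℕ) (nx : ℕ → ℕ) (G : ℕ → ℕ → ℂ) : Prop where
  upper : ∀ i < n, ∀ c < i, G i c = 0
  col : ∀ p < j, ∀ i < p, G i p = if nx p = i + 1 then 1 else 0
  diag : ∀ p < j, ∀ r, nx p = r + 1 → G r r = G p p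

theorem IsJordan.apply {n j : ℕ} {nx len tl : ℕ → ℕ} {G : ℕ → ℕ → ℂ} (h : IsJordan n j nx G)
    (hF : IsForest j nx len tl) {p i : ℕ} (hp : p < j) (hi : i < n) :
    G i p = if i = p then G p p else if nx p = i + 1 then 1 else 0 := by
  have := hF.nx_le p hp
  rcases Nat.lt_trichotomy i p with h1 | h1 | h1
  · rw [h.col p hp i h1, if_neg h1.ne]
  · simp [h1]
  · rw [h.upper i hi p h1, if_neg h1.ne', if_neg (by omega)]

/-- In column `j`, the coefficients of indices `p ≥ p₀` have been removed where possible. -/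
def IsReduced (j : ℕ) (nx : ℕ → ℕ) (p₀ : ℕ) (G : ℕ → ℕ → ℂ) : Prop :=
  ∀ p < j, p₀ ≤ p → (G p p ≠ G j j → G p j = 0) ∧
    (G p p = G j j → ∀ r, nx p = r + 1 → G r j = 0)

/-- Adding `κ b_p` to `b_j` changes column `j` by `κ (G - G j j) e_p` and no earlier column, since
row `j` is zero there. -/
theorem IsJordan.addConj {n j : ℕ} {nx : ℕ → ℕ} {G : ℕ → ℕ → ℂ} (h : IsJordan n j nx G)
    (hj : j < n) {p : ℕ} (hp : p < j) (κ : ℂ) :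
    IsJordan n j nx (addConj (2 * n) j p κ G) ∧
      (∀ i < n, addConj (2 * n) j p κ G i i = G i i) ∧
      ∀ i < n, addConj (2 * n) j p κ G i j =
        G i j + κ * G i p - if i = p then κ * G j j else 0 := by
  have h0 : G j p = 0 := h.upper j hj p hp
  have hjj : ∀ i < n, ComplexRAM.addConj (2 * n) j p κ G i j =
        G i j + κ * G i p - if i = p then κ * G j j else 0 := fun i hi => by
    rw [addConj_apply (by omega) (by omega) (by omega)]; simp [h0]
  have hcol : ∀ i < n, ∀ c < j, ComplexRAM.addConj (2 * n) j p κ G i c = G i c := fun i hi c hc =>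
    addConj_col (by omega) (by omega) (by omega) hc.ne (h.upper j hj c hc)
  have hdiag : ∀ i < n, ComplexRAM.addConj (2 * n) j p κ G i i = G i i := fun i hi => by
    rcases Nat.lt_trichotomy i j with h1 | h1 | h1
    · exact hcol i hi i h1
    · subst h1
      rw [hjj i hi, h0]; simp [hp.ne']
    · exact addConj_row (by omega) (by omega) (by omega) h1.ne' (by omega)
  refine ⟨⟨fun i hi c hc => ?_, fun q hq i hi => ?_, fun q hq r hr => ?_⟩, hdiag, hjj⟩
  · rcases Nat.lt_trichotomy c j with h1 | h1 | h1
    · rw [hcol i hi c h1, h.upper i hi c hc]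
    · subst h1
      rw [hjj i hi, h.upper i hi c hc, h.upper i hi p (by omega)]
      simp [show i ≠ p by omega]
    · rw [addConj_row (by omega) (by omega) (by omega) h1.ne' (by omega), h.upper i hi c hc]
  · rw [hcol i (by omega) q hq, h.col q hq i hi]
  -- `IsJordan` alone does not bound `nx`, so diagonal entries outside the matrix must be considered
  -- as well; they are not touched.
  · by_cases hrn : r < n
    · rw [hdiag r hrn, hdiag q (by omega), h.diag q hq r hr]
    · have := h.diag q hq r hr
      have e : ComplexRAM.addConj (2 * n) j p κ G r r = G r r := by
        simp [ComplexRAM.addConj, show r ≠ p by omega, show r ≠ j by omega]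
      rw [e, hdiag q (by omega), this]

/-- For a different eigenvalue, `b_p` removes its own coefficient; for the same eigenvalue `(G - λ)
e_p` is the successor of `e_p`, whose coefficient is removed. Since successors have smaller indices,
descending order does not destroy what has been achieved. -/
theorem IsReduced.step {n j : ℕ} {nx len tl : ℕ → ℕ} {G : ℕ → ℕ → ℂ} (h : IsJordan n j nx G)
    (hF : IsForest j nx len tl) (hj : j < n) {p : ℕ} (hp : p < j)
    (hR : IsReduced j nx (p + 1) G) (κ : ℂ)
    (h1 : G p p ≠ G j j → κ = -(G p j / (G p p - G j j)))
    (h2 : G p p = G j j → ∀ r, nx p = r + 1 → κ = -G r j) :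
    IsReduced j nx p (addConj (2 * n) j p κ G) := by
  obtain ⟨-, hd, hc⟩ := h.addConj hj hp κ
  intro q hq hpq
  rw [hd q (by omega), hd j hj, hc q (by omega)]
  rcases hpq.eq_or_lt with rfl | hpq
  · refine ⟨fun hne => ?_, fun he r hr => ?_⟩
    · have : G p p - G j j ≠ 0 := sub_ne_zero.2 hne
      rw [if_pos rfl, h1 hne]
      field_simp
      ring
    · have := hF.nx_le p hp
      rw [hc r (by omega), h2 he r hr, h.col p hp r (by omega), if_pos hr,
        if_neg (show ¬ r = p by omega)]
      ring
  · obtain ⟨hq1, hq2⟩ := hR q hq hpq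
    have hqp : G q p = 0 := h.upper q (by omega) p hpq
    refine ⟨fun hne => ?_, fun he r hr => ?_⟩
    · rw [hq1 hne, hqp, if_neg hpq.ne']; simp
    · have hrq := hF.nx_le q hq
      rw [hc r (by omega), hq2 he r hr]
      -- If `p` is the successor of a treated `q`, it has the eigenvalue of `b_j` and its own
      -- coefficient does not change. No entry arises at a successor of `q` in any other way, by
      -- `IsForest.nx_inj`.
      by_cases hrp : r = p
      · subst hrp
        have : G r r = G j j := by rw [h.diag q hq r hr, he]
        rw [if_pos rfl, this]; ring
      · rw [if_neg hrp, h.apply hF hp (by omega), if_neg hrp, if_neg]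
        · simp
        · intro h3
          have := hF.nx_inj hp hq h3 hr
          omega

/-- What is left is a complement of the image of `G - λ`: within one eigenvalue, only vectors
without predecessor can still occur. -/
theorem IsReduced.head {j : ℕ} {nx : ℕ → ℕ} {G : ℕ → ℕ → ℂ}
    (hD : ∀ p < j, ∀ r, nx p = r + 1 → G r r = G p p)
    (hR : IsReduced j nx 0 G) {q : ℕ} (hq : q < j) (h0 : G q j ≠ 0) :
    G q q = G j j ∧ ∀ p < j, nx p ≠ q + 1 := by
  have h1 : G q q = G j j := by
    by_contra hne
    exact h0 ((hR q hq (Nat.zero_le _)).1 hne)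
  refine ⟨h1, fun p hp hpq => h0 ?_⟩
  exact (hR p hp (Nat.zero_le _)).2 (by rw [← hD p hp q hpq, h1]) q hpq

/-- The state while multiples of other chains are added to the chain of `h`. The multiple `kap i` of
`b_i` is to be added to `b_{par i}`, and has been added for `i ≥ q₀`. -/
structure IsMerging (n j h : ℕ) (c : ℂ) (ev : ℕ → ℂ) (nx len tl : ℕ → ℕ) (q₀ : ℕ) (kap : ℕ → ℂ)
    (par : ℕ → ℕ) (G : ℕ → ℕ → ℂ) : Prop where
  col : ∀ p < j, ∀ i < n, G i p = if i = p then ev p else if nx p = i + 1 then 1 else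
    if i < q₀ ∧ (∃ p' < j, nx p' = i + 1) ∧ nx p = par i + 1 then kap i else 0
  last : ∀ i < j, G i j = if i = h then c else
    if i < q₀ ∧ ¬ (∃ p' < j, nx p' = i + 1) then kap i * c else 0
  diag : G j j = ev j
  upper : ∀ i < n, ∀ c < i, j ≤ c → G i c = 0
  diag' : ∀ i < n, j < i → G i i = ev i
  tl_ne : ∀ i < q₀, kap i ≠ 0 → tl i ≠ tl h
  par_lt : ∀ i < q₀, kap i ≠ 0 → par i < j
  tl_par : ∀ i < q₀, kap i ≠ 0 → tl (par i) = tl h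
  len_le : ∀ i < q₀, kap i ≠ 0 → len i ≤ len (par i)
  ev_par : ∀ i < q₀, kap i ≠ 0 → ev i = ev (par i)
  par_head : ∀ i < q₀, kap i ≠ 0 → ¬ (∃ p' < j, nx p' = i + 1) → par i = h
  par_inner : ∀ i < q₀, kap i ≠ 0 → (∃ p' < j, nx p' = i + 1) → ∃ p' < j, nx p' = par i + 1
  todo : ∀ q < q₀, ∀ r, nx q = r + 1 → kap r = 0

theorem IsMerging.skip {n j h : ℕ} {c : ℂ} {ev : ℕ → ℂ} {nx len tl : ℕ → ℕ} {q : ℕ} {kap : ℕ → ℂ}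
    {par : ℕ → ℕ} {G : ℕ → ℕ → ℂ} (hM : IsMerging n j h c ev nx len tl (q + 1) kap par G)
    (hq : kap q = 0) : IsMerging n j h c ev nx len tl q kap par G where
  col p hp i hi := by
    rw [hM.col p hp i hi]
    by_cases hiq : i = q
    · subst hiq; simp [hq]
    · simp only [show i < q + 1 ↔ i < q by omega]
  last i hi := by
    rw [hM.last i hi]
    by_cases hiq : i = q
    · subst hiq; simp [hq]
    · simp only [show i < q + 1 ↔ i < q by omega]
  diag := hM.diag
  upper := hM.upper
  diag' := hM.diag'
  tl_ne i hi := hM.tl_ne i (by omega)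
  par_lt i hi := hM.par_lt i (by omega)
  tl_par i hi := hM.tl_par i (by omega)
  len_le i hi := hM.len_le i (by omega)
  ev_par i hi := hM.ev_par i (by omega)
  par_head i hi := hM.par_head i (by omega)
  par_inner i hi := hM.par_inner i (by omega)
  todo i hi := hM.todo i (by omega)

/-- Adding `κ b_q` to `b_p` removes the unwanted entry in row `q`, but `(A - λ) b_p` now contains
`κ` times the successor of `b_q`. The same multiple is therefore scheduled for the two successors.
Successors have smaller indices, so one descending pass suffices, and each vector has at most one
predecessor from which such a task can come. -/
theorem IsMerging.step {n j h : ℕ} {c : ℂ} {ev : ℕ → ℂ} {nx len tl : ℕ → ℕ} {q : ℕ} {kap : ℕ → ℂ}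
    {par : ℕ → ℕ} {G : ℕ → ℕ → ℂ} (hM : IsMerging n j h c ev nx len tl (q + 1) kap par G)
    (hF : IsForest j nx len tl) (hev : ∀ p < j, ∀ r, nx p = r + 1 → ev r = ev p) (hjn : j < n)
    (hh : h < j) (hhead : ∀ p < j, nx p ≠ h + 1) (hqj : q < j) (hq : kap q ≠ 0) :
    IsMerging n j h c ev nx len tl q (fun i => if nx q = i + 1 then kap q else kap i)
      (fun i => if nx q = i + 1 then nx (par q) - 1 else par i)
      (addConj (2 * n) (par q) q (kap q) G) := by
  have hp := hM.par_lt q (by omega) hq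
  have htp := hM.tl_par q (by omega) hq
  have htq := hM.tl_ne q (by omega) hq
  have hlen := hM.len_le q (by omega) hq
  have hevp := hM.ev_par q (by omega) hq
  set p := par q with hpdef
  have hpq : p ≠ q := by rintro h; rw [h] at htp; exact htq htp
  -- The target lies in the chain of `h`, and nothing is scheduled for vectors of that chain.
  have hkp : kap p = 0 ∨ ¬ p < q + 1 := by
    by_contra hcon
    push Not at hcon
    exact hM.tl_ne p hcon.2 hcon.1 htp
  -- column `q`
  have colq : ∀ i < n, G i q = if i = q then ev q else if nx q = i + 1 then 1 else 0 := by
    intro i hi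
    rw [hM.col q hqj i hi]
    congr 2
    rw [ite_eq_right_iff]
    rintro ⟨h1, h2, h3⟩
    by_contra h4
    exact htq (by rw [← hF.tl_succ q hqj _ h3, hM.tl_par i h1 h4])
  have hnqp : nx q ≠ p + 1 := fun h3 => htq (by rw [← hF.tl_succ q hqj _ h3, htp])
  have hGpq : G p q = 0 := by rw [colq p (by omega), if_neg hpq, if_neg hnqp]
  -- row `p`
  have rowp : ∀ x < j, x ≠ p → G p x = if nx x = p + 1 then 1 else 0 := by
    intro x hx hxp
    rw [hM.col x hx p (by omega), if_neg hxp.symm]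
    congr 1
    rw [ite_eq_right_iff]
    rintro ⟨h1, -, -⟩
    rcases hkp with h2 | h2
    · exact h2
    · exact absurd h1 h2
  -- If `b_q` has a successor, so has `b_p`, because the chain of `b_p` is at least as long. This is
  -- where the choice of a longest chain matters.
  have hnxp : ∀ r, nx q = r + 1 → nx p ≠ 0 ∧ r < q ∧ kap r = 0 := by
    intro r hr
    refine ⟨fun h0 => ?_, ?_, hM.todo q (by omega) r hr⟩
    · have h1 := hF.len_zero p hp h0
      have h2 := hF.len_succ q hqj r hr
      have h3 := hF.nx_le q hqj
      have h4 := hF.len_pos r (by omega)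
      omega
    · have := hF.nx_le q hqj; omega
  refine ⟨?_, ?_, ?_, ?_, ?_, ?_, ?_, ?_, ?_, ?_, ?_, ?_, ?_⟩
  · -- columns below `j`
    intro x hx i hi
    rw [addConj_apply (by omega) (by omega) (by omega)]
    by_cases hxp : x = p
    · subst hxp
      rw [if_pos rfl, if_pos rfl, hGpq]
      by_cases hiq : i = q
      · subst hiq
        rw [if_pos rfl, colq i hi, hM.col p hp i hi, hM.col p hp p (by omega), if_pos rfl,
          if_pos rfl, if_neg hpq.symm, if_neg, if_neg, if_neg hpq.symm, if_neg, if_neg]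
        · rw [hevp]; ring
        · rintro ⟨h1, -⟩; omega
        · intro h1; exact htq (by rw [hF.tl_succ p hp _ h1, htp])
        · rintro ⟨-, -, h3⟩
          have := hF.nx_le p hp
          omega
        · intro h1; exact htq (by rw [hF.tl_succ p hp _ h1, htp])
      · rw [if_neg hiq, colq i hi, if_neg hiq, sub_zero]
        by_cases hir : nx q = i + 1
        · obtain ⟨h1, h2, h3⟩ := hnxp i hir
          have hti : tl i ≠ tl h := by rw [hF.tl_succ q hqj i hir]; exact htq
          have hip : i ≠ p := by intro h4; rw [h4] at hti; exact hti htp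
          have hnip : nx p ≠ i + 1 := fun h4 => hti (by rw [hF.tl_succ p hp _ h4, htp])
          have hold : G i p = 0 := by
            rw [hM.col p hp i hi, if_neg hip, if_neg hnip, h3, ite_self]
          have hnew : i < q ∧ (∃ p' < j, nx p' = i + 1) ∧ nx p = nx p - 1 + 1 :=
            ⟨h2, ⟨q, hqj, hir⟩, by omega⟩
          simp only [hold, hir, hip, hnip, if_true, if_false]
          rw [if_pos hnew]; ring
        · simp only [hir, if_false, mul_zero, add_zero]
          rw [hM.col p hp i hi]
          simp only [show i < q + 1 ↔ i < q by omega]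
    · rw [if_neg hxp, if_neg hxp]
      by_cases hiq : i = q
      · subst hiq
        rw [if_pos rfl, rowp x hx hxp]
        have hni : ¬ (i < i) := by omega
        simp only [hni, false_and, if_false]
        rw [hM.col x hx i hi]
        by_cases hxi : i = x
        · subst hxi
          simp [hnqp]
        · rw [if_neg hxi, if_neg hxi]
          by_cases h1 : nx x = p + 1
          · have h2 : nx x ≠ i + 1 := by omega
            have h3 : ∃ p' < j, nx p' = i + 1 := by
              by_contra h4
              have := hM.par_head i (by omega) hq h4
              exact hhead x hx (by rw [h1, hpdef, this])
            rw [if_neg h2, if_neg h2, if_pos ⟨by omega, h3, h1⟩, if_pos h1]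
            ring
          · have h2 : ¬ (i < i + 1 ∧ (∃ p' < j, nx p' = i + 1) ∧ nx x = par i + 1) := by
              rintro ⟨-, -, h3⟩; exact h1 h3
            rw [if_neg h1, if_neg h2]
            simp
      · rw [if_neg hiq, sub_zero, hM.col x hx i hi]
        congr 2
        by_cases hir : nx q = i + 1
        · obtain ⟨h1, h2, h3⟩ := hnxp i hir
          rw [h3, ite_self, if_neg]
          rintro ⟨-, -, h4⟩
          simp only [hir, if_true] at h4
          exact hxp (hF.nx_inj (r := nx p - 1) hx hp h4 (by omega))
        · simp only [hir, if_false, show i < q + 1 ↔ i < q by omega]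
  · -- column `j`
    intro i hi
    rw [addConj_apply (by omega) (by omega) (by omega), if_neg (show j ≠ p by omega),
      if_neg (show j ≠ p by omega)]
    by_cases hiq : i = q
    · subst hiq
      have hih : i ≠ h := by rintro rfl; exact htq rfl
      have hni : ¬ (i < i) := by omega
      rw [if_pos rfl, hM.last p hp, hM.last i hi, if_neg hih, if_neg hih]
      simp only [hni, false_and, if_false]
      by_cases hH : ∃ p' < j, nx p' = i + 1
      · obtain ⟨p', h1, h2⟩ := hM.par_inner i (by omega) hq hH
        have hph : p ≠ h := by rintro rfl; exact hhead p' h1 h2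
        rw [if_neg fun h => h.2 hH, if_neg hph]
        rcases hkp with h3 | h3
        · simp [h3]
        · rw [if_neg fun h => h3 h.1]; simp
      · have hph : p = h := hM.par_head i (by omega) hq hH
        rw [if_pos ⟨by omega, hH⟩, if_pos hph, sub_self]
    · rw [if_neg hiq, sub_zero, hM.last i hi]
      congr 1
      by_cases hir : nx q = i + 1
      · have hH : ∃ p' < j, nx p' = i + 1 := ⟨q, hqj, hir⟩
        rw [if_neg fun h => h.2 hH, if_neg fun h => h.2 hH]
      · simp only [hir, if_false, show i < q + 1 ↔ i < q by omega]
  · rw [addConj_row (by omega) (by omega) (by omega) (by omega) (by omega), hM.diag]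
  · intro i hi x hx hjx
    rw [addConj_row (by omega) (by omega) (by omega) (by omega) (by omega), hM.upper i hi x hx hjx]
  · intro i hi hji
    rw [addConj_row (by omega) (by omega) (by omega) (by omega) (by omega), hM.diag' i hi hji]
  · intro i hi
    by_cases hir : nx q = i + 1
    · simp only [hir, if_true]
      intro _
      rw [hF.tl_succ q hqj i hir]; exact htq
    · simp only [hir, if_false]; exact hM.tl_ne i (by omega)
  · intro i hi
    by_cases hir : nx q = i + 1
    · simp only [hir, if_true]
      intro _
      have := hF.nx_le p hp
      omega
    · simp only [hir, if_false]; exact hM.par_lt i (by omega)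
  · intro i hi
    by_cases hir : nx q = i + 1
    · simp only [hir, if_true]
      intro _
      have h1 := (hnxp i hir).1
      rw [hF.tl_succ p hp _ (show nx p = (nx p - 1) + 1 by omega), htp]
    · simp only [hir, if_false]; exact hM.tl_par i (by omega)
  · intro i hi
    by_cases hir : nx q = i + 1
    · simp only [hir, if_true]
      intro _
      have h1 := (hnxp i hir).1
      have h2 := hF.len_succ p hp _ (show nx p = (nx p - 1) + 1 by omega)
      have h3 := hF.len_succ q hqj i hir
      omega
    · simp only [hir, if_false]; exact hM.len_le i (by omega)
  · intro i hi
    by_cases hir : nx q = i + 1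
    · simp only [hir, if_true]
      intro _
      have h1 := (hnxp i hir).1
      rw [hev p hp _ (show nx p = (nx p - 1) + 1 by omega), hev q hqj i hir, hevp]
    · simp only [hir, if_false]; exact hM.ev_par i (by omega)
  · intro i hi
    by_cases hir : nx q = i + 1
    · intro _ hH
      exact absurd ⟨q, hqj, hir⟩ hH
    · simp only [hir, if_false]; exact hM.par_head i (by omega)
  · intro i hi
    by_cases hir : nx q = i + 1
    · simp only [hir, if_true]
      intro _ _
      have h1 := (hnxp i hir).1
      exact ⟨p, hp, by omega⟩
    · simp only [hir, if_false]; exact hM.par_inner i (by omega)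
  · intro x hx r hr
    by_cases hir : nx q = r + 1
    · exact absurd (hF.nx_inj hqj (by omega) hir hr) (by omega)
    · simp only [hir, if_false]; exact hM.todo x (by omega) r hr

end ComplexRAM

namespace ComplexRAM

/-! ### Attaching a new vector to the chains -/

/-- From a vector further from the end, following the chain down by `d` steps would arrive at `x`
through a predecessor, which a head does not have. -/
theorem IsForest.eq_of_head {j : ℕ} {nx len tl : ℕ → ℕ} (h : IsForest j nx len tl) {x : ℕ}
    (hx : x < j) (hhead : ∀ p < j, nx p ≠ x + 1) :
    ∀ d y, y < j → tl y = tl x → len y = len x + d → y = x := by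
  intro d
  induction d with
  | zero => exact fun y hy h1 h2 => h.inj y hy x hx h1 h2
  | succ d ih =>
    intro y hy h1 h2
    exfalso
    have h3 := h.len_pos x hx
    have h4 : nx y ≠ 0 := fun h0 => by have := h.len_zero y hy h0; omega
    obtain ⟨r, hr⟩ := Nat.exists_eq_succ_of_ne_zero h4
    have h5 := h.len_succ y hy r hr
    have h6 := h.nx_le y hy
    have h7 := h.tl_succ y hy r hr
    obtain rfl := ih r (by omega) (h7.trans h1) (by omega)
    exact hhead y hy hr

/-- A new chain takes its own index as label of its end, which is fresh because all old labels are
below `j`. A vector placed before a head `h` inherits the label of `h`. -/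
theorem IsForest.extend {j : ℕ} {nx len tl nx' len' : ℕ → ℕ} (hF : IsForest j nx len tl)
    (h1 : ∀ p < j, nx' p = nx p) (h2 : ∀ p < j, len' p = len p)
    (h3 : nx' j = 0 ∧ len' j = 1 ∧ (∀ p < j, tl p < j) ∨
      ∃ h < j, nx' j = h + 1 ∧ len' j = len h + 1 ∧ (∀ p < j, nx p ≠ h + 1)) :
    ∃ tl', IsForest (j + 1) nx' len' tl' ∧ ((∀ p < j, tl p < j) → ∀ p < j + 1, tl' p < j + 1) := by
  have hlt : ∀ p, p < j + 1 → p ≠ j → p < j := by omega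
  rcases h3 with ⟨a1, a2, a3⟩ | ⟨h, hh, a1, a2, a3⟩
  · refine ⟨fun p => if p = j then j else tl p, ⟨?_, ?_, ?_, ?_, ?_, ?_⟩, ?_⟩
    · intro p hp
      by_cases hpj : p = j
      · subst hpj; omega
      · rw [h1 p (hlt p hp hpj)]; exact hF.nx_le p (hlt p hp hpj)
    · intro p hp
      by_cases hpj : p = j
      · subst hpj; omega
      · rw [h2 p (hlt p hp hpj)]; exact hF.len_pos p (hlt p hp hpj)
    · intro p hp
      by_cases hpj : p = j
      · subst hpj; intro; omega
      · rw [h1 p (hlt p hp hpj), h2 p (hlt p hp hpj)]; exact hF.len_zero p (hlt p hp hpj)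
    · intro p hp r hr
      by_cases hpj : p = j
      · subst hpj; omega
      · have := hlt p hp hpj
        rw [h1 p this] at hr
        have := hF.nx_le p this
        rw [h2 p (by omega), h2 r (by omega)]; exact hF.len_succ p (by omega) r hr
    · intro p hp r hr
      by_cases hpj : p = j
      · subst hpj; omega
      · have := hlt p hp hpj
        rw [h1 p this] at hr
        have := hF.nx_le p this
        simp only [hpj, show r ≠ j by omega, if_false]
        exact hF.tl_succ p (by omega) r hr
    · intro p hp q hq
      by_cases hpj : p = j <;> by_cases hqj : q = j
      · omega
      · have := a3 q (hlt q hq hqj)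
        simp only [hpj, hqj, if_true, if_false]; omega
      · have := a3 p (hlt p hp hpj)
        simp only [hpj, hqj, if_true, if_false]; omega
      · simp only [hpj, hqj, if_false]
        rw [h2 p (hlt p hp hpj), h2 q (hlt q hq hqj)]
        exact hF.inj p (hlt p hp hpj) q (hlt q hq hqj)
    · intro _ p hp
      by_cases hpj : p = j
      · simp [hpj]
      · have := a3 p (hlt p hp hpj)
        simp only [hpj, if_false]; omega
  -- The position in front of a head is still free, which gives injectivity for the new vector.
  · have key : ∀ p < j, tl p = tl h → len p ≠ len h + 1 := by
      intro p hp h4 h5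
      have := hF.eq_of_head hh a3 1 p hp h4 h5
      subst this; omega
    refine ⟨fun p => if p = j then tl h else tl p, ⟨?_, ?_, ?_, ?_, ?_, ?_⟩, ?_⟩
    · intro p hp
      by_cases hpj : p = j
      · subst hpj; omega
      · rw [h1 p (hlt p hp hpj)]; exact hF.nx_le p (hlt p hp hpj)
    · intro p hp
      by_cases hpj : p = j
      · subst hpj; omega
      · rw [h2 p (hlt p hp hpj)]; exact hF.len_pos p (hlt p hp hpj)
    · intro p hp
      by_cases hpj : p = j
      · subst hpj; intro; omega
      · rw [h1 p (hlt p hp hpj), h2 p (hlt p hp hpj)]; exact hF.len_zero p (hlt p hp hpj)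
    · intro p hp r hr
      by_cases hpj : p = j
      · subst hpj
        obtain rfl : r = h := by omega
        rw [a2, h2 r hh]
      · have := hlt p hp hpj
        rw [h1 p this] at hr
        have := hF.nx_le p this
        rw [h2 p (by omega), h2 r (by omega)]; exact hF.len_succ p (by omega) r hr
    · intro p hp r hr
      by_cases hpj : p = j
      · subst hpj
        obtain rfl : r = h := by omega
        simp [hh.ne]
      · have := hlt p hp hpj
        rw [h1 p this] at hr
        have := hF.nx_le p this
        simp only [hpj, show r ≠ j by omega, if_false]
        exact hF.tl_succ p (by omega) r hr
    · intro p hp q hq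
      by_cases hpj : p = j <;> by_cases hqj : q = j
      · omega
      · have := key q (hlt q hq hqj)
        have e := h2 q (hlt q hq hqj)
        simp only [hpj, hqj, if_true, if_false, a2, e]
        intro h4 h5
        exact absurd h5.symm (this h4.symm)
      · have := key p (hlt p hp hpj)
        have e := h2 p (hlt p hp hpj)
        simp only [hpj, hqj, if_true, if_false, a2, e]
        intro h4 h5
        exact absurd h5 (this h4)
      · simp only [hpj, hqj, if_false]
        rw [h2 p (hlt p hp hpj), h2 q (hlt q hq hqj)]
        exact hF.inj p (hlt p hp hpj) q (hlt q hq hqj)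
    · intro h4 p hp
      by_cases hpj : p = j
      · have := h4 h hh
        simp only [hpj, if_true]; omega
      · have := h4 p (hlt p hp hpj)
        simp only [hpj, if_false]; omega

theorem IsJordan.extend_zero {n j : ℕ} {nx nx' : ℕ → ℕ} {G : ℕ → ℕ → ℂ} (h : IsJordan n j nx G)
    (h1 : ∀ p < j, nx' p = nx p) (h2 : nx' j = 0) (h3 : ∀ i < j, G i j = 0) :
    IsJordan n (j + 1) nx' G where
  upper := h.upper
  col p hp i hi := by
    rcases Nat.lt_succ_iff_lt_or_eq.1 hp with hp | rfl
    · rw [h1 p hp, h.col p hp i hi]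
    · rw [h3 i hi, if_neg (by omega)]
  diag p hp r hr := by
    rcases Nat.lt_succ_iff_lt_or_eq.1 hp with hp | rfl
    · exact h.diag p hp r (by rw [← h1 p hp, hr])
    · omega

/-- Only heads are scheduled at first, all with target `h`. The coefficient is chosen so that column
`j` becomes a multiple of the modified `b_h`. -/
theorem IsMerging.start {n j h : ℕ} {nx len tl : ℕ → ℕ} {G : ℕ → ℕ → ℂ} {kap : ℕ → ℂ}
    {par : ℕ → ℕ} (hJ : IsJordan n j nx G) (hF : IsForest j nx len tl)
    (hR : IsReduced j nx 0 G) (hh : h < j) (h0 : G h j ≠ 0)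
    (hmax : ∀ p < j, G p j ≠ 0 → len p ≤ len h) (hpar : ∀ q < j, par q = h)
    (hkap : ∀ q < j, kap q = if q = h then 0 else G q j / G h j) :
    IsMerging n j h (G h j) (fun i => G i i) nx len tl j kap par G := by
  have hk : ∀ i < j, kap i ≠ 0 → i ≠ h ∧ G i j ≠ 0 := by
    intro i hi hne
    rw [hkap i hi] at hne
    by_cases hih : i = h
    · simp [hih] at hne
    · rw [if_neg hih] at hne
      exact ⟨hih, fun h => hne (by rw [h, zero_div])⟩
  have hnh : ∀ i < j, (∃ p' < j, nx p' = i + 1) → kap i = 0 := by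
    rintro i hi ⟨p, hp, hpi⟩
    by_contra hne
    exact (hR.head hJ.diag hi (hk i hi hne).2).2 p hp hpi
  refine ⟨?_, ?_, rfl, ?_, fun _ _ _ => rfl, ?_, ?_, ?_, ?_, ?_, ?_, ?_, ?_⟩
  · intro p hp i hi
    rw [hJ.apply hF hp hi]
    by_cases hip : i = p
    · rw [if_pos hip, if_pos hip]
    · rw [if_neg hip, if_neg hip]
      congr 1
      symm
      rw [ite_eq_right_iff]
      rintro ⟨h1, h2, -⟩
      exact hnh i h1 h2
  · intro i hi
    by_cases hih : i = h
    · simp [hih]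
    · rw [if_neg hih]
      by_cases hH : ∃ p' < j, nx p' = i + 1
      · rw [if_neg fun h => h.2 hH]
        by_contra hne
        obtain ⟨p, hp, hpi⟩ := hH
        exact (hR.head hJ.diag hi hne).2 p hp hpi
      · rw [if_pos ⟨hi, hH⟩, hkap i hi, if_neg hih, div_mul_cancel₀ _ h0]
  · exact fun i hi c hc _ => hJ.upper i hi c hc
  -- Two distinct heads cannot belong to the same chain.
  · intro i hi hne htl
    obtain ⟨h1, h2⟩ := hk i hi hne
    have h3 := hmax i hi h2
    exact h1 (hF.eq_of_head hi (hR.head hJ.diag hi h2).2 (len h - len i) h hh htl.symm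
      (by omega)).symm
  · intro i hi _; rw [hpar i hi]; exact hh
  · intro i hi _; rw [hpar i hi]
  · intro i hi hne; rw [hpar i hi]; exact hmax i hi (hk i hi hne).2
  · intro i hi hne
    rw [hpar i hi, (hR.head hJ.diag hi (hk i hi hne).2).1, (hR.head hJ.diag hh h0).1]
  · intro i hi _ _; exact hpar i hi
  · intro i hi hne hH
    exact absurd (hnh i hi hH) hne
  · intro q hq r hr
    have := hF.nx_le q hq
    exact hnh r (by omega) ⟨q, hq, hr⟩

/-- Now `(A - λ) b_j = c b_h`, so `b_j / c` is a predecessor of `b_h`. -/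
theorem IsMerging.finish {n j h : ℕ} {c : ℂ} {ev : ℕ → ℂ} {nx len tl nx' : ℕ → ℕ} {kap : ℕ → ℂ}
    {par : ℕ → ℕ} {G : ℕ → ℕ → ℂ} (hM : IsMerging n j h c ev nx len tl 0 kap par G)
    (hF : IsForest j nx len tl) (hev : ∀ p < j, ∀ r, nx p = r + 1 → ev r = ev p) (hjn : j < n)
    (hh : h < j) (hc : c ≠ 0) (hevh : ev h = ev j)
    (h1 : ∀ p < j, nx' p = nx p) (h2 : nx' j = h + 1) :
    IsJordan n (j + 1) nx' (scaleConj (2 * n) j (1 / c) G) := by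
  have hc' : (1 / c : ℂ) ≠ 0 := one_div_ne_zero hc
  have hcol : ∀ p < j, ∀ i < n, G i p = if i = p then ev p else if nx p = i + 1 then 1 else 0 := by
    intro p hp i hi
    rw [hM.col p hp i hi]; simp
  have hdiag : ∀ p < j + 1, scaleConj (2 * n) j (1 / c) G p p = ev p := by
    intro p hp
    rw [scaleConj_apply (by omega) (by omega) hc']
    rcases Nat.lt_succ_iff_lt_or_eq.1 hp with hp | rfl
    · simp [hp.ne, hcol p hp p (by omega)]
    · simp [hM.diag]
  refine ⟨fun i hi x hx => ?_, fun p hp i hi => ?_, fun p hp r hr => ?_⟩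
  · have : G i x = 0 := by
      by_cases hxj : j ≤ x
      · exact hM.upper i hi x hx hxj
      · have := hF.nx_le x (by omega)
        rw [hcol x (by omega) i hi, if_neg (by omega), if_neg (by omega)]
    rw [scaleConj_apply (by omega) (by omega) hc', this]
    simp
  · rw [scaleConj_apply (by omega) (by omega) hc', if_neg (by omega)]
    rcases Nat.lt_succ_iff_lt_or_eq.1 hp with hp | rfl
    · rw [if_neg hp.ne, hcol p hp i (by omega), if_neg hi.ne, h1 p hp]
    · rw [if_pos rfl, hM.last i hi, h2]
      by_cases hih : i = h
      · simp [hih, hc]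
      · simp [hih, show h ≠ i from fun h => hih h.symm]
  · rcases Nat.lt_succ_iff_lt_or_eq.1 hp with hp' | rfl
    · rw [h1 p hp'] at hr
      have := hF.nx_le p hp'
      rw [hdiag r (by omega), hdiag p hp, hev p hp' r hr]
    · obtain rfl : r = h := by omega
      rw [hdiag r (by omega), hdiag p hp, hevh]

/-! ### The program for the Jordan form -/

/-- Remove from column `j` what can be removed with the basis vector `p`, held in `nat 26 0`. -/
def reduceEntry : Program :=
  .ifZero (.sub (.read 10 (nv 26) (nv 26)) (.read 10 (nv 16) (nv 16)))
    (.ifLt (.const 0) (.read 27 (nv 26))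
      (addConjProg (nv 16) (nv 26)
        (.sub (.const 0) (.read 10 (.sub (.read 27 (nv 26)) (.const 1)) (nv 16)))) .skip)
    (addConjProg (nv 16) (nv 26) (.sub (.const 0) (.div (.read 10 (nv 26) (nv 16))
      (.sub (.read 10 (nv 26) (nv 26)) (.read 10 (nv 16) (nv 16))))))

/-- Put the index `n - 1 - q` into `nat 26 0`, where `q` is the counter of a loop. -/
def countDown : Program :=
  .setNat 26 (.const 0) (.sub (.sub (nv 1) (.const 1)) (nv 21))

/-- Reduce column `j`. -/
def reduceColumn : Program :=
  .loop 21 (nv 1) (.seq countDown (.ifLt (nv 26) (nv 16) reduceEntry .skip))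

theorem reduceEntry_run (R : RootFinder) (s : Memory) {n j p : ℕ} {A : Matrix (Fin n) (Fin n) ℂ}
    {len tl : ℕ → ℕ} (h2n : s.nat 2 0 = 2 * n) (hj : s.nat 16 0 = j) (hp : s.nat 26 0 = p)
    (hpj : p < j) (hjn : j < n) (hA : IsConj A (s.arr 10)) (hJ : IsJordan n j (s.nat 27) (s.arr 10))
    (hF : IsForest j (s.nat 27) len tl) (hR : IsReduced j (s.nat 27) (p + 1) (s.arr 10)) :
    IsConj A ((reduceEntry.run R s).arr 10) ∧
      IsJordan n j (s.nat 27) ((reduceEntry.run R s).arr 10) ∧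
      IsReduced j (s.nat 27) p ((reduceEntry.run R s).arr 10) := by
  have hne : j ≠ p := by omega
  rw [reduceEntry, Program.run]
  simp only [CExp.eval, NExp.eval, hp, hj]
  split_ifs with h0
  · have he : s.arr 10 p p = s.arr 10 j j := sub_eq_zero.1 h0
    rw [Program.run]
    simp only [NExp.eval, hp]
    split_ifs with h1
    · have e := addConjProg_run R s (p := nv 16) (q := nv 26)
        (κ := .sub (.const 0) (.read 10 (.sub (.read 27 (nv 26)) (.const 1)) (nv 16)))
        (c := -s.arr 10 (s.nat 27 p - 1) j) h2n hj (by simp [NExp.eval, hp])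
        (by simp [NExp.eval, CExp.eval, hp, hj]) hne
      rw [e]
      refine ⟨hA.addConj hjn (by omega) (by omega) _, (hJ.addConj hjn hpj _).1,
        hR.step hJ hF hjn hpj _ (fun h => absurd he h) fun _ r hr => ?_⟩
      rw [hr]; simp
    · rw [Program.run]
      refine ⟨hA, hJ, fun q hq hpq => ?_⟩
      rcases hpq.eq_or_lt with rfl | hpq
      · exact ⟨fun h => absurd he h, fun _ r hr => by omega⟩
      · exact hR q hq hpq
  · have he : s.arr 10 p p ≠ s.arr 10 j j := fun h => h0 (sub_eq_zero.2 h)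
    have e := addConjProg_run R s (p := nv 16) (q := nv 26)
      (κ := .sub (.const 0) (.div (.read 10 (nv 26) (nv 16))
        (.sub (.read 10 (nv 26) (nv 26)) (.read 10 (nv 16) (nv 16)))))
      (c := -(s.arr 10 p j / (s.arr 10 p p - s.arr 10 j j))) h2n hj (by simp [NExp.eval, hp])
      (by simp [NExp.eval, CExp.eval, hp, hj]) hne
    rw [e]
    exact ⟨hA.addConj hjn (by omega) (by omega) _, (hJ.addConj hjn hpj _).1,
      hR.step hJ hF hjn hpj _ (fun _ => rfl) fun h => absurd h he⟩

theorem reduceColumn_run (R : RootFinder) (s : Memory) {n j : ℕ} {A : Matrix (Fin n) (Fin n) ℂ}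
    {len tl : ℕ → ℕ} (hn : s.nat 1 0 = n) (h2n : s.nat 2 0 = 2 * n) (hj : s.nat 16 0 = j)
    (hjn : j < n) (hA : IsConj A (s.arr 10)) (hJ : IsJordan n j (s.nat 27) (s.arr 10))
    (hF : IsForest j (s.nat 27) len tl) :
    IsConj A ((reduceColumn.run R s).arr 10) ∧
      IsJordan n j (s.nat 27) ((reduceColumn.run R s).arr 10) ∧
      IsReduced j (s.nat 27) 0 ((reduceColumn.run R s).arr 10) := by
  -- After `q` passes the indices from `n - q` on have been visited; those not below `j` are skipped
  -- and impose no condition.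
  have key : IsConj A ((reduceColumn.run R s).arr 10) ∧
      IsJordan n j (s.nat 27) ((reduceColumn.run R s).arr 10) ∧
      IsReduced j (s.nat 27) (n - n) ((reduceColumn.run R s).arr 10) := by
    refine Program.loop_induct R (x := 21) (e := nv 1) (s := s) n hn (fun q s' =>
      IsConj A (s'.arr 10) ∧ IsJordan n j (s.nat 27) (s'.arr 10) ∧
      IsReduced j (s.nat 27) (n - q) (s'.arr 10)) ⟨hA, hJ, fun p hp h => by omega⟩ ?_
    rintro q s' hq hn' - ⟨i1, i2, i3⟩
    have e1 : s'.nat 1 0 = n := by rw [hn' 1 rfl, hn]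
    have e2 : s'.nat 2 0 = 2 * n := by rw [hn' 2 rfl, h2n]
    have e3 : s'.nat 16 0 = j := by rw [hn' 16 rfl, hj]
    have e4 : s'.nat 27 = s.nat 27 := hn' 27 rfl
    rw [Program.run]
    set s1 := countDown.run R (s'.setNat 21 0 q) with hs1
    have f1 : s1.nat 26 0 = n - (q + 1) := by
      simp [hs1, countDown, Program.run, NExp.eval, e1]; omega
    have f2 : s1.nat 2 0 = 2 * n := by simp [hs1, countDown, Program.run, e2]
    have f3 : s1.nat 16 0 = j := by simp [hs1, countDown, Program.run, e3]
    have f4 : s1.nat 27 = s.nat 27 := by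
      rw [hs1, Program.run_nat R rfl, Memory.setNat_nat_of_ne _ _ _ (by decide), e4]
    have f5 : s1.arr 10 = s'.arr 10 := rfl
    clear_value s1
    rw [Program.run]
    simp only [NExp.eval, f1, f3]
    split_ifs with hlt
    · have h1 : n - (q + 1) + 1 = n - q := by omega
      have := reduceEntry_run R s1 (n := n) (A := A) (len := len) (tl := tl) f2 f3 f1 hlt hjn
        (by rwa [f5]) (by rwa [f4, f5]) (by rwa [f4]) (by rwa [f4, f5, h1])
      rwa [f4] at this
    · rw [Program.run, f5]
      exact ⟨i1, i2, fun p hp h => by omega⟩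
  rwa [Nat.sub_self] at key

/-- Put `h + 1` into `nat 29 0` and the length of the chain of `h` into `nat 30 0`, for a nonzero
entry in row `h` of column `j` with the longest chain; both are zero if there is no such entry. -/
def selectHead : Program :=
  .seq (.setNat 29 (.const 0) (.const 0)) (.seq (.setNat 30 (.const 0) (.const 0))
    (.loop 21 (nv 1) (.ifLt (nv 21) (nv 16) (.ifZero (.read 10 (nv 21) (nv 16)) .skip
      (.ifLt (nv 30) (.read 28 (nv 21))
        (.seq (.setNat 29 (.const 0) (.add (nv 21) (.const 1)))
          (.setNat 30 (.const 0) (.read 28 (nv 21)))) .skip)) .skip)))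

theorem selectHead_run (R : RootFinder) (s : Memory) {n j : ℕ} (hn : s.nat 1 0 = n)
    (hj : s.nat 16 0 = j) (hjn : j < n) (hlen : ∀ p < j, 0 < s.nat 28 p) :
    ((selectHead.run R s).nat 29 0 = 0 ∧ (selectHead.run R s).nat 30 0 = 0 ∧
      ∀ p < j, s.arr 10 p j = 0) ∨
    ∃ h < j, (selectHead.run R s).nat 29 0 = h + 1 ∧
      (selectHead.run R s).nat 30 0 = s.nat 28 h ∧ s.arr 10 h j ≠ 0 ∧
      ∀ p < j, s.arr 10 p j ≠ 0 → s.nat 28 p ≤ s.nat 28 h := by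
  have key : ((selectHead.run R s).nat 29 0 = 0 ∧ (selectHead.run R s).nat 30 0 = 0 ∧
      ∀ p < n, p < j → s.arr 10 p j = 0) ∨
    ∃ h < j, (selectHead.run R s).nat 29 0 = h + 1 ∧
      (selectHead.run R s).nat 30 0 = s.nat 28 h ∧ s.arr 10 h j ≠ 0 ∧
      ∀ p < n, p < j → s.arr 10 p j ≠ 0 → s.nat 28 p ≤ s.nat 28 h := by
    rw [selectHead, Program.run, Program.run]
    refine Program.loop_induct R n (by simp [Program.run, NExp.eval, hn]) (fun q s' =>
      (s'.nat 29 0 = 0 ∧ s'.nat 30 0 = 0 ∧ ∀ p < q, p < j → s.arr 10 p j = 0) ∨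
      ∃ h < j, s'.nat 29 0 = h + 1 ∧ s'.nat 30 0 = s.nat 28 h ∧ s.arr 10 h j ≠ 0 ∧
        ∀ p < q, p < j → s.arr 10 p j ≠ 0 → s.nat 28 p ≤ s.nat 28 h)
      (by simp [Program.run, NExp.eval]) ?_
    intro q s' hq hn' ha hI
    have e1 : s'.nat 16 0 = j := by rw [hn' 16 rfl]; simp [Program.run, hj]
    have e2 : s'.nat 28 = s.nat 28 := by
      rw [hn' 28 rfl, Program.run_nat R rfl, Memory.setNat_nat_of_ne _ _ _ (by decide)]
    have e3 : s'.arr 10 = s.arr 10 := by rw [ha 10 rfl]; rfl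
    simp only [Program.run, NExp.eval, CExp.eval, Memory.setNat_nat, Memory.setNat_arr, e1, e2, e3]
    simp only [show (16 : ℕ) ≠ 21 by decide, show (28 : ℕ) ≠ 21 by decide,
      show (30 : ℕ) ≠ 21 by decide, false_and, if_false, and_self, if_true]
    have keep : (¬ q < j ∨ s.arr 10 q j = 0 ∨ ¬ s'.nat 30 0 < s.nat 28 q) →
        (s'.nat 29 0 = 0 ∧ s'.nat 30 0 = 0 ∧ ∀ p < q + 1, p < j → s.arr 10 p j = 0) ∨
        ∃ h < j, s'.nat 29 0 = h + 1 ∧ s'.nat 30 0 = s.nat 28 h ∧ s.arr 10 h j ≠ 0 ∧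
          ∀ p < q + 1, p < j → s.arr 10 p j ≠ 0 → s.nat 28 p ≤ s.nat 28 h := by
      intro hk
      rcases hI with ⟨a1, a2, a3⟩ | ⟨h, a1, a2, a3, a4, a5⟩
      · left
        refine ⟨a1, a2, fun p hp hpj => ?_⟩
        rcases Nat.lt_succ_iff_lt_or_eq.1 hp with hp | rfl
        · exact a3 p hp hpj
        · rcases hk with hk | hk | hk
          · exact absurd hpj hk
          · exact hk
          -- Lengths of chains are positive, so the first nonzero entry always beats the initial
          -- value `0`.
          · have := hlen p hpj
            omega
      · right
        refine ⟨h, a1, a2, a3, a4, fun p hp hpj h0 => ?_⟩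
        rcases Nat.lt_succ_iff_lt_or_eq.1 hp with hp | rfl
        · exact a5 p hp hpj h0
        · rcases hk with hk | hk | hk
          · exact absurd hpj hk
          · exact absurd hk h0
          · omega
    by_cases h1 : q < j
    · by_cases h2 : s.arr 10 q j = 0
      · simpa [if_pos h1, if_pos h2] using keep (Or.inr (Or.inl h2))
      · by_cases h3 : s'.nat 30 0 < s.nat 28 q
        · right
          refine ⟨q, h1, ?_, ?_, h2, fun p hp hpj h0 => ?_⟩
          · simp [if_pos h1, if_neg h2, if_pos h3]
          · simp [if_pos h1, if_neg h2, if_pos h3]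
          rcases Nat.lt_succ_iff_lt_or_eq.1 hp with hp | rfl
          · rcases hI with ⟨a1, a2, a3⟩ | ⟨h, a1, a2, a3, a4, a5⟩
            · exact absurd (a3 p hp hpj) h0
            · have := a5 p hp hpj h0
              omega
          · exact le_rfl
        · simpa [if_pos h1, if_neg h2, if_neg h3] using keep (Or.inr (Or.inr h3))
    · simpa [if_neg h1] using keep (Or.inl h1)
  rcases key with ⟨a1, a2, a3⟩ | ⟨h, a1, a2, a3, a4, a5⟩
  · exact Or.inl ⟨a1, a2, fun p hp => a3 p (by omega) hp⟩
  · exact Or.inr ⟨h, a1, a2, a3, a4, fun p hp => a5 p (by omega) hp⟩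

/-- Compute the multiples of the other chains that are to be added to the chain of `h`. -/
def mergeInit : Program :=
  .seq (.loop 21 (nv 1) (.seq (.setNat 31 (nv 21) (.sub (nv 29) (.const 1)))
      (.setArr 23 (.const 0) (nv 21) (.div (.read 10 (nv 21) (nv 16))
        (.read 10 (.sub (nv 29) (.const 1)) (nv 16))))))
    (.setArr 23 (.const 0) (.sub (nv 29) (.const 1)) (.const 0))

theorem mergeInit_run (R : RootFinder) (s : Memory) {n j h : ℕ} (hn : s.nat 1 0 = n)
    (hj : s.nat 16 0 = j) (hh : s.nat 29 0 = h + 1) :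
    ∀ q < n, (mergeInit.run R s).nat 31 q = h ∧
      (mergeInit.run R s).arr 23 0 q = if q = h then 0 else s.arr 10 q j / s.arr 10 h j := by
  rw [mergeInit, Program.run]
  set P : Program := .loop 21 (nv 1) (.seq (.setNat 31 (nv 21) (.sub (nv 29) (.const 1)))
      (.setArr 23 (.const 0) (nv 21) (.div (.read 10 (nv 21) (nv 16))
        (.read 10 (.sub (nv 29) (.const 1)) (nv 16))))) with hP
  have key : ∀ q < n, (P.run R s).nat 31 q = h ∧
      (P.run R s).arr 23 0 q = s.arr 10 q j / s.arr 10 h j := by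
    refine Program.loop_induct R (x := 21) (e := nv 1) n hn (fun k s' => ∀ q < k,
      s'.nat 31 q = h ∧ s'.arr 23 0 q = s.arr 10 q j / s.arr 10 h j) (by simp) ?_
    intro k s' hk hn' ha hI q hq
    have e1 : s'.nat 16 0 = j := by rw [hn' 16 rfl, hj]
    have e2 : s'.nat 29 0 = h + 1 := by rw [hn' 29 rfl, hh]
    have e3 : s'.arr 10 = s.arr 10 := ha 10 rfl
    rcases Nat.lt_succ_iff_lt_or_eq.1 hq with hq | rfl
    · simp [Program.run, NExp.eval, CExp.eval, hq.ne, hI q hq]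
    · simp [Program.run, NExp.eval, CExp.eval, e1, e2, e3]
  have f1 : (P.run R s).nat 29 0 = h + 1 := by rw [Program.run_nat R rfl, hh]
  intro q hq
  refine ⟨(key q hq).1, ?_⟩
  simp only [Program.run, Memory.setArr_arr, NExp.eval, CExp.eval, f1, true_and, (key q hq).2]
  simp

/-- Add the multiple of the basis vector `q`, held in `nat 26 0`. -/
def mergeEntry : Program :=
  .seq (addConjProg (.read 31 (nv 26)) (nv 26) (.read 23 (.const 0) (nv 26)))
    (.ifLt (.const 0) (.read 27 (nv 26))
      (.seq (.setArr 23 (.const 0) (.sub (.read 27 (nv 26)) (.const 1))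
          (.read 23 (.const 0) (nv 26)))
        (.setNat 31 (.sub (.read 27 (nv 26)) (.const 1))
          (.sub (.read 27 (.read 31 (nv 26))) (.const 1)))) .skip)

/-- Add multiples of the other chains to the chain of `h`. -/
def mergeLoop : Program :=
  .loop 21 (nv 1) (.seq countDown (.ifLt (nv 26) (nv 16)
    (.ifZero (.read 23 (.const 0) (nv 26)) .skip mergeEntry) .skip))

theorem mergeEntry_run (R : RootFinder) (s : Memory) {n j h q : ℕ} {A : Matrix (Fin n) (Fin n) ℂ}
    {len tl : ℕ → ℕ} {c : ℂ} {ev : ℕ → ℂ} (h2n : s.nat 2 0 = 2 * n) (hq : s.nat 26 0 = q)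
    (hqj : q < j) (hjn : j < n) (hA : IsConj A (s.arr 10))
    (hM : IsMerging n j h c ev (s.nat 27) len tl (q + 1) (s.arr 23 0) (s.nat 31) (s.arr 10))
    (hF : IsForest j (s.nat 27) len tl)
    (hev : ∀ p < j, ∀ r, s.nat 27 p = r + 1 → ev r = ev p)
    (hh : h < j) (hhead : ∀ p < j, s.nat 27 p ≠ h + 1) (h0 : s.arr 23 0 q ≠ 0) :
    IsConj A ((mergeEntry.run R s).arr 10) ∧
      IsMerging n j h c ev (s.nat 27) len tl q ((mergeEntry.run R s).arr 23 0)
        ((mergeEntry.run R s).nat 31) ((mergeEntry.run R s).arr 10) := by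
  have hp := hM.par_lt q (by omega) h0
  have hpq : s.nat 31 q ≠ q := by
    intro he
    have := hM.tl_par q (by omega) h0
    rw [he] at this
    exact hM.tl_ne q (by omega) h0 this
  have hstep := hM.step hF hev hjn hh hhead hqj h0
  have e10 : (mergeEntry.run R s).arr 10 =
      addConj (2 * n) (s.nat 31 q) q (s.arr 23 0 q) (s.arr 10) := by
    rw [mergeEntry, Program.run, Program.run_arr R rfl]
    exact addConjProg_run R s h2n (by simp [NExp.eval, hq]) (by simp [NExp.eval, hq])
      (by simp [NExp.eval, CExp.eval, hq]) hpq
  set s1 := (addConjProg (.read 31 (nv 26)) (nv 26) (.read 23 (.const 0) (nv 26))).run R s with hs1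
  have f1 : s1.nat 26 0 = q := by rw [hs1, Program.run_nat R rfl, hq]
  have f2 : s1.nat 27 = s.nat 27 := by rw [hs1, Program.run_nat R rfl]
  have f3 : s1.nat 31 = s.nat 31 := by rw [hs1, Program.run_nat R rfl]
  have f4 : s1.arr 23 = s.arr 23 := by rw [hs1, Program.run_arr R rfl]
  have hrun : mergeEntry.run R s = (Program.ifLt (.const 0) (.read 27 (nv 26))
      (.seq (.setArr 23 (.const 0) (.sub (.read 27 (nv 26)) (.const 1))
          (.read 23 (.const 0) (nv 26)))
        (.setNat 31 (.sub (.read 27 (nv 26)) (.const 1))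
          (.sub (.read 27 (.read 31 (nv 26))) (.const 1)))) .skip).run R s1 := rfl
  clear_value s1
  have e23 : (mergeEntry.run R s).arr 23 0 =
      fun i => if s.nat 27 q = i + 1 then s.arr 23 0 q else s.arr 23 0 i := by
    rw [hrun, Program.run]
    funext i
    simp only [NExp.eval, f1, f2]
    by_cases h1 : 0 < s.nat 27 q
    · rw [if_pos h1]
      simp only [Program.run, Memory.setNat_arr, Memory.setArr_arr, NExp.eval, CExp.eval, f1, f2,
        f4, true_and, show i = s.nat 27 q - 1 ↔ s.nat 27 q = i + 1 by omega]
    · rw [if_neg h1, Program.run, f4, if_neg (by omega)]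
  have e31 : (mergeEntry.run R s).nat 31 =
      fun i => if s.nat 27 q = i + 1 then s.nat 27 (s.nat 31 q) - 1 else s.nat 31 i := by
    rw [hrun, Program.run]
    funext i
    simp only [NExp.eval, f1, f2]
    by_cases h1 : 0 < s.nat 27 q
    · rw [if_pos h1]
      simp only [Program.run, Memory.setNat_nat, Memory.setArr_nat, NExp.eval, f1, f2, f3,
        true_and, show i = s.nat 27 q - 1 ↔ s.nat 27 q = i + 1 by omega]
    · rw [if_neg h1, Program.run, f3, if_neg (by omega)]
  rw [e10, e23, e31]
  exact ⟨hA.addConj (by omega) (by omega) hpq _, hstep⟩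

/-- The counter descends from `n - 1`, and the passes before index `j` is crossed do nothing; hence
the threshold `min j (n - q)` in the invariant. -/
theorem mergeLoop_run (R : RootFinder) (s : Memory) {n j h : ℕ} {A : Matrix (Fin n) (Fin n) ℂ}
    {len tl : ℕ → ℕ} {c : ℂ} {ev : ℕ → ℂ} (hn : s.nat 1 0 = n) (h2n : s.nat 2 0 = 2 * n)
    (hj : s.nat 16 0 = j) (hjn : j < n) (hA : IsConj A (s.arr 10))
    (hM : IsMerging n j h c ev (s.nat 27) len tl j (s.arr 23 0) (s.nat 31) (s.arr 10))
    (hF : IsForest j (s.nat 27) len tl)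
    (hev : ∀ p < j, ∀ r, s.nat 27 p = r + 1 → ev r = ev p)
    (hh : h < j) (hhead : ∀ p < j, s.nat 27 p ≠ h + 1) :
    IsConj A ((mergeLoop.run R s).arr 10) ∧
      IsMerging n j h c ev (s.nat 27) len tl 0 ((mergeLoop.run R s).arr 23 0)
        ((mergeLoop.run R s).nat 31) ((mergeLoop.run R s).arr 10) := by
  have key : IsConj A ((mergeLoop.run R s).arr 10) ∧
      IsMerging n j h c ev (s.nat 27) len tl (min j (n - n)) ((mergeLoop.run R s).arr 23 0)
        ((mergeLoop.run R s).nat 31) ((mergeLoop.run R s).arr 10) := by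
    refine Program.loop_induct R (x := 21) (e := nv 1) (s := s) n hn (fun q s' =>
      IsConj A (s'.arr 10) ∧ IsMerging n j h c ev (s.nat 27) len tl (min j (n - q)) (s'.arr 23 0)
        (s'.nat 31) (s'.arr 10)) ⟨hA, ?_⟩ ?_
    · rwa [show min j (n - 0) = j by omega]
    rintro q s' hq hn' - ⟨i1, i2⟩
    have e1 : s'.nat 1 0 = n := by rw [hn' 1 rfl, hn]
    have e2 : s'.nat 2 0 = 2 * n := by rw [hn' 2 rfl, h2n]
    have e3 : s'.nat 16 0 = j := by rw [hn' 16 rfl, hj]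
    have e4 : s'.nat 27 = s.nat 27 := hn' 27 rfl
    rw [Program.run]
    set s1 := countDown.run R (s'.setNat 21 0 q) with hs1
    have f1 : s1.nat 26 0 = n - (q + 1) := by
      simp [hs1, countDown, Program.run, NExp.eval, e1]; omega
    have f2 : s1.nat 2 0 = 2 * n := by simp [hs1, countDown, Program.run, e2]
    have f3 : s1.nat 16 0 = j := by simp [hs1, countDown, Program.run, e3]
    have f4 : s1.nat 27 = s.nat 27 := by
      rw [hs1, Program.run_nat R rfl, Memory.setNat_nat_of_ne _ _ _ (by decide), e4]
    have f5 : s1.arr = s'.arr := rfl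
    have f6 : s1.nat 31 = s'.nat 31 := by
      rw [hs1, Program.run_nat R rfl, Memory.setNat_nat_of_ne _ _ _ (by decide)]
    clear_value s1
    rw [Program.run]
    simp only [NExp.eval, f1, f3]
    split_ifs with hlt
    · have h1 : min j (n - q) = n - (q + 1) + 1 := by omega
      have h2 : min j (n - (q + 1)) = n - (q + 1) := by omega
      rw [h2]
      rw [h1] at i2
      rw [Program.run]
      simp only [CExp.eval, NExp.eval, f1, f5]
      split_ifs with h0
      · rw [Program.run, f5, f6]
        exact ⟨i1, i2.skip h0⟩
      · have := mergeEntry_run R s1 (n := n) (A := A) (len := len) (tl := tl) (c := c) (ev := ev)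
          (h := h) f2 f1 hlt hjn (by rwa [f5]) (by rwa [f4, f5, f6]) (by rwa [f4]) (by rwa [f4]) hh
          (by rwa [f4]) (by rwa [f5])
        rwa [f4] at this
    · have h1 : min j (n - (q + 1)) = min j (n - q) := by omega
      rw [Program.run, f5, f6, h1]
      exact ⟨i1, i2⟩
  rwa [show min j (n - n) = 0 by omega] at key

/-- Insert the basis vector `j` into the Jordan chains. -/
def jordanStep : Program :=
  .seq reduceColumn (.seq selectHead
    (.seq (.ifLt (.const 0) (nv 29) (.seq mergeInit (.seq mergeLoop
      (scaleConjProg (nv 16) (.div (.const 1) (.read 10 (.sub (nv 29) (.const 1)) (nv 16)))))) .skip)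
    (.seq (.setNat 27 (nv 16) (nv 29)) (.setNat 28 (nv 16) (.add (nv 30) (.const 1))))))

/-- Transform an upper triangular matrix into Jordan form. -/
def jordanProg : Program := .loop 16 (nv 1) jordanStep

/-- The first `j` columns are in Jordan form, with the chains described by `nat 27` and `nat 28`. -/
def HasChains {n : ℕ} (A : Matrix (Fin n) (Fin n) ℂ) (j : ℕ) (s : Memory) : Prop :=
  IsConj A (s.arr 10) ∧ IsJordan n j (s.nat 27) (s.arr 10) ∧
    ∃ tl, IsForest j (s.nat 27) (s.nat 28) tl ∧ ∀ p < j, tl p < j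

/-- If the reduced column is zero above the diagonal, `b_j` is an eigenvector and starts a new
chain; otherwise it becomes the new head of the longest chain that occurs in the column. -/
theorem jordanStep_run (R : RootFinder) (s : Memory) {n j : ℕ} {A : Matrix (Fin n) (Fin n) ℂ}
    (hn : s.nat 1 0 = n) (h2n : s.nat 2 0 = 2 * n) (hj : s.nat 16 0 = j) (hjn : j < n)
    (h : HasChains A j s) : HasChains A (j + 1) (jordanStep.run R s) := by
  obtain ⟨hA, hJ, tl, hF, htl⟩ := h
  obtain ⟨hA1, hJ1, hR1⟩ := reduceColumn_run R s hn h2n hj hjn hA hJ hF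
  rw [jordanStep, Program.run]
  set s1 := reduceColumn.run R s with hs1
  have n1 : s1.nat 1 0 = n := by rw [hs1, Program.run_nat R rfl, hn]
  have n2 : s1.nat 2 0 = 2 * n := by rw [hs1, Program.run_nat R rfl, h2n]
  have n16 : s1.nat 16 0 = j := by rw [hs1, Program.run_nat R rfl, hj]
  have n27 : s1.nat 27 = s.nat 27 := by rw [hs1, Program.run_nat R rfl]
  have n28 : s1.nat 28 = s.nat 28 := by rw [hs1, Program.run_nat R rfl]
  rw [← n27] at hF hJ1 hR1
  rw [← n28] at hF
  clear_value s1
  clear hs1 hA hJ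
  have hsel := selectHead_run R s1 n1 n16 hjn hF.len_pos
  rw [Program.run]
  set s2 := selectHead.run R s1 with hs2
  have m1 : s2.nat 1 0 = n := by rw [hs2, Program.run_nat R rfl, n1]
  have m2 : s2.nat 2 0 = 2 * n := by rw [hs2, Program.run_nat R rfl, n2]
  have m16 : s2.nat 16 0 = j := by rw [hs2, Program.run_nat R rfl, n16]
  have m27 : s2.nat 27 = s1.nat 27 := by rw [hs2, Program.run_nat R rfl]
  have m28 : s2.nat 28 = s1.nat 28 := by rw [hs2, Program.run_nat R rfl]
  have m10 : s2.arr 10 = s1.arr 10 := by rw [hs2, Program.run_arr R rfl]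
  rw [← m27] at hF hJ1 hR1
  rw [← m28] at hF hsel
  rw [← m10] at hJ1 hR1 hA1 hsel
  clear_value s2
  clear hs2 n1 n2 n16 n27 n28 m27 m28 m10
  rw [Program.run]
  set P : Program := .ifLt (.const 0) (nv 29) (.seq mergeInit (.seq mergeLoop
      (scaleConjProg (nv 16) (.div (.const 1) (.read 10 (.sub (nv 29) (.const 1)) (nv 16)))))) .skip
    with hP
  have p16 : (P.run R s2).nat 16 0 = j := by rw [hP, Program.run_nat R rfl, m16]
  have p27 : (P.run R s2).nat 27 = s2.nat 27 := by rw [hP, Program.run_nat R rfl]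
  have p28 : (P.run R s2).nat 28 = s2.nat 28 := by rw [hP, Program.run_nat R rfl]
  have p29 : (P.run R s2).nat 29 = s2.nat 29 := by rw [hP, Program.run_nat R rfl]
  have p30 : (P.run R s2).nat 30 = s2.nat 30 := by rw [hP, Program.run_nat R rfl]
  have hrun : P.run R s2 = if 0 < s2.nat 29 0 then (Program.seq mergeInit (.seq mergeLoop
      (scaleConjProg (nv 16) (.div (.const 1) (.read 10 (.sub (nv 29) (.const 1)) (nv 16)))))).run
        R s2 else s2 := rfl
  set s3 := P.run R s2 with hs3
  clear_value s3 P
  set s4 := (Program.seq (.setNat 27 (nv 16) (nv 29))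
    (.setNat 28 (nv 16) (.add (nv 30) (.const 1)))).run R s3 with hs4
  have r27 : s4.nat 27 = fun p => if p = j then s2.nat 29 0 else s2.nat 27 p := by
    funext p
    simp [hs4, Program.run, NExp.eval, p16, p27, p29]
  have r28 : s4.nat 28 = fun p => if p = j then s2.nat 30 0 + 1 else s2.nat 28 p := by
    funext p
    simp [hs4, Program.run, NExp.eval, p16, p28, p30]
  have r10 : s4.arr 10 = s3.arr 10 := rfl
  clear_value s4
  have x27 : ∀ p < j, s4.nat 27 p = s2.nat 27 p := fun p hp => by rw [r27]; simp [hp.ne]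
  have x28 : ∀ p < j, s4.nat 28 p = s2.nat 28 p := fun p hp => by rw [r28]; simp [hp.ne]
  -- The defaults of the selection fit both cases: `0` codes the absence of a successor, and length
  -- `0 + 1` is that of a new chain.
  have y27 : s4.nat 27 j = s2.nat 29 0 := by rw [r27]; simp
  have y28 : s4.nat 28 j = s2.nat 30 0 + 1 := by rw [r28]; simp
  rw [HasChains, r10]
  rcases hsel with ⟨a1, a2, a3⟩ | ⟨h, a1, a2, a3, a4, a5⟩
  · rw [a1, if_neg (lt_irrefl 0)] at hrun
    obtain ⟨tl', t1, t2⟩ := hF.extend x27 x28 (Or.inl ⟨by rw [y27, a1], by rw [y28, a2], htl⟩)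
    rw [hrun]
    exact ⟨hA1, hJ1.extend_zero x27 (by rw [y27, a1]) a3, tl', t1, t2 htl⟩
  · have hhead := hR1.head hJ1.diag a1 a4
    obtain ⟨tl', t1, t2⟩ := hF.extend x27 x28
      (Or.inr ⟨h, a1, by rw [y27, a2], by rw [y28, a3], hhead.2⟩)
    rw [a2, if_pos (Nat.succ_pos h), Program.run, Program.run] at hrun
    have k1 := mergeInit_run R s2 m1 m16 a2
    set u1 := mergeInit.run R s2 with hu1
    have v1 : u1.nat 1 0 = n := by rw [hu1, Program.run_nat R rfl, m1]
    have v2 : u1.nat 2 0 = 2 * n := by rw [hu1, Program.run_nat R rfl, m2]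
    have v16 : u1.nat 16 0 = j := by rw [hu1, Program.run_nat R rfl, m16]
    have v27 : u1.nat 27 = s2.nat 27 := by rw [hu1, Program.run_nat R rfl]
    have v29 : u1.nat 29 = s2.nat 29 := by rw [hu1, Program.run_nat R rfl]
    have v10 : u1.arr 10 = s2.arr 10 := by rw [hu1, Program.run_arr R rfl]
    clear_value u1
    have hM := IsMerging.start (kap := u1.arr 23 0) (par := u1.nat 31) hJ1 hF hR1 a1 a4 a5
      (fun q hq => (k1 q (by omega)).1) (fun q hq => (k1 q (by omega)).2)
    have hM' := mergeLoop_run R u1 (A := A) (len := s2.nat 28) (tl := tl) v1 v2 v16 hjn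
      (by rwa [v10]) (by rw [v27, v10]; exact hM) (by rwa [v27]) (by rw [v27]; exact hJ1.diag) a1
      (by rw [v27]; exact hhead.2)
    rw [v27] at hM'
    set u2 := mergeLoop.run R u1 with hu2
    have w2 : u2.nat 2 0 = 2 * n := by rw [hu2, Program.run_nat R rfl, v2]
    have w16 : u2.nat 16 0 = j := by rw [hu2, Program.run_nat R rfl, v16]
    have w29 : u2.nat 29 0 = h + 1 := by rw [hu2, Program.run_nat R rfl, v29, a2]
    -- The scaling factor is read after the merge, which has not changed this entry.
    have wh : u2.arr 10 h j = s2.arr 10 h j := by rw [hM'.2.last h a1, if_pos rfl]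
    have e := scaleConjProg_run R u2 (p := nv 16)
      (κ := .div (.const 1) (.read 10 (.sub (nv 29) (.const 1)) (nv 16))) (c := 1 / s2.arr 10 h j)
      w2 w16 (by simp [CExp.eval, NExp.eval, w29, w16, wh])
    rw [hrun, e]
    exact ⟨hM'.1.scaleConj hjn (one_div_ne_zero a4),
      hM'.2.finish hF hJ1.diag hjn a1 a4 hhead.1 x27 (by rw [y27, a2]), tl', t1, t2 htl⟩

theorem jordanProg_run (R : RootFinder) (s : Memory) {n : ℕ} {A : Matrix (Fin n) (Fin n) ℂ}
    (hn : s.nat 1 0 = n) (h2n : s.nat 2 0 = 2 * n) (hA : IsConj A (s.arr 10))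
    (h : ∀ i < n, ∀ j < i, s.arr 10 i j = 0) : HasChains A n (jordanProg.run R s) := by
  refine Program.loop_induct R (x := 16) (e := nv 1) n hn (fun j s' => HasChains A j s')
    ⟨hA, ⟨h, by simp, by simp⟩, id, ⟨by simp, by simp, by simp, by simp, by simp, by simp⟩,
      by simp⟩ ?_
  intro j s' hj hn' _ hI
  refine jordanStep_run R (s'.setNat 16 0 j) (by simp [hn' 1 rfl, hn]) (by simp [hn' 2 rfl, h2n])
    (by simp) hj ?_
  rw [HasChains, Memory.setNat_nat_of_ne _ _ _ (show 27 ≠ 16 by decide),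
    Memory.setNat_nat_of_ne _ _ _ (show 28 ≠ 16 by decide)]
  exact hI

end ComplexRAM

namespace ComplexRAM

/-! ### The exponential of a matrix in Jordan form -/

/-- The basis vector number `x`, if `p = x + 1`, and zero, if `p = 0`. -/
def chainVec (n p : ℕ) : Fin n → ℂ := fun i => if p = (i : ℕ) + 1 then 1 else 0

/-- The `m`-th element of the chain that starts with the basis vector number `i`, shifted by one,
and zero after the end of the chain. -/
def chainPos (nx : ℕ → ℕ) (i : ℕ) : ℕ → ℕ
  | 0 => i + 1
  | m + 1 => if chainPos nx i m = 0 then 0 else nx (chainPos nx i m - 1)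

/-- Indices decrease strictly along a chain, which bounds the number of steps and makes `n` terms of
the exponential series enough. -/
theorem chainPos_le {n : ℕ} {nx len tl : ℕ → ℕ} (hF : IsForest n nx len tl) {i : ℕ} (hi : i < n)
    (m : ℕ) : chainPos nx i m = 0 ∨ chainPos nx i m + m ≤ i + 1 := by
  induction m with
  | zero => exact Or.inr le_rfl
  | succ m ih =>
    rw [chainPos]
    split_ifs with h
    · exact Or.inl rfl
    · have h1 := ih.resolve_left h
      have h2 := hF.nx_le (chainPos nx i m - 1) (by omega)
      exact Or.inr (by omega)

theorem IsJordan.chainPos_diag {n : ℕ} {nx len tl : ℕ → ℕ} {G : ℕ → ℕ → ℂ}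
    (hJ : IsJordan n n nx G) (hF : IsForest n nx len tl) {i : ℕ} (hi : i < n) (m : ℕ) {x : ℕ}
    (hx : chainPos nx i m = x + 1) : G x x = G i i := by
  induction m generalizing x with
  | zero =>
    rw [chainPos] at hx
    obtain rfl : i = x := by omega
    rfl
  | succ m ih =>
    rw [chainPos] at hx
    split_ifs at hx with h
    obtain ⟨y, hy⟩ := Nat.exists_eq_succ_of_ne_zero h
    have h1 := (chainPos_le hF hi m).resolve_left h
    rw [hy] at hx h1
    simp only [Nat.succ_eq_add_one, Nat.add_sub_cancel] at hx h1
    rw [hJ.diag y (by omega) x hx, ih hy]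

theorem IsJordan.sub_mulVec {n : ℕ} {nx len tl : ℕ → ℕ} {G : ℕ → ℕ → ℂ} (hJ : IsJordan n n nx G)
    (hF : IsForest n nx len tl) {x : ℕ} (hx : x < n) :
    (toMatrix n G - G x x • 1) *ᵥ chainVec n (x + 1) = chainVec n (nx x) := by
  have h1 : chainVec n (x + 1) = Pi.single ⟨x, hx⟩ 1 := by
    funext i
    simp only [chainVec, Pi.single_apply, Fin.ext_iff, add_left_inj, eq_comm]
  have h2 := hF.nx_le x hx
  funext i
  rw [h1, Matrix.mulVec_single_one]
  simp only [Matrix.col_apply, Matrix.sub_apply, toMatrix, Matrix.of_apply, Matrix.smul_apply,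
    Matrix.one_apply, chainVec, Fin.ext_iff, smul_eq_mul]
  rw [hJ.apply hF hx i.2]
  by_cases hix : (i : ℕ) = x
  · rw [if_pos hix, if_pos hix, if_neg (by omega)]; simp
  · rw [if_neg hix, if_neg hix]; simp

/-- The eigenvalue is constant along the chain by `IsJordan.chainPos_diag`, so one and the same
shift moves every vector to its successor. -/
theorem IsJordan.pow_mulVec {n : ℕ} {nx len tl : ℕ → ℕ} {G : ℕ → ℕ → ℂ} (hJ : IsJordan n n nx G)
    (hF : IsForest n nx len tl) {i : ℕ} (hi : i < n) (m : ℕ) :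
    (toMatrix n G - G i i • 1) ^ m *ᵥ chainVec n (i + 1) = chainVec n (chainPos nx i m) := by
  induction m with
  | zero => simp [chainPos]
  | succ m ih =>
    rw [pow_succ', ← Matrix.mulVec_mulVec, ih, chainPos]
    split_ifs with h
    · have : chainVec n 0 = 0 := by funext i; simp [chainVec]
      rw [h, this, Matrix.mulVec_zero]
    · obtain ⟨y, hy⟩ := Nat.exists_eq_succ_of_ne_zero h
      have h1 := (chainPos_le hF hi m).resolve_left h
      rw [hy, Nat.succ_eq_add_one, ← hJ.chainPos_diag hF hi m hy, hJ.sub_mulVec hF (by omega)]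
      simp

open scoped Matrix.Norms.Operator in
theorem exp_mulVec_of_pow_eq_zero {n k : ℕ} (B : Matrix (Fin n) (Fin n) ℂ) (v : Fin n → ℂ)
    (h : ∀ m, k ≤ m → B ^ m *ᵥ v = 0) :
    NormedSpace.exp B *ᵥ v = ∑ m ∈ Finset.range k, ((m.factorial : ℂ)⁻¹) • (B ^ m *ᵥ v) := by
  have h1 := NormedSpace.exp_series_hasSum_exp' (𝕂 := ℂ) B
  have h2 := h1.map (Matrix.mulVec.addMonoidHomLeft v)
    (Continuous.matrix_mulVec continuous_id continuous_const)
  refine h2.unique ?_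
  have h3 : (∑ m ∈ Finset.range k, ((m.factorial : ℂ)⁻¹) • (B ^ m *ᵥ v)) =
      ∑ m ∈ Finset.range k, (Matrix.mulVec.addMonoidHomLeft v ∘
        fun m => ((m.factorial : ℂ)⁻¹) • B ^ m) m := by
    refine Finset.sum_congr rfl fun m _ => ?_
    simp [Matrix.mulVec.addMonoidHomLeft, Matrix.smul_mulVec]
  rw [h3]
  refine hasSum_sum_of_ne_finset_zero fun m hm => ?_
  simp only [Finset.mem_range, not_lt] at hm
  simp [Matrix.mulVec.addMonoidHomLeft, Matrix.smul_mulVec, h m hm]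

theorem exp_smul_one_add {n : ℕ} (B : Matrix (Fin n) (Fin n) ℂ) (c : ℂ) :
    NormedSpace.exp (c • 1 + B) = Complex.exp c • NormedSpace.exp B := by
  have h1 : Commute (c • (1 : Matrix (Fin n) (Fin n) ℂ)) B := (Commute.one_left B).smul_left c
  rw [Matrix.exp_add_of_commute _ _ h1]
  have h2 : c • (1 : Matrix (Fin n) (Fin n) ℂ) = Matrix.diagonal fun _ => c := by
    rw [Matrix.smul_one_eq_diagonal]
  rw [h2, Matrix.exp_diagonal]
  have h3 : NormedSpace.exp (fun _ : Fin n => c) = fun _ => Complex.exp c := by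
    funext i
    rw [Pi.coe_exp, ← Complex.exp_eq_exp_ℂ]
  rw [h3, ← Matrix.smul_one_eq_diagonal, Matrix.smul_mul, Matrix.one_mul]

/-- Split off the eigenvalue of the `i`-th basis vector. The exponential series of the rest
terminates on this vector, and its `m`-th power is the `m`-th element of the chain. -/
theorem IsJordan.exp_apply {n : ℕ} {nx len tl : ℕ → ℕ} {G : ℕ → ℕ → ℂ} (hJ : IsJordan n n nx G)
    (hF : IsForest n nx len tl) (x i : Fin n) :
    NormedSpace.exp (toMatrix n G) x i = ∑ m ∈ Finset.range n,
      if chainPos nx i m = x + 1 then Complex.exp (G i i) / m.factorial else 0 := by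
  have h1 : toMatrix n G = G i i • 1 + (toMatrix n G - G i i • 1) := by abel
  have h2 : chainVec n (i + 1) = Pi.single i 1 := by
    funext i
    simp only [chainVec, Pi.single_apply, Fin.ext_iff, add_left_inj, eq_comm]
  have h3 := exp_mulVec_of_pow_eq_zero (k := n) (toMatrix n G - G i i • 1) (chainVec n (i + 1)) (by
    intro m hm
    rw [hJ.pow_mulVec hF i.2]
    have : chainPos nx i m = 0 := by
      have := chainPos_le hF i.2 m
      omega
    rw [this]
    funext i; simp [chainVec])
  have h4 : NormedSpace.exp (toMatrix n G) x i =
      (NormedSpace.exp (toMatrix n G) *ᵥ chainVec n (i + 1)) x := by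
    rw [h2, Matrix.mulVec_single_one]; rfl
  rw [h4, h1, exp_smul_one_add, Matrix.smul_mulVec, h3, Pi.smul_apply, Finset.sum_apply,
    Finset.smul_sum]
  refine Finset.sum_congr rfl fun m _ => ?_
  rw [hJ.pow_mulVec hF i.2, Pi.smul_apply, chainVec, smul_eq_mul, smul_eq_mul]
  split_ifs
  · rw [mul_one, div_eq_mul_inv]
  · simp

/-- Run through the chain of the basis vector that is held in `nat 32 0`, shifted by one. -/
def expChain : Program :=
  .loop 21 (nv 1) (.seq (.ifLt (.const 0) (nv 32)
      (.seq (.setArr 31 (.sub (nv 32) (.const 1)) (nv 16)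
        (.add (.read 31 (.sub (nv 32) (.const 1)) (nv 16)) (cv 24)))
        (.setNat 32 (.const 0) (.read 27 (.sub (nv 32) (.const 1))))) .skip)
    (.seq (.setArr 25 (.const 0) (.const 0) (.add (cv 25) (.const 1)))
      (.setArr 24 (.const 0) (.const 0) (.div (cv 24) (cv 25)))))

/-- The exponential of a matrix in Jordan form, in array `31`. -/
def expJordanProg : Program :=
  .loop 16 (nv 1) (.seq (.setNat 32 (.const 0) (.add (nv 16) (.const 1)))
    (.seq (.setArr 24 (.const 0) (.const 0) (.exp (.read 10 (nv 16) (nv 16))))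
      (.seq (.setArr 25 (.const 0) (.const 0) (.const 0)) expChain)))

theorem expJordanProg_run (R : RootFinder) (s : Memory) {n : ℕ} (hn : s.nat 1 0 = n)
    (h0 : s.arr 31 = fun _ _ => 0) : (expJordanProg.run R s).arr 31 = fun x i =>
      if i < n then ∑ m ∈ Finset.range n, if chainPos (s.nat 27) i m = x + 1 then
        Complex.exp (s.arr 10 i i) / m.factorial else 0 else 0 := by
  have key : (expJordanProg.run R s).arr 31 = fun x i =>
      if i < n ∧ i < n then ∑ m ∈ Finset.range n, if chainPos (s.nat 27) i m = x + 1 then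
        Complex.exp (s.arr 10 i i) / m.factorial else 0 else 0 := by
    rw [expJordanProg]
    refine Program.loop_induct R (x := 16) (e := nv 1) n hn (fun k s' => s'.arr 31 = fun x i =>
      if i < n ∧ i < k then ∑ m ∈ Finset.range n, if chainPos (s.nat 27) i m = x + 1 then
        Complex.exp (s.arr 10 i i) / m.factorial else 0 else 0) (by simpa using h0) ?_
    intro k s' hk hn' ha hI
    have e1 : s'.nat 1 0 = n := by rw [hn' 1 rfl, hn]
    have e2 : s'.nat 27 = s.nat 27 := hn' 27 rfl
    have e3 : s'.arr 10 = s.arr 10 := ha 10 rfl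
    set s1 := Program.run R (.setArr 25 (.const 0) (.const 0) (.const 0))
      (Program.run R (.setArr 24 (.const 0) (.const 0) (.exp (.read 10 (nv 16) (nv 16))))
        (Program.run R (.setNat 32 (.const 0) (.add (nv 16) (.const 1))) (s'.setNat 16 0 k)))
      with hs1
    have f1 : s1.nat 1 0 = n := by simp [hs1, Program.run, e1]
    have f2 : s1.nat 27 = s.nat 27 := by
      rw [← e2]; funext i; simp [hs1, Program.run]
    have f16 : s1.nat 16 0 = k := by simp [hs1, Program.run]
    have f32 : s1.nat 32 0 = k + 1 := by simp [hs1, Program.run, NExp.eval]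
    have f24 : s1.arr 24 0 0 = Complex.exp (s.arr 10 k k) := by
      simp [hs1, Program.run, CExp.eval, NExp.eval, e3]
    have f25 : s1.arr 25 0 0 = 0 := by simp [hs1, Program.run, CExp.eval, NExp.eval]
    have f31 : s1.arr 31 = s'.arr 31 := by funext i j; simp [hs1, Program.run]
    change (expChain.run R s1).arr 31 = _
    clear_value s1
    have inner := Program.loop_induct R (x := 21) (e := nv 1) (s := s1)
      (P := .seq (.ifLt (.const 0) (nv 32)
          (.seq (.setArr 31 (.sub (nv 32) (.const 1)) (nv 16)
            (.add (.read 31 (.sub (nv 32) (.const 1)) (nv 16)) (cv 24)))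
            (.setNat 32 (.const 0) (.read 27 (.sub (nv 32) (.const 1))))) .skip)
        (.seq (.setArr 25 (.const 0) (.const 0) (.add (cv 25) (.const 1)))
          (.setArr 24 (.const 0) (.const 0) (.div (cv 24) (cv 25))))) n f1
      -- The coefficient `exp λ / m!` is updated by one division per step, so a whole column costs
      -- `O(n)`.
      (fun m t => t.nat 32 0 = chainPos (s.nat 27) k m ∧ t.arr 25 0 0 = m ∧
        t.arr 24 0 0 = Complex.exp (s.arr 10 k k) / m.factorial ∧
        t.arr 31 = fun x i => if i = k then ∑ m ∈ Finset.range m,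
          if chainPos (s.nat 27) k m = x + 1 then Complex.exp (s.arr 10 k k) / m.factorial else 0
          else s'.arr 31 x i) ?_ ?_
    · refine inner.2.2.2.trans ?_
      rw [hI]
      funext x i
      by_cases hik : i = k
      · subst hik; simp [hk]
      · simp [hik, show i < k + 1 ↔ i < k by omega]
    · refine ⟨f32, by simpa using f25, by simpa using f24, ?_⟩
      rw [f31]
      funext x i
      by_cases hik : i = k
      · simp [hik, hI]
      · simp [hik]
    · rintro m t hm tn ta ⟨i1, i2, i3, i4⟩
      have g16 : t.nat 16 0 = k := by rw [tn 16 rfl, f16]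
      have g27 : t.nat 27 = s.nat 27 := by rw [tn 27 rfl, f2]
      have hfac : (m.factorial : ℂ) ≠ 0 := by exact_mod_cast m.factorial_ne_zero
      have hm1 : (m : ℂ) + 1 ≠ 0 := by exact_mod_cast m.succ_ne_zero
      rw [chainPos]
      by_cases hc : chainPos (s.nat 27) k m = 0
      · refine ⟨?_, ?_, ?_, ?_⟩
        · simp [Program.run, NExp.eval, i1, hc]
        · simp [Program.run, NExp.eval, CExp.eval, i1, hc, i2]
        · simp [Program.run, NExp.eval, CExp.eval, i1, hc, i2, i3, Nat.factorial_succ]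
          field_simp
        · funext x i
          simp [Program.run, NExp.eval, CExp.eval, i1, hc, i4, Finset.sum_range_succ]
      · refine ⟨?_, ?_, ?_, ?_⟩
        · simp [Program.run, NExp.eval, i1, hc, Nat.pos_of_ne_zero hc, g27]
        · simp [Program.run, NExp.eval, CExp.eval, i1, Nat.pos_of_ne_zero hc, i2]
        · simp [Program.run, NExp.eval, CExp.eval, i1, Nat.pos_of_ne_zero hc, i2, i3,
            Nat.factorial_succ]
          field_simp
        · funext x i
          have hx : x = chainPos (s.nat 27) k m - 1 ↔ chainPos (s.nat 27) k m = x + 1 := by omega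
          simp [Program.run, NExp.eval, CExp.eval, i1, Nat.pos_of_ne_zero hc, g16, i3, i4,
            Finset.sum_range_succ, hx]
          by_cases hik : i = k
          · by_cases hxp : chainPos (s.nat 27) k m = x + 1
            · simp [hik, hxp]
            · simp [hik, hxp]
          · simp [hik]
  simpa using key

/-- Undo the change of basis: array `33` becomes `P F Q`, if array `31` holds `F`. -/
def unconjProg : Program :=
  .seq (accumulate 32 1 1 1
      (.mul (.read 31 (nv 17) (nv 19)) (.read 10 (nv 19) (.add (nv 1) (nv 18)))))
    (accumulate 33 1 1 1
      (.mul (.read 10 (.add (nv 1) (nv 17)) (nv 19)) (.read 32 (nv 19) (nv 18))))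

theorem unconjProg_run (R : RootFinder) (s : Memory) {n : ℕ} (hn : s.nat 1 0 = n)
    (h32 : s.arr 32 = fun _ _ => 0) (h33 : s.arr 33 = fun _ _ => 0) (i j : ℕ) (hi : i < n)
    (hj : j < n) : (unconjProg.run R s).arr 33 i j = ∑ y ∈ Finset.range n,
      s.arr 10 (n + i) y * ∑ z ∈ Finset.range n, s.arr 31 y z * s.arr 10 z (n + j) := by
  rw [unconjProg, Program.run]
  have h1 := accumulate_run R s (d := 32) (a := 1) (b := 1) (e := 1)
    (f := .mul (.read 31 (nv 17) (nv 19)) (.read 10 (nv 19) (.add (nv 1) (nv 18))))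
    (by decide) (by decide) hn hn hn (fun x y z => s.arr 31 x z * s.arr 10 z (n + y))
    (fun s' hs ha _ _ _ => by
      simp [CExp.eval, NExp.eval, hs 1 (by decide) (by decide) (by decide), hn,
        ha 31 (by decide), ha 10 (by decide)])
  set s1 := (accumulate 32 1 1 1
      (.mul (.read 31 (nv 17) (nv 19)) (.read 10 (nv 19) (.add (nv 1) (nv 18))))).run R s with hs1
  have f1 : s1.nat 1 0 = n := by rw [hs1, Program.run_nat R rfl, hn]
  have f10 : s1.arr 10 = s.arr 10 := by rw [hs1, Program.run_arr R rfl]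
  have f33 : s1.arr 33 = s.arr 33 := by rw [hs1, Program.run_arr R rfl]
  clear_value s1
  rw [accumulate_run R s1 (d := 33) (a := 1) (b := 1) (e := 1)
    (f := .mul (.read 10 (.add (nv 1) (nv 17)) (nv 19)) (.read 32 (nv 19) (nv 18)))
    (by decide) (by decide) f1 f1 f1 (fun x y z => s.arr 10 (n + x) z * s1.arr 32 z y)
    (fun s' hs ha _ _ _ => by
      simp [CExp.eval, NExp.eval, hs 1 (by decide) (by decide) (by decide), f1,
        ha 32 (by decide), ha 10 (by decide), f10])]
  simp only [hi, hj, and_self, if_true, f33, h33, zero_add]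
  refine Finset.sum_congr rfl fun y hy => ?_
  rw [h1]
  simp [Finset.mem_range.1 hy, hj, h32]

/-- The exponential of the matrix `A`, if array `10` holds `[[A, 1], [1, 0]]`, in array `33`. -/
def expProg : Program :=
  .seq companionProg (.seq rootsProg (.seq shiftProg (.seq reverseProg (.seq jordanProg
    (.seq expJordanProg unconjProg)))))

theorem exp_apply_of_isConj {n : ℕ} {A : Matrix (Fin n) (Fin n) ℂ} {G F : ℕ → ℕ → ℂ}
    (hA : IsConj A G) (hF : ∀ i j : Fin n, F i j = NormedSpace.exp (toMatrix n G) i j)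
    (i j : Fin n) : NormedSpace.exp A i j = ∑ y ∈ Finset.range n,
      G (n + i) y * ∑ z ∈ Finset.range n, F y z * G z (n + j) := by
  obtain ⟨P, Q, hPQ, h⟩ := hA
  have hQP : Q * P = 1 := mul_eq_one_comm.1 hPQ
  have hG : toMatrix n G = Q * A * P := by
    ext x y; exact (h x y).1
  have hinv : P⁻¹ = Q := Matrix.inv_eq_right_inv hPQ
  have hU : IsUnit P := ⟨⟨P, Q, hPQ, hQP⟩, rfl⟩
  have e : NormedSpace.exp A = P * NormedSpace.exp (toMatrix n G) * Q := by
    have : A = P * toMatrix n G * P⁻¹ := by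
      rw [hinv, hG, ← Matrix.mul_assoc, ← Matrix.mul_assoc, hPQ, Matrix.one_mul, Matrix.mul_assoc,
        hPQ, Matrix.mul_one]
    conv_lhs => rw [this]
    rw [Matrix.exp_conj _ _ hU, hinv]
  rw [e, Matrix.mul_assoc, Matrix.mul_apply, Finset.sum_range]
  refine Finset.sum_congr rfl fun y _ => ?_
  rw [Matrix.mul_apply, Finset.sum_range, (h i y).2.2]
  congr 1
  refine Finset.sum_congr rfl fun z _ => ?_
  rw [hF, (h z j).2.1]

/-- Every stage supplies the hypotheses of the next one, and the frame lemmas transport sizes, block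
data and the zeros in the accumulators. Root finding occurs in one stage only. -/
theorem expProg_run (R : RootFinder) (s : Memory) {n : ℕ} {A : Matrix (Fin n) (Fin n) ℂ}
    (hn : s.nat 1 0 = n) (h2n : s.nat 2 0 = 2 * n) (hst : s.nat 24 0 = 0)
    (hA : IsConj A (s.arr 10)) (h31 : s.arr 31 = fun _ _ => 0) (h32 : s.arr 32 = fun _ _ => 0)
    (h33 : s.arr 33 = fun _ _ => 0) :
    (∀ i j : Fin n, (expProg.run R s).arr 33 i j = NormedSpace.exp A i j) ∧
      expProg.rootCost R s ≤ n ^ 3 := by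
  obtain ⟨a1, a2⟩ := companionProg_run R s hn h2n hst hA
  set s1 := companionProg.run R s with hs1
  have n1 : s1.nat 1 0 = n := by rw [hs1, Program.run_nat R rfl, hn]
  have d1 : s1.nat 2 0 = 2 * n := by rw [hs1, Program.run_nat R rfl, h2n]
  have x1 : s1.arr 31 = s.arr 31 := by rw [hs1, Program.run_arr R rfl]
  have y1 : s1.arr 32 = s.arr 32 := by rw [hs1, Program.run_arr R rfl]
  have z1 : s1.arr 33 = s.arr 33 := by rw [hs1, Program.run_arr R rfl]
  have b1 := rootsProg_run R s1 n1 a2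
  have b2 := rootsProg_rootCost R s1 n1 a2
  set s2 := rootsProg.run R s1 with hs2
  have n2 : s2.nat 1 0 = n := by rw [hs2, Program.run_nat R rfl, n1]
  have d2 : s2.nat 2 0 = 2 * n := by rw [hs2, Program.run_nat R rfl, d1]
  have c2 : s2.nat 23 = s1.nat 23 := by rw [hs2, Program.run_nat R rfl]
  have c3 : s2.nat 24 = s1.nat 24 := by rw [hs2, Program.run_nat R rfl]
  have c4 : s2.arr 10 = s1.arr 10 := by rw [hs2, Program.run_arr R rfl]
  have x2 : s2.arr 31 = s.arr 31 := by rw [hs2, Program.run_arr R rfl, x1]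
  have y2 : s2.arr 32 = s.arr 32 := by rw [hs2, Program.run_arr R rfl, y1]
  have z2 : s2.arr 33 = s.arr 33 := by rw [hs2, Program.run_arr R rfl, z1]
  rw [← c2, ← c3, ← c4] at a2 b1
  obtain ⟨e1, e2, e3⟩ := shiftProg_run R s2 n2 d2 (by rw [c4]; exact a1) rfl a2 b1
  set s3 := shiftProg.run R s2 with hs3
  have n3 : s3.nat 1 0 = n := by rw [hs3, Program.run_nat R rfl, n2]
  have d3 : s3.nat 2 0 = 2 * n := by rw [hs3, Program.run_nat R rfl, d2]
  have c5 : s3.nat 23 = s2.nat 23 := by rw [hs3, Program.run_nat R rfl]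
  have c6 : s3.nat 24 = s2.nat 24 := by rw [hs3, Program.run_nat R rfl]
  have x3 : s3.arr 31 = s.arr 31 := by rw [hs3, Program.run_arr R rfl, x2]
  have y3 : s3.arr 32 = s.arr 32 := by rw [hs3, Program.run_arr R rfl, y2]
  have z3 : s3.arr 33 = s.arr 33 := by rw [hs3, Program.run_arr R rfl, z2]
  rw [← c5, ← c6] at a2
  rw [← c5] at e2 e3
  rw [← c6] at e3
  obtain ⟨g1, g2⟩ := reverseProg_run R s3 n3 d3 e1 a2 e2 e3
  set s4 := reverseProg.run R s3 with hs4
  have n4 : s4.nat 1 0 = n := by rw [hs4, Program.run_nat R rfl, n3]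
  have d4 : s4.nat 2 0 = 2 * n := by rw [hs4, Program.run_nat R rfl, d3]
  have x4 : s4.arr 31 = s.arr 31 := by rw [hs4, Program.run_arr R rfl, x3]
  have y4 : s4.arr 32 = s.arr 32 := by rw [hs4, Program.run_arr R rfl, y3]
  have z4 : s4.arr 33 = s.arr 33 := by rw [hs4, Program.run_arr R rfl, z3]
  obtain ⟨k1, k2, tl, k3, -⟩ := jordanProg_run R s4 n4 d4 g1 g2
  set s5 := jordanProg.run R s4 with hs5
  have n5 : s5.nat 1 0 = n := by rw [hs5, Program.run_nat R rfl, n4]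
  have x5 : s5.arr 31 = s.arr 31 := by rw [hs5, Program.run_arr R rfl, x4]
  have y5 : s5.arr 32 = s.arr 32 := by rw [hs5, Program.run_arr R rfl, y4]
  have z5 : s5.arr 33 = s.arr 33 := by rw [hs5, Program.run_arr R rfl, z4]
  have l1 := expJordanProg_run R s5 n5 (x5.trans h31)
  set s6 := expJordanProg.run R s5 with hs6
  have n6 : s6.nat 1 0 = n := by rw [hs6, Program.run_nat R rfl, n5]
  have c7 : s6.arr 10 = s5.arr 10 := by rw [hs6, Program.run_arr R rfl]
  have y6 : s6.arr 32 = s.arr 32 := by rw [hs6, Program.run_arr R rfl, y5]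
  have z6 : s6.arr 33 = s.arr 33 := by rw [hs6, Program.run_arr R rfl, z5]
  have hrun : expProg.run R s = unconjProg.run R s6 := rfl
  have hcost : expProg.rootCost R s = rootsProg.rootCost R s1 := by
    have : expProg.rootCost R s = companionProg.rootCost R s + (rootsProg.rootCost R s1 +
      (shiftProg.rootCost R s2 + (reverseProg.rootCost R s3 + (jordanProg.rootCost R s4 +
        (expJordanProg.rootCost R s5 + unconjProg.rootCost R s6))))) := rfl
    rw [this, Program.rootCost_eq_zero R (P := companionProg) rfl,
      Program.rootCost_eq_zero R (P := shiftProg) rfl,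
      Program.rootCost_eq_zero R (P := reverseProg) rfl,
      Program.rootCost_eq_zero R (P := jordanProg) rfl,
      Program.rootCost_eq_zero R (P := expJordanProg) rfl,
      Program.rootCost_eq_zero R (P := unconjProg) rfl]
    omega
  refine ⟨fun i j => ?_, hcost.trans_le b2⟩
  rw [hrun, unconjProg_run R s6 n6 (y6.trans h32) (z6.trans h33) i j i.2 j.2, c7]
  symm
  refine exp_apply_of_isConj k1 (fun x y => ?_) i j
  rw [l1, k2.exp_apply k3 x y]
  exact if_pos y.2

end ComplexRAM

namespace ComplexRAM

/-! ### The program for the covariance matrix -/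

section Drift

variable {ι : Type*} [DecidableEq ι]

/-- The drift matrix of the covariance matrix. -/
def driftMatrix (H M : Matrix ι ι ℂ) : Matrix ι ι ℂ := H - (2 : ℂ) • (M + Mᵀ)

/-- The inhomogeneity in the equation of motion of the covariance matrix. -/
noncomputable def noiseMatrix (M : Matrix ι ι ℂ) : Matrix ι ι ℂ := (4 * Complex.I) • (Mᵀ - M)

/-- The generator of the extended linear system. -/
noncomputable def generator (H M : Matrix ι ι ℂ) : Matrix (ι ⊕ ι) (ι ⊕ ι) ℂ :=
  Matrix.fromBlocks (driftMatrix H M) (noiseMatrix M) 0 (-(driftMatrix H M)ᵀ)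

end Drift

/-- An entry of the drift matrix times `t`. -/
def driftEntry (x y : NExp) : CExp :=
  .mul (cv 0) (.sub (.read 1 x y) (.mul (.const 2) (.add (.read 5 x y) (.read 5 y x))))

/-- Write the matrix `[[A, 1], [1, 0]]` into array `10`, for `A` the generator times `t`. -/
def setupProg : Program :=
  .seq (fill 10 3 3 (.const 0) (.const 0) (driftEntry (nv 17) (nv 18)))
    (.seq (fill 10 3 3 (.const 0) (nv 3) (.mul (cv 0) (.mul (.mul (.const 4) .imag)
        (.sub (.read 5 (nv 18) (nv 17)) (.read 5 (nv 17) (nv 18))))))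
    (.seq (fill 10 3 3 (nv 3) (nv 3) (.sub (.const 0) (driftEntry (nv 18) (nv 17))))
      (.loop 17 (nv 1) (.seq (.setArr 10 (nv 17) (.add (nv 1) (nv 17)) (.const 1))
        (.setArr 10 (.add (nv 1) (nv 17)) (nv 17) (.const 1))))))

/-- The trivial change of basis `P = Q = 1` is the starting point for all similarity
transformations. -/
theorem setupProg_run (R : RootFinder) (s : Memory) {d : ℕ} {t : ℂ} {H M : Matrix (Fin d) (Fin d) ℂ}
    (h3 : s.nat 3 0 = d) (h1 : s.nat 1 0 = d + d) (ht : s.arr 0 0 0 = t)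
    (hH : ∀ i j : Fin d, s.arr 1 i j = H i j) (hM : ∀ i j : Fin d, s.arr 5 i j = M i j)
    (h10 : s.arr 10 = fun _ _ => 0) :
    IsConj ((t • generator H M).reindex finSumFinEquiv finSumFinEquiv)
      ((setupProg.run R s).arr 10) := by
  set a : ℕ → ℕ → ℂ := fun x y => t * (s.arr 1 x y - 2 * (s.arr 5 x y + s.arr 5 y x)) with ha
  set b : ℕ → ℕ → ℂ := fun x y => t * ((4 * Complex.I) * (s.arr 5 y x - s.arr 5 x y)) with hb
  rw [setupProg]
  have e1 := fill_run R s (d := 10) (a := 3) (b := 3) (ro := .const 0) (co := .const 0)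
    (f := driftEntry (nv 17) (nv 18)) (by decide) h3 h3 (fun _ _ => rfl) (fun _ _ => rfl) a
    (fun s' _ hs _ _ => by
      simp [driftEntry, CExp.eval, NExp.eval, hs 0 (by decide), hs 1 (by decide),
        hs 5 (by decide), ht, ha])
  rw [Program.run]
  set s1 := (fill 10 3 3 (.const 0) (.const 0) (driftEntry (nv 17) (nv 18))).run R s with hs1
  have f1 : s1.nat 1 0 = d + d := by rw [hs1, Program.run_nat R rfl, h1]
  have f3 : s1.nat 3 0 = d := by rw [hs1, Program.run_nat R rfl, h3]
  have g0 : s1.arr 0 = s.arr 0 := by rw [hs1, Program.run_arr R rfl]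
  have g1 : s1.arr 1 = s.arr 1 := by rw [hs1, Program.run_arr R rfl]
  have g5 : s1.arr 5 = s.arr 5 := by rw [hs1, Program.run_arr R rfl]
  clear_value s1
  have e2 := fill_run R s1 (d := 10) (a := 3) (b := 3) (ro := .const 0) (co := nv 3)
    (f := .mul (cv 0) (.mul (.mul (.const 4) .imag)
        (.sub (.read 5 (nv 18) (nv 17)) (.read 5 (nv 17) (nv 18))))) (by decide) f3 f3
    (fun _ _ => rfl) (c := d) (fun s' hs => by simp [NExp.eval, hs 3, f3]) b
    (fun s' _ hs _ _ => by
      simp [CExp.eval, NExp.eval, hs 0 (by decide), hs 5 (by decide), g0, g5, ht, hb])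
  rw [Program.run]
  set s2 := (fill 10 3 3 (.const 0) (nv 3) (.mul (cv 0) (.mul (.mul (.const 4) .imag)
        (.sub (.read 5 (nv 18) (nv 17)) (.read 5 (nv 17) (nv 18)))))).run R s1 with hs2
  have f1' : s2.nat 1 0 = d + d := by rw [hs2, Program.run_nat R rfl, f1]
  have f3' : s2.nat 3 0 = d := by rw [hs2, Program.run_nat R rfl, f3]
  have g0' : s2.arr 0 = s.arr 0 := by rw [hs2, Program.run_arr R rfl, g0]
  have g1' : s2.arr 1 = s.arr 1 := by rw [hs2, Program.run_arr R rfl, g1]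
  have g5' : s2.arr 5 = s.arr 5 := by rw [hs2, Program.run_arr R rfl, g5]
  clear_value s2
  have e3 := fill_run R s2 (d := 10) (a := 3) (b := 3) (ro := nv 3) (co := nv 3)
    (f := .sub (.const 0) (driftEntry (nv 18) (nv 17))) (by decide) f3' f3'
    (r := d) (fun s' hs => by simp [NExp.eval, hs 3, f3'])
    (c := d) (fun s' hs => by simp [NExp.eval, hs 3, f3']) (fun x y => -a y x)
    (fun s' _ hs _ _ => by
      simp [driftEntry, CExp.eval, NExp.eval, hs 0 (by decide), hs 1 (by decide),
        hs 5 (by decide), g0', g1', g5', ht, ha])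
  rw [Program.run]
  set s3 := (fill 10 3 3 (nv 3) (nv 3) (.sub (.const 0) (driftEntry (nv 18) (nv 17)))).run R s2
    with hs3
  have f1'' : s3.nat 1 0 = d + d := by rw [hs3, Program.run_nat R rfl, f1']
  clear_value s3
  have e4 := Program.loop_induct R (x := 17) (e := nv 1) (s := s3)
    (P := .seq (.setArr 10 (nv 17) (.add (nv 1) (nv 17)) (.const 1))
        (.setArr 10 (.add (nv 1) (nv 17)) (nv 17) (.const 1))) (d + d) f1''
    (fun k s' => s'.arr 10 = fun i j => if j = d + d + i ∧ i < k then 1 else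
      if i = d + d + j ∧ j < k then 1 else s3.arr 10 i j) (by simp) (by
      intro k s' hk hn' ha' hI
      have e1 : s'.nat 1 0 = d + d := by rw [hn' 1 rfl, f1'']
      funext i j
      simp only [Program.run, CExp.eval, NExp.eval, Memory.setArr_arr, Memory.setNat_arr,
        Memory.setNat_nat, Memory.setArr_nat, e1, hI, true_and, and_self, if_true,
        show (1 : ℕ) ≠ 17 by decide, false_and, if_false, Rat.cast_one]
      by_cases c1 : i = d + d + k ∧ j = k
      · rw [if_pos c1, if_neg (by omega), if_pos (by omega)]
      · rw [if_neg c1]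
        by_cases c2 : i = k ∧ j = d + d + k
        · rw [if_pos c2, if_pos (by omega)]
        · rw [if_neg c2]
          have h1 : (j = d + d + i ∧ i < k + 1) ↔ (j = d + d + i ∧ i < k) := by omega
          have h2 : (i = d + d + j ∧ j < k + 1) ↔ (i = d + d + j ∧ j < k) := by omega
          simp only [h1, h2])
  rw [e4, e3, e2, e1, h10]
  refine ⟨1, 1, Matrix.one_mul _, fun i j => ⟨?_, ?_, ?_⟩⟩
  · rw [Matrix.one_mul, Matrix.mul_one]
    beta_reduce
    have hi := i.2
    have hj := j.2
    generalize hx : (i : ℕ) = x at *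
    generalize hy : (j : ℕ) = y at *
    rw [if_neg (by omega), if_neg (by omega)]
    obtain ⟨i, rfl⟩ := finSumFinEquiv.surjective i
    obtain ⟨j, rfl⟩ := finSumFinEquiv.surjective j
    simp only [Matrix.reindex_apply, Matrix.submatrix_apply, Equiv.symm_apply_apply,
      Matrix.smul_apply, generator, smul_eq_mul]
    rcases i with i | i <;> rcases j with j | j <;>
      have hi' := i.2 <;> have hj' := j.2 <;>
      simp only [finSumFinEquiv_apply_left, finSumFinEquiv_apply_right, Fin.val_castAdd,
        Fin.val_natAdd] at hx hy <;> subst hx hy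
    · rw [if_neg (by omega), if_neg (by omega), if_pos (by omega)]
      simp [ha, hH, hM, driftMatrix, mul_add]
    · rw [if_neg (by omega), if_pos (by omega)]
      simp [hb, hM, noiseMatrix]
    -- The lower left block is never written; it is zero because the array was.
    · rw [if_neg (by omega), if_neg (by omega), if_neg (by omega)]
      simp
    · rw [if_pos (by omega)]
      simp [ha, hH, hM, driftMatrix, mul_add]
      ring
  · beta_reduce
    have hi := i.2
    have hj := j.2
    simp only [Matrix.one_apply, Fin.ext_iff, add_right_inj, hi, and_true]
    by_cases hij : (i : ℕ) = j
    · rw [if_pos hij.symm, if_pos hij]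
    · rw [if_neg (fun h => hij h.symm), if_neg hij, if_neg (by omega), if_neg (by omega),
        if_neg (by omega), if_neg (by omega)]
  · beta_reduce
    have hi := i.2
    have hj := j.2
    simp only [Matrix.one_apply, Fin.ext_iff, add_right_inj, hj, and_true]
    rw [if_neg (by omega)]
    by_cases hij : (i : ℕ) = j
    · rw [if_pos hij, if_pos hij]
    · rw [if_neg hij, if_neg hij, if_neg (by omega), if_neg (by omega), if_neg (by omega)]

/-- The result `(E₁₁ D + E₁₂) E₁₁ᵀ`, where `E` is held in array `33` and `D` in array `3`. -/
def outputProg : Program :=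
  .seq (fill 34 3 3 (.const 0) (.const 0) (.read 33 (nv 17) (.add (nv 3) (nv 18))))
    (.seq (accumulate 34 3 3 3 (.mul (.read 33 (nv 17) (nv 19)) (.read 3 (nv 19) (nv 18))))
      (accumulate 4 3 3 3 (.mul (.read 34 (nv 17) (nv 19)) (.read 33 (nv 18) (nv 19)))))

theorem outputProg_run (R : RootFinder) (s : Memory) {d : ℕ} {D : Matrix (Fin d) (Fin d) ℂ}
    {E : Matrix (Fin d ⊕ Fin d) (Fin d ⊕ Fin d) ℂ} (h3 : s.nat 3 0 = d)
    (hE : ∀ i j : Fin d ⊕ Fin d, s.arr 33 (finSumFinEquiv i) (finSumFinEquiv j) = E i j)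
    (hD : ∀ i j : Fin d, s.arr 3 i j = D i j) (h4 : s.arr 4 = fun _ _ => 0) (i j : Fin d) :
    (outputProg.run R s).arr 4 i j =
      ((E.toBlocks₁₁ * D + E.toBlocks₁₂) * E.toBlocks₁₁ᵀ) i j := by
  have hE1 : ∀ i j : Fin d, s.arr 33 i j = E.toBlocks₁₁ i j := fun i j =>
    hE (Sum.inl i) (Sum.inl j)
  have hE2 : ∀ i j : Fin d, s.arr 33 i (d + j) = E.toBlocks₁₂ i j := fun i j =>
    hE (Sum.inl i) (Sum.inr j)
  rw [outputProg]
  have e1 := fill_run R s (d := 34) (a := 3) (b := 3) (ro := .const 0) (co := .const 0)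
    (f := .read 33 (nv 17) (.add (nv 3) (nv 18))) (by decide) h3 h3 (fun _ _ => rfl)
    (fun _ _ => rfl) (fun x y => s.arr 33 x (d + y))
    (fun s' hn hs _ _ => by
      simp [CExp.eval, NExp.eval, hs 33 (by decide), hn 3 (by decide), h3])
  rw [Program.run]
  set s1 := (fill 34 3 3 (.const 0) (.const 0) (.read 33 (nv 17) (.add (nv 3) (nv 18)))).run R s
    with hs1
  have f3 : s1.nat 3 0 = d := by rw [hs1, Program.run_nat R rfl, h3]
  have g3 : s1.arr 3 = s.arr 3 := by rw [hs1, Program.run_arr R rfl]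
  have g4 : s1.arr 4 = s.arr 4 := by rw [hs1, Program.run_arr R rfl]
  have g33 : s1.arr 33 = s.arr 33 := by rw [hs1, Program.run_arr R rfl]
  clear_value s1
  have e2 := accumulate_run R s1 (d := 34) (a := 3) (b := 3) (e := 3)
    (f := .mul (.read 33 (nv 17) (nv 19)) (.read 3 (nv 19) (nv 18))) (by decide) (by decide)
    f3 f3 f3 (fun x y z => s.arr 33 x z * s.arr 3 z y) (fun s' hn hs _ _ _ => by
      simp [CExp.eval, NExp.eval, hs 33 (by decide), hs 3 (by decide), g33, g3])
  rw [Program.run]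
  set s2 := (accumulate 34 3 3 3 (.mul (.read 33 (nv 17) (nv 19)) (.read 3 (nv 19) (nv 18)))).run
    R s1 with hs2
  have f3' : s2.nat 3 0 = d := by rw [hs2, Program.run_nat R rfl, f3]
  have g4' : s2.arr 4 = s.arr 4 := by rw [hs2, Program.run_arr R rfl, g4]
  have g33' : s2.arr 33 = s.arr 33 := by rw [hs2, Program.run_arr R rfl, g33]
  clear_value s2
  have e4 := accumulate_run R s2 (d := 4) (a := 3) (b := 3) (e := 3)
    (f := .mul (.read 34 (nv 17) (nv 19)) (.read 33 (nv 18) (nv 19))) (by decide) (by decide)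
    f3' f3' f3' (fun x y z => s2.arr 34 x z * s.arr 33 y z) (fun s' hn hs _ _ _ => by
      simp [CExp.eval, NExp.eval, hs 33 (by decide), hs 34 (by decide), g33'])
  rw [e4]
  simp only [i.2, j.2, and_self, if_true, g4', h4, zero_add]
  rw [Matrix.mul_apply, Finset.sum_range]
  refine Finset.sum_congr rfl fun z _ => ?_
  rw [e2]
  simp only [i.2, z.2, and_self, if_true, e1]
  rw [if_pos (by omega), Finset.sum_range, Matrix.add_apply, Matrix.mul_apply,
    Matrix.transpose_apply, hE1 j z, Nat.sub_zero, Nat.sub_zero, hE2, add_comm]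
  simp only [hE1, hD]

/-- Compute the covariance matrix at time `t`, from `H` in array `1`, `M` in array `5` and the
initial covariance matrix in array `3`. -/
def mainProg : Program := .seq setupProg (.seq expProg outputProg)

theorem exp_reindex {ι κ : Type*} [Fintype ι] [DecidableEq ι] [Fintype κ] [DecidableEq κ]
    (e : ι ≃ κ) (A : Matrix ι ι ℂ) :
    NormedSpace.exp (A.reindex e e) = (NormedSpace.exp A).reindex e e := by
  open scoped Matrix.Norms.Operator in
  exact (NormedSpace.map_exp (Matrix.reindexAlgEquiv ℂ ℂ e).toAlgHom.toRingHom
    (continuous_id.matrix_submatrix _ _) A).symm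

theorem mainProg_run (R : RootFinder) (s : Memory) {d : ℕ} {t : ℂ}
    {H M D : Matrix (Fin d) (Fin d) ℂ} (h3 : s.nat 3 0 = d) (h1 : s.nat 1 0 = d + d)
    (h2 : s.nat 2 0 = 2 * (d + d)) (h24 : s.nat 24 0 = 0) (ht : s.arr 0 0 0 = t)
    (hH : ∀ i j : Fin d, s.arr 1 i j = H i j) (hM : ∀ i j : Fin d, s.arr 5 i j = M i j)
    (hD : ∀ i j : Fin d, s.arr 3 i j = D i j) (h4 : s.arr 4 = fun _ _ => 0)
    (h10 : s.arr 10 = fun _ _ => 0) (h31 : s.arr 31 = fun _ _ => 0)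
    (h32 : s.arr 32 = fun _ _ => 0) (h33 : s.arr 33 = fun _ _ => 0) :
    (∀ i j : Fin d, (mainProg.run R s).arr 4 i j =
      (((NormedSpace.exp (t • generator H M)).toBlocks₁₁ * D +
        (NormedSpace.exp (t • generator H M)).toBlocks₁₂) *
          (NormedSpace.exp (t • generator H M)).toBlocks₁₁ᵀ) i j) ∧
      mainProg.rootCost R s ≤ (d + d) ^ 3 := by
  have a1 := setupProg_run R s h3 h1 ht hH hM h10
  set s1 := setupProg.run R s with hs1
  have f1 : s1.nat 1 0 = d + d := by rw [hs1, Program.run_nat R rfl, h1]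
  have f2 : s1.nat 2 0 = 2 * (d + d) := by rw [hs1, Program.run_nat R rfl, h2]
  have f3 : s1.nat 3 0 = d := by rw [hs1, Program.run_nat R rfl, h3]
  have f24 : s1.nat 24 0 = 0 := by rw [hs1, Program.run_nat R rfl, h24]
  have g3 : s1.arr 3 = s.arr 3 := by rw [hs1, Program.run_arr R rfl]
  have g4 : s1.arr 4 = fun _ _ => 0 := by rw [hs1, Program.run_arr R rfl, h4]
  have g31 : s1.arr 31 = fun _ _ => 0 := by rw [hs1, Program.run_arr R rfl, h31]
  have g32 : s1.arr 32 = fun _ _ => 0 := by rw [hs1, Program.run_arr R rfl, h32]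
  have g33 : s1.arr 33 = fun _ _ => 0 := by rw [hs1, Program.run_arr R rfl, h33]
  obtain ⟨b1, b2⟩ := expProg_run R s1 f1 f2 f24 a1 g31 g32 g33
  set s2 := expProg.run R s1 with hs2
  have f3' : s2.nat 3 0 = d := by rw [hs2, Program.run_nat R rfl, f3]
  have g3' : s2.arr 3 = s.arr 3 := by rw [hs2, Program.run_arr R rfl, g3]
  have g4' : s2.arr 4 = fun _ _ => 0 := by rw [hs2, Program.run_arr R rfl, g4]
  have hrun : mainProg.run R s = outputProg.run R s2 := rfl
  have hcost : mainProg.rootCost R s =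
    setupProg.rootCost R s + (expProg.rootCost R s1 + outputProg.rootCost R s2) := rfl
  clear_value s2 s1
  constructor
  · intro i j
    rw [hrun]
    refine outputProg_run R s2 f3' (fun x y => ?_) (by rwa [g3']) g4' i j
    rw [b1, exp_reindex]
    simp
  · rw [hcost, Program.rootCost_eq_zero R (P := setupProg) rfl,
      Program.rootCost_eq_zero R (P := outputProg) rfl]
    omega

end ComplexRAM

namespace Fermion

/-! ### Canonical anticommutation relations -/

/-- The operator that maps `|S⟩` to `f S |S ∆ {j}⟩`. -/
def flipOp {N : ℕ} (j : Fin N) (f : Finset (Fin N) → ℂ) : Op N :=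
  fun T S => if T = symmDiff S {j} then f S else 0

theorem flipOp_mul {N : ℕ} (j k : Fin N) (f g : Finset (Fin N) → ℂ)
    (T S : Finset (Fin N)) : (flipOp j f * flipOp k g) T S =
      if T = symmDiff (symmDiff S {k}) {j} then f (symmDiff S {k}) * g S else 0 := by
  rw [Matrix.mul_apply, Finset.sum_eq_single (symmDiff S {k})]
  · simp [flipOp]
  · intro U _ hU
    simp [flipOp, hU]
  · simp

/-- Both products flip the same two modes, so the operator identity reduces to a scalar identity on
each number state. For `j ≠ k` the double flip is not diagonal, which forces `c = 0`. -/
theorem flipOp_anticomm {N : ℕ} (j k : Fin N) (f g : Finset (Fin N) → ℂ) (c : ℂ)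
    (hc : j ≠ k → c = 0)
    (h : ∀ S, f (symmDiff S {k}) * g S + g (symmDiff S {j}) * f S = c) :
    flipOp j f * flipOp k g + flipOp k g * flipOp j f = c • 1 := by
  ext T S
  have e : symmDiff (symmDiff S {j}) {k} = symmDiff (symmDiff S {k}) {j} := by
    rw [symmDiff_right_comm]
  simp only [Matrix.add_apply, flipOp_mul, e, Matrix.smul_apply, Matrix.one_apply, smul_eq_mul]
  by_cases hT : T = symmDiff (symmDiff S {k}) {j}
  · rw [if_pos hT, if_pos hT, h]
    by_cases hjk : j = k
    · subst hjk
      rw [symmDiff_symmDiff_cancel_right] at hT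
      simp [hT]
    · simp [hc hjk]
  · rw [if_neg hT, if_neg hT]
    by_cases hjk : j = k
    · subst hjk
      rw [symmDiff_symmDiff_cancel_right] at hT
      simp [hT]
    · simp [hc hjk]

/-- The sign `(-1) ^ #{k ∈ S | k < j}`. -/
def stringSign {N : ℕ} (j : Fin N) (S : Finset (Fin N)) : ℂ := (-1) ^ (S.filter (· < j)).card

theorem stringSign_symmDiff {N : ℕ} (j k : Fin N) (S : Finset (Fin N)) :
    stringSign j (symmDiff S {k}) = if k < j then -stringSign j S else stringSign j S := by
  have key : ∀ S : Finset (Fin N), k ∉ S →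
      stringSign j (insert k S) = if k < j then -stringSign j S else stringSign j S := by
    intro S hk
    rw [stringSign, Finset.filter_insert]
    split_ifs with h
    · rw [Finset.card_insert_of_notMem (by simp [hk]), pow_succ, stringSign]; ring
    · rfl
  by_cases hk : k ∈ S
  · have e : symmDiff S {k} = S.erase k := by
      ext x
      simp only [Finset.mem_symmDiff, Finset.mem_singleton, Finset.mem_erase]
      constructor
      · rintro (h | h)
        · exact h.symm
        · exact absurd (h.1 ▸ hk) h.2
      · exact fun h => Or.inl h.symm
    have := key (S.erase k) (by simp)
    rw [Finset.insert_erase hk] at this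
    rw [e, this]
    split_ifs <;> simp
  · have e : symmDiff S {k} = insert k S := by
      ext x
      simp only [Finset.mem_symmDiff, Finset.mem_singleton, Finset.mem_insert]
      constructor
      · rintro (h | h)
        · exact Or.inr h.1
        · exact Or.inl h.1
      · rintro (h | h)
        · exact Or.inr ⟨h, h ▸ hk⟩
        · exact Or.inl ⟨h, fun hx => hk (hx ▸ h)⟩
    rw [e, key S hk]

theorem stringSign_mul_self {N : ℕ} (j : Fin N) (S : Finset (Fin N)) :
    stringSign j S * stringSign j S = 1 := by
  rw [stringSign, ← mul_pow]; simp

/-- The mode of a Majorana operator. -/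
def mode {N : ℕ} (k : Fin (2 * N)) : Fin N := ⟨k.val / 2, by omega⟩

/-- The phase of a Majorana operator. -/
noncomputable def phase {N : ℕ} (k : Fin (2 * N)) (S : Finset (Fin N)) : ℂ :=
  if k.val % 2 = 0 then 1 else if mode k ∈ S then Complex.I else -Complex.I

theorem annihilation_apply {N : ℕ} (j : Fin N) (T S : Finset (Fin N)) :
    annihilation j T S = if T = symmDiff S {j} ∧ j ∈ S then stringSign j S else 0 := by
  rw [annihilation, stringSign]
  refine if_congr ?_ rfl rfl
  rw [and_comm]
  refine and_congr_left fun h => ?_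
  rw [show symmDiff S {j} = S.erase j from ?_]
  ext x
  simp only [Finset.mem_symmDiff, Finset.mem_singleton, Finset.mem_erase]
  constructor
  · rintro (h' | h')
    · exact h'.symm
    · exact absurd (h'.1 ▸ h) h'.2
  · exact fun h' => Or.inl h'.symm

theorem creation_apply {N : ℕ} (j : Fin N) (T S : Finset (Fin N)) :
    creation j T S = if T = symmDiff S {j} ∧ j ∉ S then stringSign j S else 0 := by
  rw [creation, Matrix.conjTranspose_apply, annihilation_apply]
  have h1 : S = symmDiff T {j} ↔ T = symmDiff S {j} := by
    constructor <;> rintro rfl <;> rw [symmDiff_symmDiff_cancel_right]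
  by_cases hT : T = symmDiff S {j}
  · have h2 : j ∈ T ↔ j ∉ S := by simp [hT, Finset.mem_symmDiff]
    have h3 : stringSign j T = stringSign j S := by
      rw [hT, stringSign_symmDiff, if_neg (lt_irrefl j)]
    simp only [and_congr h1 h2, h3]
    split_ifs <;> simp [stringSign]
  · simp [h1, hT]

theorem majorana_eq_flipOp {N : ℕ} (k : Fin (2 * N)) :
    majorana k = flipOp (mode k) fun S => stringSign (mode k) S * phase k S := by
  ext T S
  rw [majorana, flipOp, phase]
  by_cases hk : k.val % 2 = 0
  · simp only [hk, if_true, Matrix.add_apply, annihilation_apply, creation_apply, mode]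
    by_cases hT : T = symmDiff S {⟨k.val / 2, by omega⟩} <;>
      by_cases hS : (⟨k.val / 2, by omega⟩ : Fin N) ∈ S <;> simp [hT, hS]
  · simp only [hk, if_false, Matrix.smul_apply, Matrix.sub_apply, annihilation_apply,
      creation_apply, mode, smul_eq_mul]
    by_cases hT : T = symmDiff S {⟨k.val / 2, by omega⟩} <;>
      by_cases hS : (⟨k.val / 2, by omega⟩ : Fin N) ∈ S <;> simp [hT, hS, mul_comm]

theorem phase_symmDiff_of_ne {N : ℕ} {k : Fin (2 * N)} {j : Fin N} (h : mode k ≠ j)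
    (S : Finset (Fin N)) : phase k (symmDiff S {j}) = phase k S := by
  rw [phase, phase]
  simp [Finset.mem_symmDiff, h]

/-- For different modes exactly one of the two orders picks up a sign from the string. For the same
mode the string signs square to one and only the phases matter. -/
theorem majorana_anticomm {N : ℕ} (j k : Fin (2 * N)) :
    majorana j * majorana k + majorana k * majorana j = (if j = k then 2 else 0 : ℂ) • 1 := by
  rw [majorana_eq_flipOp, majorana_eq_flipOp]
  refine flipOp_anticomm _ _ _ _ _ (fun h => if_neg fun h' => h (by rw [h'])) fun S => ?_
  rcases lt_trichotomy (mode j) (mode k) with h | h | h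
  · rw [if_neg (fun h' => by rw [h'] at h; exact lt_irrefl _ h), stringSign_symmDiff,
      stringSign_symmDiff, if_neg h.not_gt, if_pos h, phase_symmDiff_of_ne h.ne,
      phase_symmDiff_of_ne h.ne']
    ring
  · rw [stringSign_symmDiff, stringSign_symmDiff, ← h, if_neg (lt_irrefl _)]
    have h1 := stringSign_mul_self (mode j) S
    have e : ∀ x y z w : ℂ, stringSign (mode j) S * x * (stringSign (mode j) S * y) +
        stringSign (mode j) S * z * (stringSign (mode j) S * w) = x * y + z * w := by
      intro x y z w
      linear_combination (x * y + z * w) * h1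
    rw [e]
    have h2 : (mode j).val = j.val / 2 := rfl
    have h3 : (mode k).val = k.val / 2 := rfl
    -- The two operators of a mode are told apart by the parity of the index.
    have h4 : j = k ↔ j.val % 2 = k.val % 2 := by
      rw [Fin.ext_iff]
      have := congrArg Fin.val h
      omega
    simp only [phase, h4, ← h, Finset.mem_symmDiff, Finset.mem_singleton]
    have h5 := Nat.mod_two_eq_zero_or_one j.val
    have h6 := Nat.mod_two_eq_zero_or_one k.val
    rcases h5 with h5 | h5 <;> rcases h6 with h6 | h6 <;> by_cases hS : mode j ∈ S <;>
      simp [h5, h6, hS] <;> norm_num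
  · rw [if_neg (fun h' => by rw [h'] at h; exact lt_irrefl _ h), stringSign_symmDiff,
      stringSign_symmDiff, if_neg h.not_gt, if_pos h, phase_symmDiff_of_ne h.ne,
      phase_symmDiff_of_ne h.ne']
    ring

theorem majorana_conjTranspose {N : ℕ} (k : Fin (2 * N)) : (majorana k)ᴴ = majorana k := by
  rw [majorana]
  split_ifs
  · rw [Matrix.conjTranspose_add, creation, Matrix.conjTranspose_conjTranspose, add_comm]
  · rw [Matrix.conjTranspose_smul, Matrix.conjTranspose_sub, creation,
      Matrix.conjTranspose_conjTranspose]
    simp only [Complex.star_def, Complex.conj_I, neg_smul, smul_sub]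
    abel

/-! ### Linear combinations of Majorana operators -/

theorem lindblad_conjTranspose {N : ℕ} (l : Fin (2 * N) → ℂ) :
    (lindblad l)ᴴ = lindblad (star l) := by
  rw [lindblad, lindblad, Matrix.conjTranspose_sum]
  refine Finset.sum_congr rfl fun j _ => ?_
  rw [Matrix.conjTranspose_smul, majorana_conjTranspose]; rfl

theorem comm_majorana {N : ℕ} (j k a : Fin (2 * N)) :
    majorana j * majorana k * majorana a - majorana a * (majorana j * majorana k) =
      (if k = a then 2 else 0 : ℂ) • majorana j - (if j = a then 2 else 0 : ℂ) • majorana k := by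
  have h1 := majorana_anticomm k a
  have h2 := majorana_anticomm j a
  have h3 : majorana j * majorana k * majorana a - majorana a * (majorana j * majorana k) =
      majorana j * (majorana k * majorana a + majorana a * majorana k) -
        (majorana j * majorana a + majorana a * majorana j) * majorana k := by noncomm_ring
  rw [h3, h1, h2, Matrix.mul_smul, Matrix.smul_mul, Matrix.mul_one, Matrix.one_mul]

theorem comm_lindblad {N : ℕ} (j k : Fin (2 * N)) (l : Fin (2 * N) → ℂ) :
    majorana j * majorana k * lindblad l - lindblad l * (majorana j * majorana k) =
      (2 * l k) • majorana j - (2 * l j) • majorana k := by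
  have h1 : majorana j * majorana k * lindblad l - lindblad l * (majorana j * majorana k) =
      ∑ a, l a • ((if k = a then 2 else 0 : ℂ) • majorana j -
        (if j = a then 2 else 0 : ℂ) • majorana k) := by
    rw [lindblad, Finset.mul_sum, Finset.sum_mul, ← Finset.sum_sub_distrib]
    refine Finset.sum_congr rfl fun a _ => ?_
    rw [← comm_majorana, smul_sub, Matrix.mul_smul, Matrix.smul_mul]
  rw [h1]
  simp only [smul_sub, smul_smul, Finset.sum_sub_distrib, ← Finset.sum_smul, mul_ite, mul_zero,
    Finset.sum_ite_eq, Finset.mem_univ, if_true, mul_comm]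

/-- The matrix of second moments `tr (ρ c_j c_k)`. -/
noncomputable def moments {N : ℕ} (ρ : Op N) : Matrix (Fin (2 * N)) (Fin (2 * N)) ℂ :=
  fun j k => (ρ * (majorana j * majorana k)).trace

/-- This is the anticommutation relation under the trace. It lets every transposed moment matrix be
eliminated, and its scalar part is a source of the inhomogeneous term. -/
theorem moments_transpose {N : ℕ} (ρ : Op N) :
    (moments ρ)ᵀ = (2 * ρ.trace) • 1 - moments ρ := by
  ext j k
  rw [Matrix.transpose_apply, Matrix.sub_apply, Matrix.smul_apply, eq_sub_iff_add_eq, moments,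
    moments, ← Matrix.trace_add, ← Matrix.mul_add, majorana_anticomm, Matrix.mul_smul,
    Matrix.trace_smul, Matrix.mul_one, Matrix.one_apply]
  by_cases h : j = k
  · simp [h]
  · simp [h, show k ≠ j from fun h' => h h'.symm]

theorem covariance_eq {N : ℕ} (ρ : Op N) :
    covariance ρ = Complex.I • (moments ρ - ρ.trace • 1) := by
  have h1 : covariance ρ = (Complex.I / 2) • (moments ρ - (moments ρ)ᵀ) := by
    ext j k
    simp only [covariance, moments, Matrix.smul_apply, Matrix.sub_apply, Matrix.transpose_apply,
      smul_eq_mul, Matrix.mul_sub, Matrix.trace_sub]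
  rw [h1, moments_transpose]
  ext j k
  simp only [Matrix.smul_apply, Matrix.sub_apply, smul_eq_mul]
  ring

theorem trace_majorana_lindblad {N : ℕ} (ρ : Op N) (j : Fin (2 * N)) (l : Fin (2 * N) → ℂ) :
    (ρ * (majorana j * lindblad l)).trace = ∑ a, moments ρ j a * l a := by
  rw [lindblad, Finset.mul_sum, Finset.mul_sum, Matrix.trace_sum]
  refine Finset.sum_congr rfl fun a _ => ?_
  rw [Matrix.mul_smul, Matrix.mul_smul, Matrix.trace_smul, smul_eq_mul, mul_comm, moments]

theorem trace_lindblad_majorana {N : ℕ} (ρ : Op N) (j : Fin (2 * N)) (l : Fin (2 * N) → ℂ) :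
    (ρ * (lindblad l * majorana j)).trace = ∑ a, l a * moments ρ a j := by
  rw [lindblad, Finset.sum_mul, Finset.mul_sum, Matrix.trace_sum]
  refine Finset.sum_congr rfl fun a _ => ?_
  rw [Matrix.smul_mul, Matrix.mul_smul, Matrix.trace_smul, smul_eq_mul, moments]

/-! ### The equation of motion of the second moments -/

theorem trace_comm_mul {N : ℕ} (A ρ O : Op N) :
    ((A * ρ - ρ * A) * O).trace = (ρ * (O * A - A * O)).trace := by
  rw [Matrix.sub_mul, Matrix.mul_sub, Matrix.trace_sub, Matrix.trace_sub, Matrix.mul_assoc A,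
    Matrix.trace_mul_comm A, Matrix.mul_assoc, Matrix.mul_assoc]

/-- In this form the observable enters only through commutators with single Lindblad operators. For
a quadratic observable these are linear, so no fourth moments arise. -/
theorem trace_dissipator_mul {N : ℕ} (A B ρ O : Op N) :
    (((2 : ℂ) • (A * (ρ * B)) - (B * A * ρ + ρ * (B * A))) * O).trace =
      (ρ * (B * (O * A - A * O) - (O * B - B * O) * A)).trace := by
  have e1 : (A * (ρ * B) * O).trace = (ρ * (B * O * A)).trace := by
    rw [Matrix.mul_assoc, Matrix.trace_mul_comm A]
    simp only [Matrix.mul_assoc]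
  have e2 : (B * A * ρ * O).trace = (ρ * (O * (B * A))).trace := by
    rw [Matrix.mul_assoc, Matrix.trace_mul_comm (B * A)]
    simp only [Matrix.mul_assoc]
  have e3 : ρ * (B * (O * A - A * O) - (O * B - B * O) * A) =
      (2 : ℂ) • (ρ * (B * O * A)) - (ρ * (B * A) * O + ρ * (O * (B * A))) := by
    rw [two_smul]; noncomm_ring
  rw [e3, Matrix.sub_mul, Matrix.add_mul, Matrix.smul_mul, Matrix.trace_sub, Matrix.trace_sub,
    Matrix.trace_add, Matrix.trace_add, Matrix.trace_smul, Matrix.trace_smul, e1, e2]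
  ring

theorem moments_unitary {N : ℕ} (H : Matrix (Fin (2 * N)) (Fin (2 * N)) ℝ) (hH : Hᵀ = -H)
    (ρ : Op N) (j k : Fin (2 * N)) :
    ((-Complex.I) • (hamiltonian H * ρ - ρ * hamiltonian H) * (majorana j * majorana k)).trace =
      (H.map Complex.ofReal * moments ρ - moments ρ * H.map Complex.ofReal) j k := by
  set O := majorana j * majorana k with hO
  set K := H.map Complex.ofReal with hK
  have hKT : Kᵀ = -K := by
    rw [hK, ← Matrix.transpose_map, hH]; ext; simp
  have h1 : ((-Complex.I) • (hamiltonian H * ρ - ρ * hamiltonian H) * O).trace =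
      (-Complex.I) * (ρ * (O * hamiltonian H - hamiltonian H * O)).trace := by
    rw [Matrix.smul_mul, Matrix.trace_smul, smul_eq_mul, trace_comm_mul]
  have h2 : hamiltonian H = (Complex.I / 4) • ∑ a, majorana a * lindblad (K a) := by
    rw [hamiltonian]
    congr 1
    refine Finset.sum_congr rfl fun a _ => ?_
    rw [lindblad, Finset.mul_sum]
    refine Finset.sum_congr rfl fun b _ => ?_
    rw [Matrix.mul_smul]; rfl
  have h3 : O * hamiltonian H - hamiltonian H * O = (Complex.I / 4) • ∑ a,
      (((if k = a then 2 else 0 : ℂ) • (majorana j * lindblad (K a)) -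
        (if j = a then 2 else 0 : ℂ) • (majorana k * lindblad (K a))) +
        ((2 * K a k) • (majorana a * majorana j) - (2 * K a j) • (majorana a * majorana k))) := by
    rw [h2, Matrix.mul_smul, Matrix.smul_mul, ← smul_sub, Finset.mul_sum, Finset.sum_mul,
      ← Finset.sum_sub_distrib]
    congr 1
    refine Finset.sum_congr rfl fun a _ => ?_
    have e : O * (majorana a * lindblad (K a)) - majorana a * lindblad (K a) * O =
      (O * majorana a - majorana a * O) * lindblad (K a) +
        majorana a * (O * lindblad (K a) - lindblad (K a) * O) := by noncomm_ring
    rw [e, hO, comm_majorana, comm_lindblad]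
    simp only [Matrix.sub_mul, Matrix.mul_sub, Matrix.smul_mul, Matrix.mul_smul]
  have h4 : (ρ * (O * hamiltonian H - hamiltonian H * O)).trace = (Complex.I / 4) *
      (2 * (moments ρ * Kᵀ) j k - 2 * (moments ρ * Kᵀ) k j + 2 * ((moments ρ)ᵀ * K) j k -
        2 * ((moments ρ)ᵀ * K) k j) := by
    rw [h3, Matrix.mul_smul, Matrix.trace_smul, smul_eq_mul, Finset.mul_sum, Matrix.trace_sum]
    congr 1
    simp only [Matrix.mul_add, Matrix.mul_sub, Matrix.mul_smul, Matrix.trace_add, Matrix.trace_sub,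
      Matrix.trace_smul, smul_eq_mul, trace_majorana_lindblad, Finset.sum_add_distrib,
      Finset.sum_sub_distrib, ite_mul, zero_mul, Finset.sum_ite_eq, Finset.mem_univ, if_true]
    simp only [Matrix.mul_apply, Matrix.transpose_apply, Finset.mul_sum]
    rw [add_sub_assoc]
    congr 2
    · refine Finset.sum_congr rfl fun a _ => ?_
      rw [moments]; ring
    · refine Finset.sum_congr rfl fun a _ => ?_
      rw [moments]; ring
  -- Terms with exchanged indices are brought back to the entry `j k` by transposition; the terms
  -- with the trace cancel in the end.
  have h5 : (moments ρ * K) k j = ((-2 * ρ.trace) • K + K * moments ρ) j k := by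
    have e : (moments ρ * K)ᵀ = (-2 * ρ.trace) • K + K * moments ρ := by
      rw [Matrix.transpose_mul, hKT, moments_transpose, Matrix.mul_sub, Matrix.mul_smul,
        Matrix.mul_one, Matrix.neg_mul]
      module
    rw [← e, Matrix.transpose_apply]
  have h6 : K k j = -K j k := by rw [← Matrix.transpose_apply K, hKT]; rfl
  rw [h1, h4, hKT, moments_transpose]
  simp only [Matrix.mul_neg, Matrix.neg_apply, Matrix.sub_mul, Matrix.smul_mul, Matrix.one_mul,
    Matrix.sub_apply, Matrix.smul_apply, smul_eq_mul, h5, h6, Matrix.add_apply]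
  linear_combination (-((K * moments ρ) j k - (moments ρ * K) j k)) * Complex.I_mul_I

theorem moments_dissipator {N m : ℕ} (l : Matrix (Fin m) (Fin (2 * N)) ℂ) (ρ : Op N)
    (j k : Fin (2 * N)) :
    ∑ μ, (((2 : ℂ) • (lindblad (l μ) * (ρ * (lindblad (l μ))ᴴ)) -
      ((lindblad (l μ))ᴴ * lindblad (l μ) * ρ + ρ * ((lindblad (l μ))ᴴ * lindblad (l μ)))) *
        (majorana j * majorana k)).trace =
      (2 : ℂ) * ((lindbladMatrix l * moments ρ) k j - (lindbladMatrix l * moments ρ) j k -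
        (moments ρ * lindbladMatrix l) j k + (moments ρ * lindbladMatrix l) k j) := by
  have h1 : ∀ μ, (((2 : ℂ) • (lindblad (l μ) * (ρ * (lindblad (l μ))ᴴ)) -
      ((lindblad (l μ))ᴴ * lindblad (l μ) * ρ + ρ * ((lindblad (l μ))ᴴ * lindblad (l μ)))) *
        (majorana j * majorana k)).trace =
      2 * (l μ k * ∑ a, star (l μ a) * moments ρ a j - l μ j * ∑ a, star (l μ a) * moments ρ a k -
        star (l μ k) * ∑ a, moments ρ j a * l μ a + star (l μ j) * ∑ a, moments ρ k a * l μ a) := by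
    intro μ
    rw [trace_dissipator_mul, lindblad_conjTranspose, comm_lindblad, comm_lindblad]
    simp only [Matrix.mul_sub, Matrix.sub_mul, Matrix.mul_smul, Matrix.smul_mul, Matrix.trace_sub,
      Matrix.trace_smul, trace_majorana_lindblad, trace_lindblad_majorana, smul_eq_mul,
      Pi.star_apply]
    ring
  have h2 : ∀ x y, (lindbladMatrix l * moments ρ) x y =
      ∑ μ, l μ x * ∑ a, star (l μ a) * moments ρ a y := by
    intro x y
    simp only [Matrix.mul_apply, lindbladMatrix, Finset.sum_mul, Finset.mul_sum]
    rw [Finset.sum_comm]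
    simp only [mul_assoc]
  have h3 : ∀ x y, (moments ρ * lindbladMatrix l) x y =
      ∑ μ, star (l μ y) * ∑ a, moments ρ x a * l μ a := by
    intro x y
    simp only [Matrix.mul_apply, lindbladMatrix, Finset.mul_sum]
    rw [Finset.sum_comm]
    refine Finset.sum_congr rfl fun _ _ => Finset.sum_congr rfl fun _ _ => by ring
  simp only [h1, h2, h3, ← Finset.mul_sum, Finset.sum_add_distrib, Finset.sum_sub_distrib]

theorem liouvillian_apply {N m : ℕ} (H : Matrix (Fin (2 * N)) (Fin (2 * N)) ℝ)
    (l : Matrix (Fin m) (Fin (2 * N)) ℂ) (ρ : Op N) : liouvillian H l ρ =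
      (-Complex.I) • (hamiltonian H * ρ - ρ * hamiltonian H) +
      ∑ μ, ((2 : ℂ) • (lindblad (l μ) * (ρ * (lindblad (l μ))ᴴ)) -
      ((lindblad (l μ))ᴴ * lindblad (l μ) * ρ + ρ * ((lindblad (l μ))ᴴ * lindblad (l μ)))) := by
  simp [liouvillian, LinearMap.sum_apply, Matrix.mul_assoc]

theorem trace_liouvillian {N m : ℕ} (H : Matrix (Fin (2 * N)) (Fin (2 * N)) ℝ)
    (l : Matrix (Fin m) (Fin (2 * N)) ℂ) (ρ : Op N) : (liouvillian H l ρ).trace = 0 := by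
  rw [liouvillian_apply, Matrix.trace_add, Matrix.trace_smul, Matrix.trace_sum]
  have h1 := trace_comm_mul (hamiltonian H) ρ 1
  rw [Matrix.mul_one, Matrix.one_mul, Matrix.mul_one, sub_self, Matrix.mul_zero,
    Matrix.trace_zero] at h1
  rw [h1, smul_zero, zero_add]
  refine Finset.sum_eq_zero fun μ _ => ?_
  have h2 := trace_dissipator_mul (lindblad (l μ)) (lindblad (l μ))ᴴ ρ 1
  simpa using h2

/-- The equation of motion of the covariance matrix. -/
theorem covariance_liouvillian {N m : ℕ} (H : Matrix (Fin (2 * N)) (Fin (2 * N)) ℝ) (hH : Hᵀ = -H)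
    (l : Matrix (Fin m) (Fin (2 * N)) ℂ) (ρ : Op N) : covariance (liouvillian H l ρ) =
      ComplexRAM.driftMatrix (H.map Complex.ofReal) (lindbladMatrix l) * covariance ρ +
        covariance ρ * (ComplexRAM.driftMatrix (H.map Complex.ofReal) (lindbladMatrix l))ᵀ +
        ρ.trace • ComplexRAM.noiseMatrix (lindbladMatrix l) := by
  set K := H.map Complex.ofReal with hK
  set M := lindbladMatrix l with hM
  set T := moments ρ with hT
  have hKT : Kᵀ = -K := by
    rw [hK, ← Matrix.transpose_map, hH]; ext; simp
  have h1 : moments (liouvillian H l ρ) = K * T - T * K +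
      (2 : ℂ) • ((M * T)ᵀ - M * T - T * M + (T * M)ᵀ) := by
    ext j k
    rw [moments, liouvillian_apply, Matrix.add_mul, Matrix.trace_add, moments_unitary H hH,
      Finset.sum_mul, Matrix.trace_sum, moments_dissipator]
    rfl
  have hTT : Tᵀ = (2 * ρ.trace) • 1 - T := moments_transpose ρ
  have hC : covariance ρ = Complex.I • (T - ρ.trace • 1) := covariance_eq ρ
  rw [covariance_eq, trace_liouvillian, zero_smul, sub_zero, h1, hC, Matrix.transpose_mul,
    Matrix.transpose_mul, hTT, ComplexRAM.driftMatrix, ComplexRAM.noiseMatrix,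
    Matrix.transpose_sub, hKT, Matrix.transpose_smul, Matrix.transpose_add,
    Matrix.transpose_transpose]
  -- With transposes of the moments eliminated, both sides are linear combinations of the same
  -- products; the multiples of the trace combine to the noise matrix.
  simp only [Matrix.mul_sub, Matrix.sub_mul, Matrix.mul_smul, Matrix.smul_mul, Matrix.mul_one,
    Matrix.one_mul, Matrix.mul_add, Matrix.add_mul, Matrix.mul_neg, smul_add, smul_sub, smul_smul]
  module

end Fermion

namespace Fermion

/-! ### Solution of the equation of motion -/

section Exponential

variable {V W : Type*} [NormedAddCommGroup V] [NormedSpace ℂ V] [FiniteDimensional ℂ V]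
  [NormedAddCommGroup W] [NormedSpace ℂ W] [FiniteDimensional ℂ W]

theorem hasSum_exp_apply (f : V →ₗ[ℂ] V) (v : V) :
    HasSum (fun n : ℕ => ((n.factorial : ℂ)⁻¹) • (f ^ n) v)
      (NormedSpace.exp (LinearMap.toContinuousLinearMap f) v) := by
  have : CompleteSpace V := FiniteDimensional.complete ℂ V
  have h1 := NormedSpace.exp_series_hasSum_exp' (𝕂 := ℂ) (LinearMap.toContinuousLinearMap f)
  have h2 := (ContinuousLinearMap.apply ℂ V v).hasSum h1
  have h3 : ∀ n : ℕ, (LinearMap.toContinuousLinearMap f ^ n) v = (f ^ n) v := by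
    intro n
    induction n with
    | zero => rfl
    | succ n ih =>
      rw [pow_succ', pow_succ', mul_apply_eq_comp, ih]
      rfl
  simpa [h3] using h2

theorem exp_add_apply {f g : V →ₗ[ℂ] V} (h : Commute f g) (v : V) :
    NormedSpace.exp (LinearMap.toContinuousLinearMap (f + g)) v =
      NormedSpace.exp (LinearMap.toContinuousLinearMap f)
        (NormedSpace.exp (LinearMap.toContinuousLinearMap g) v) := by
  have : CompleteSpace V := FiniteDimensional.complete ℂ V
  have h1 : Commute (LinearMap.toContinuousLinearMap f) (LinearMap.toContinuousLinearMap g) := by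
    ext x
    exact LinearMap.congr_fun h.eq x
  have hb : ∀ x : V →L[ℂ] V, x ∈ Metric.eball (0 : V →L[ℂ] V)
      (NormedSpace.expSeries ℂ (V →L[ℂ] V)).radius := fun x =>
    (NormedSpace.expSeries_radius_eq_top ℂ (V →L[ℂ] V)).symm ▸ edist_lt_top _ _
  rw [map_add, NormedSpace.exp_add_of_commute_of_mem_ball (𝕂 := ℂ) h1 (hb _) (hb _)]
  rfl

/-- The exponential of a sum of commuting maps, stated through orbits of single vectors, so that
only the series and no operator exponential appears in applications. -/
theorem hasSum_exp_add {f g : V →ₗ[ℂ] V} (h : Commute f g) {u v w : V}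
    (hg : HasSum (fun n : ℕ => ((n.factorial : ℂ)⁻¹) • (g ^ n) u) v)
    (hf : HasSum (fun n : ℕ => ((n.factorial : ℂ)⁻¹) • (f ^ n) v) w) :
    HasSum (fun n : ℕ => ((n.factorial : ℂ)⁻¹) • ((f + g) ^ n) u) w := by
  have h1 := hasSum_exp_apply (f + g) u
  rwa [exp_add_apply h, (hasSum_exp_apply g u).unique hg, (hasSum_exp_apply f v).unique hf] at h1

end Exponential

section Matrix

variable {ι κ : Type*} [Fintype ι] [DecidableEq ι] [Fintype κ] [DecidableEq κ]

section Norm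

open scoped Matrix.Norms.Operator

theorem mul_exp_of_intertwine {A : Matrix ι ι ℂ} {B : Matrix κ κ ℂ} {J : Matrix ι κ ℂ}
    (h : A * J = J * B) : NormedSpace.exp A * J = J * NormedSpace.exp B := by
  have h1 := (NormedSpace.exp_series_hasSum_exp' (𝕂 := ℂ) A).map
    (mulRightLinearMap ι ℂ J : Matrix ι ι ℂ →ₗ[ℂ] Matrix ι κ ℂ)
    (continuous_id.matrix_mul continuous_const)
  have h2 := (NormedSpace.exp_series_hasSum_exp' (𝕂 := ℂ) B).map
    (mulLeftLinearMap κ ℂ J : Matrix κ κ ℂ →ₗ[ℂ] Matrix ι κ ℂ)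
    (continuous_const.matrix_mul continuous_id)
  have h3 : ∀ n : ℕ, A ^ n * J = J * B ^ n := by
    intro n
    induction n with
    | zero => simp
    | succ n ih => rw [pow_succ', Matrix.mul_assoc, ih, ← Matrix.mul_assoc, h, pow_succ',
        Matrix.mul_assoc]
  have e : (mulRightLinearMap ι ℂ J : Matrix ι ι ℂ →ₗ[ℂ] Matrix ι κ ℂ) ∘
      (fun n : ℕ => (n.factorial : ℂ)⁻¹ • A ^ n) =
      (mulLeftLinearMap κ ℂ J : Matrix κ κ ℂ →ₗ[ℂ] Matrix ι κ ℂ) ∘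
        fun n : ℕ => (n.factorial : ℂ)⁻¹ • B ^ n := by
    funext n
    simp [h3]
  rw [e] at h1
  exact h1.unique h2

theorem hasSum_exp_mulLeft {α : Type*} (A : Matrix ι ι ℂ) (Z : Matrix ι α ℂ) :
    HasSum (fun n : ℕ => ((n.factorial : ℂ)⁻¹) • (mulLeftLinearMap α ℂ A ^ n) Z)
      (NormedSpace.exp A * Z) := by
  have h1 := (NormedSpace.exp_series_hasSum_exp' (𝕂 := ℂ) A).map
    (mulRightLinearMap ι ℂ Z : Matrix ι ι ℂ →ₗ[ℂ] Matrix ι α ℂ)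
    (continuous_id.matrix_mul continuous_const)
  have e : (fun n : ℕ => ((n.factorial : ℂ)⁻¹) • (mulLeftLinearMap α ℂ A ^ n) Z) =
      (mulRightLinearMap ι ℂ Z : Matrix ι ι ℂ →ₗ[ℂ] Matrix ι α ℂ) ∘
      (fun n : ℕ => (n.factorial : ℂ)⁻¹ • A ^ n) := by
    funext n
    simp
  rw [e]
  exact h1

theorem hasSum_exp_mulRight {α : Type*} (B : Matrix κ κ ℂ) (Z : Matrix α κ ℂ) :
    HasSum (fun n : ℕ => ((n.factorial : ℂ)⁻¹) • (mulRightLinearMap α ℂ B ^ n) Z)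
      (Z * NormedSpace.exp B) := by
  have h1 := (NormedSpace.exp_series_hasSum_exp' (𝕂 := ℂ) B).map
    (mulLeftLinearMap κ ℂ Z : Matrix κ κ ℂ →ₗ[ℂ] Matrix α κ ℂ)
    (continuous_const.matrix_mul continuous_id)
  have e : (fun n : ℕ => ((n.factorial : ℂ)⁻¹) • (mulRightLinearMap α ℂ B ^ n) Z) =
      (mulLeftLinearMap κ ℂ Z : Matrix κ κ ℂ →ₗ[ℂ] Matrix α κ ℂ) ∘
      (fun n : ℕ => (n.factorial : ℂ)⁻¹ • B ^ n) := by
    funext n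
    simp
  rw [e]
  exact h1

/-- Left and right multiplications commute, so the exponential of their sum factorizes. -/
theorem hasSum_exp_sylvester (A : Matrix ι ι ℂ) (B : Matrix κ κ ℂ) (Z : Matrix ι κ ℂ) :
    HasSum (fun n : ℕ => ((n.factorial : ℂ)⁻¹) •
      ((mulLeftLinearMap κ ℂ A + mulRightLinearMap ι ℂ B) ^ n) Z)
      (NormedSpace.exp A * (Z * NormedSpace.exp B)) := by
  have h : Commute (mulLeftLinearMap κ ℂ A) (mulRightLinearMap ι ℂ B) := by
    refine LinearMap.ext fun Z => ?_
    simp [Matrix.mul_assoc]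
  exact hasSum_exp_add (V := Matrix ι κ ℂ) h (hasSum_exp_mulRight B Z) (hasSum_exp_mulLeft A _)

theorem summable_exp_series {α β : Type*} [Fintype α] [Fintype β]
    (f : Matrix α β ℂ →ₗ[ℂ] Matrix α β ℂ) (Z : Matrix α β ℂ) :
    Summable fun n : ℕ => ((n.factorial : ℂ)⁻¹) • (f ^ n) Z :=
  (hasSum_exp_apply (V := Matrix α β ℂ) f Z).summable

end Norm

/-- The inclusion of the first summand intertwines `X` with the block triangular matrix, hence also
their exponentials. -/
theorem exp_fromBlocks_toBlocks₁₁ (X Y Z : Matrix ι ι ℂ) :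
    (NormedSpace.exp (Matrix.fromBlocks X Y 0 Z)).toBlocks₁₁ = NormedSpace.exp X := by
  have h := mul_exp_of_intertwine (A := Matrix.fromBlocks X Y 0 Z) (B := X)
    (J := Matrix.fromRows 1 0) (by
      rw [Matrix.fromRows_mul, Matrix.fromBlocks_mul_fromRows]; simp)
  rw [Matrix.fromRows_mul, Matrix.one_mul, Matrix.zero_mul,
    ← Matrix.fromBlocks_toBlocks (NormedSpace.exp (Matrix.fromBlocks X Y 0 Z)),
    Matrix.fromBlocks_mul_fromRows, Matrix.mul_one, Matrix.mul_zero, add_zero] at h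
  exact (Matrix.fromRows_inj h).1

end Matrix

/-! ### The covariance matrix of the evolved state -/

/-- The covariance matrix on top of the trace. -/
noncomputable def covarianceColumn {N : ℕ} :
    Op N →ₗ[ℂ] Matrix (Fin (2 * N) ⊕ Fin (2 * N)) (Fin (2 * N)) ℂ where
  toFun ρ := Matrix.fromRows (covariance ρ) (ρ.trace • 1)
  map_add' ρ σ := by
    ext i j
    rcases i with i | i <;>
      simp [covariance, mul_add, add_mul]
  map_smul' c ρ := by
    ext i j
    rcases i with i | i <;>
      simp [covariance, mul_left_comm, mul_assoc]

/-- Adjoining the trace makes the affine equation linear. The block `-Xᵀ` is chosen to cancel the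
right multiplication by `Xᵀ` on the multiple of the identity, in accordance with the conservation of
the trace. -/
theorem covariance_evolve {N m : ℕ} (H : Matrix (Fin (2 * N)) (Fin (2 * N)) ℝ) (hH : Hᵀ = -H)
    (l : Matrix (Fin m) (Fin (2 * N)) ℂ) (t : ℝ) (ρ : Op N) (hρ : ρ.trace = 1)
    (E : Matrix (Fin (2 * N) ⊕ Fin (2 * N)) (Fin (2 * N) ⊕ Fin (2 * N)) ℂ)
    (hE : E = NormedSpace.exp
      ((t : ℂ) • ComplexRAM.generator (H.map Complex.ofReal) (lindbladMatrix l))) :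
    covariance (evolve H l t ρ) =
      (E.toBlocks₁₁ * covariance ρ + E.toBlocks₁₂) * E.toBlocks₁₁ᵀ := by
  set X := ComplexRAM.driftMatrix (H.map Complex.ofReal) (lindbladMatrix l) with hX
  set Y := ComplexRAM.noiseMatrix (lindbladMatrix l) with hY
  have hG : ComplexRAM.generator (H.map Complex.ofReal) (lindbladMatrix l) =
    Matrix.fromBlocks X Y 0 (-Xᵀ) := rfl
  set f := (t : ℂ) • liouvillian H l with hf
  set g := mulLeftLinearMap (Fin (2 * N)) ℂ ((t : ℂ) • Matrix.fromBlocks X Y 0 (-Xᵀ)) +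
      mulRightLinearMap (Fin (2 * N) ⊕ Fin (2 * N)) ℂ ((t : ℂ) • Xᵀ) with hg
  have hfg : ∀ σ, covarianceColumn (f σ) = g (covarianceColumn σ) := by
    intro σ
    rw [hf, hg, LinearMap.smul_apply, map_smul]
    simp only [LinearMap.add_apply, mulLeftLinearMap_apply,
      mulRightLinearMap_apply, Matrix.smul_mul, Matrix.mul_smul, ← smul_add]
    congr 1
    simp only [covarianceColumn, LinearMap.coe_mk, AddHom.coe_mk]
    rw [covariance_liouvillian H hH, trace_liouvillian, Matrix.fromBlocks_mul_fromRows,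
      Matrix.fromRows_mul]
    ext i j
    rcases i with i | i
    · simp [← hX, ← hY]
      ring
    · simp
  have hpow : ∀ n : ℕ, covarianceColumn ((f ^ n) ρ) = (g ^ n) (covarianceColumn ρ) := by
    intro n
    induction n with
    | zero => rfl
    | succ n ih => rw [pow_succ', pow_succ', Module.End.mul_apply, hfg, ih, Module.End.mul_apply]
  have h1 : HasSum (fun n : ℕ => ((n.factorial : ℂ)⁻¹) • (f ^ n) ρ) (evolve H l t ρ) := by
    have e : evolve H l t ρ = ∑' n : ℕ, ((n.factorial : ℂ)⁻¹) • (f ^ n) ρ := by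
      rw [evolve]
      refine tsum_congr fun n => ?_
      rw [hf, smul_pow, LinearMap.smul_apply, smul_smul, div_eq_inv_mul]
    rw [e]
    exact (summable_exp_series f ρ).hasSum
  have h2 : covarianceColumn (evolve H l t ρ) = E * (covarianceColumn ρ *
      NormedSpace.exp ((t : ℂ) • Xᵀ)) := by
    have h3 := h1.map covarianceColumn
      (LinearMap.continuous_of_finiteDimensional (covarianceColumn (N := N)))
    refine h3.unique ?_
    rw [hE, hG]
    convert hasSum_exp_sylvester ((t : ℂ) • Matrix.fromBlocks X Y 0 (-Xᵀ)) ((t : ℂ) • Xᵀ)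
      (covarianceColumn ρ) using 2 with n
    rw [← hpow, Function.comp_apply, map_smul]
  -- The factor on the right needs no second exponential: it is the transpose of a block of `E`.
  have h3 : NormedSpace.exp ((t : ℂ) • Xᵀ) = E.toBlocks₁₁ᵀ := by
    rw [hE, hG, Matrix.fromBlocks_smul, smul_zero, exp_fromBlocks_toBlocks₁₁,
      ← Matrix.exp_transpose, Matrix.transpose_smul]
  rw [h3, ← Matrix.mul_assoc] at h2
  conv_rhs at h2 => rw [← Matrix.fromBlocks_toBlocks E]
  simp only [covarianceColumn, LinearMap.coe_mk, AddHom.coe_mk, hρ, one_smul] at h2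
  rw [Matrix.fromBlocks_mul_fromRows, Matrix.fromRows_mul, Matrix.toBlocks_fromBlocks₁₁,
    Matrix.mul_one] at h2
  exact (Matrix.fromRows_inj h2).1

end Fermion

namespace ComplexRAM

/-! ### The complete programs -/

/-- Store the sizes `2 N`, `4 N` and `8 N`. -/
def sizesProg : Program :=
  .seq (.setNat 3 (.const 0) (.add (nv 0) (nv 0))) (.seq (.setNat 1 (.const 0) (.add (nv 3) (nv 3)))
    (.setNat 2 (.const 0) (.add (nv 1) (nv 1))))

/-- Copy the matrix `M`. -/
def copyProg : Program := fill 5 3 3 (.const 0) (.const 0) (.read 2 (nv 17) (nv 18))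

/-- Compute the matrix `M` from the Lindblad operators. -/
def gramProg : Program :=
  accumulate 5 3 3 4 (.mul (.read 2 (nv 19) (nv 17)) (.conj (.read 2 (nv 19) (nv 18))))

/-- The program for given `M`. -/
def matrixProgram : Program := .seq sizesProg (.seq copyProg mainProg)

/-- The program for given Lindblad operators. -/
def vectorProgram : Program :=
  .seq sizesProg (.seq (.setNat 4 (.const 0) (.read 0 (.const 1))) (.seq gramProg mainProg))

theorem Program.cost_le_pow (R : RootFinder) {ro : ℕ → Bool} {P : Program}
    (hP : P.LoopsIn ro = true) {s : Memory} {B d : ℕ} (hB : 1 ≤ B) (hd : P.depth ≤ d)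
    (hs : ∀ a, ro a = true → s.nat a 0 ≤ B) :
    P.cost R s ≤ P.maxCost (fun _ => 1) * B ^ d + P.rootCost R s := by
  have h1 := Program.cost_le R hP (b := fun _ => B) hs
  have h2 := P.maxCost_le B hB
  have h3 := Nat.mul_le_mul_left (P.maxCost fun _ => 1) (Nat.pow_le_pow_right hB hd)
  omega

theorem ofMatrix_apply {a b : ℕ} (A : Matrix (Fin a) (Fin b) ℂ) (i : Fin a) (j : Fin b) :
    ofMatrix A i j = A i j := by
  simp [ofMatrix]

/-- All loop bounds are at most `8 N`, whence `512 = 8³`; the matrix to be exponentiated has size `4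
N`, whence `64 = 4³` for the roots. -/
theorem mainProg_spec (R : RootFinder) {N m : ℕ} (hN : 1 ≤ N)
    {H : Matrix (Fin (2 * N)) (Fin (2 * N)) ℝ} (hH : Hᵀ = -H)
    (l : Matrix (Fin m) (Fin (2 * N)) ℂ) {ρ : Fermion.Op N} (hρ : ρ.trace = 1) (t : ℝ)
    (s : Memory) (h3 : s.nat 3 0 = N + N) (h1 : s.nat 1 0 = N + N + (N + N))
    (h2 : s.nat 2 0 = N + N + (N + N) + (N + N + (N + N))) (h24 : s.nat 24 0 = 0)
    (ht : s.arr 0 0 0 = t) (hH' : s.arr 1 = ofMatrix (H.map Complex.ofReal))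
    (hM : ∀ i j : Fin (2 * N), s.arr 5 i j = Fermion.lindbladMatrix l i j)
    (hD : s.arr 3 = ofMatrix (Fermion.covariance ρ)) (h0 : ∀ a, 4 ≤ a → a ≠ 5 → s.arr a = 0) :
    (∀ i j : Fin (2 * N), (mainProg.run R s).arr 4 i j =
      Fermion.covariance (Fermion.evolve H l t ρ) i j) ∧
    mainProg.cost R s ≤ (mainProg.maxCost (fun _ => 1) * 512 + 64) * N ^ 3 := by
  have hz : ∀ a, 4 ≤ a → a ≠ 5 → s.arr a = fun _ _ => 0 := h0
  have key := mainProg_run R s (d := 2 * N) (t := t) (H := H.map Complex.ofReal)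
    (M := Fermion.lindbladMatrix l) (D := Fermion.covariance ρ) (by omega) (by omega) (by omega)
    h24 ht (fun i j => by rw [hH', ofMatrix_apply]) hM (fun i j => by rw [hD, ofMatrix_apply])
    (hz 4 (by decide) (by decide)) (hz 10 (by decide) (by decide)) (hz 31 (by decide) (by decide))
    (hz 32 (by decide) (by decide)) (hz 33 (by decide) (by decide))
  refine ⟨fun i j => ?_, ?_⟩
  · rw [key.1, Fermion.covariance_evolve H hH l t ρ hρ _ rfl]
  · have hro : ∀ a, (a == 1 || (a == 2 || a == 3)) = true → s.nat a 0 ≤ 8 * N := by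
      intro a ha
      simp only [Bool.or_eq_true, beq_iff_eq] at ha
      rcases ha with rfl | rfl | rfl <;> omega
    have h4 := Program.cost_le_pow R (ro := fun a => a == 1 || (a == 2 || a == 3)) (P := mainProg)
      rfl (d := 3) (by omega) (by decide) hro
    have h5 := key.2
    have e1 : (8 * N) ^ 3 = 512 * N ^ 3 := by ring
    have e2 : (2 * N + 2 * N) ^ 3 = 64 * N ^ 3 := by ring
    rw [e1] at h4
    rw [e2] at h5
    calc _ ≤ _ := h4
      _ ≤ _ := Nat.add_le_add_left h5 _
      _ = _ := by ring

theorem input_arr_eq_zero {a b c d e f : ℕ} (N m : ℕ) (t : ℝ) (A : Matrix (Fin a) (Fin b) ℂ)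
    (B : Matrix (Fin c) (Fin d) ℂ) (D : Matrix (Fin e) (Fin f) ℂ) {x : ℕ} (hx : 4 ≤ x) :
    (input N m t A B D).arr x = 0 := by
  funext i j
  simp [input, show x ≠ 0 by omega, show x ≠ 1 by omega, show x ≠ 2 by omega,
    show x ≠ 3 by omega]

theorem sizesProg_run (R : RootFinder) (s : Memory) {N : ℕ} (h : s.nat 0 0 = N) :
    (sizesProg.run R s).nat 3 0 = N + N ∧ (sizesProg.run R s).nat 1 0 = N + N + (N + N) ∧
      (sizesProg.run R s).nat 2 0 = N + N + (N + N) + (N + N + (N + N)) := by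
  simp [sizesProg, Program.run, NExp.eval, h]

theorem matrixProgram_computes (R : RootFinder) {N m : ℕ} (hN : 1 ≤ N)
    {H : Matrix (Fin (2 * N)) (Fin (2 * N)) ℝ} (hH : Hᵀ = -H)
    (l : Matrix (Fin m) (Fin (2 * N)) ℂ) {ρ : Fermion.Op N} (hρ : ρ.trace = 1) (t : ℝ) :
    matrixProgram.Computes R
      (input N 0 t (H.map Complex.ofReal) (Fermion.lindbladMatrix l) (Fermion.covariance ρ))
      (Fermion.covariance (Fermion.evolve H l t ρ))
      ((21 + copyProg.maxCost (fun _ => 1) * 4 + (mainProg.maxCost (fun _ => 1) * 512 + 64)) *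
        N ^ 3) := by
  set s := input N 0 t (H.map Complex.ofReal) (Fermion.lindbladMatrix l) (Fermion.covariance ρ)
    with hs
  obtain ⟨f3, f1, f2⟩ := sizesProg_run R s (N := N) rfl
  have f24 : (sizesProg.run R s).nat 24 0 = 0 := by rw [Program.run_nat R rfl]; rfl
  have g : (sizesProg.run R s).arr = s.arr := rfl
  have hc1 : sizesProg.cost R s = 21 := rfl
  have hcost : matrixProgram.cost R s = sizesProg.cost R s + (copyProg.cost R (sizesProg.run R s) +
    mainProg.cost R (copyProg.run R (sizesProg.run R s))) := rfl
  have hrun : matrixProgram.run R s = mainProg.run R (copyProg.run R (sizesProg.run R s)) := rfl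
  set s1 := sizesProg.run R s
  clear_value s1
  have e5 := fill_run R s1 (d := 5) (a := 3) (b := 3) (ro := .const 0) (co := .const 0)
    (f := .read 2 (nv 17) (nv 18)) (by decide) f3 f3 (fun _ _ => rfl) (fun _ _ => rfl)
    (s1.arr 2) (fun s' _ ha _ _ => by simp [CExp.eval, NExp.eval, ha 2 (by decide)])
  have hc2 := Program.cost_le_pow R (ro := fun a => a == 3) (P := copyProg) (s := s1) (B := 2 * N)
    (d := 2) rfl (by omega) (by decide) (fun a ha => by
      simp only [beq_iff_eq] at ha
      subst ha; omega)
  rw [Program.rootCost_eq_zero R (P := copyProg) rfl] at hc2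
  obtain ⟨k1, k2⟩ := mainProg_spec R hN hH l hρ t (copyProg.run R s1)
    (by rw [Program.run_nat R rfl, f3]) (by rw [Program.run_nat R rfl, f1])
    (by rw [Program.run_nat R rfl, f2]) (by rw [Program.run_nat R rfl, f24])
    (by rw [Program.run_arr R rfl, g]; rfl) (by rw [Program.run_arr R rfl, g]; rfl)
    (fun i j => by
      rw [copyProg, e5]
      have hi := i.2
      have hj := j.2
      beta_reduce
      rw [if_pos ⟨⟨Nat.zero_le _, show i.1 < 0 + (N + N) by omega⟩, Nat.zero_le _,
        show j.1 < 0 + (N + N) by omega⟩, Nat.sub_zero, Nat.sub_zero, g]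
      exact ofMatrix_apply _ i j)
    (by rw [Program.run_arr R rfl, g]; rfl)
    (fun a ha ha' => by
      rw [Program.run_arr R (by simpa [copyProg, fill, Program.writesArr] using ha'), g]
      exact input_arr_eq_zero _ _ _ _ _ _ ha)
  refine ⟨?_, fun i j => by rw [hrun, k1]⟩
  rw [hcost, hc1]
  have h1 : 1 ≤ N ^ 3 := Nat.one_le_pow _ _ hN
  have h2 : (2 * N) ^ 2 ≤ 4 * N ^ 3 := by
    rw [mul_pow]
    exact Nat.mul_le_mul_left _ (Nat.pow_le_pow_right hN (by decide))
  have h3 := Nat.mul_le_mul_left (copyProg.maxCost fun _ => 1) h2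
  calc _ ≤ 21 * N ^ 3 + (copyProg.maxCost (fun _ => 1) * (4 * N ^ 3) +
        (mainProg.maxCost (fun _ => 1) * 512 + 64) * N ^ 3) := by omega
    _ = _ := by ring

theorem vectorProgram_computes (R : RootFinder) {N m : ℕ} (hN : 1 ≤ N)
    {H : Matrix (Fin (2 * N)) (Fin (2 * N)) ℝ} (hH : Hᵀ = -H)
    (l : Matrix (Fin m) (Fin (2 * N)) ℂ) {ρ : Fermion.Op N} (hρ : ρ.trace = 1) (t : ℝ) :
    vectorProgram.Computes R
      (input N m t (H.map Complex.ofReal) l (Fermion.covariance ρ))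
      (Fermion.covariance (Fermion.evolve H l t ρ))
      ((52 + (mainProg.maxCost (fun _ => 1) * 512 + 64) + 4 * gramProg.maxCost (fun _ => 1)) *
        (N ^ 3 + m * N ^ 2)) := by
  set s := input N m t (H.map Complex.ofReal) l (Fermion.covariance ρ) with hs
  obtain ⟨f3, f1, f2⟩ := sizesProg_run R s (N := N) rfl
  have f24 : (sizesProg.run R s).nat 24 0 = 0 := by rw [Program.run_nat R rfl]; rfl
  have f0 : (sizesProg.run R s).nat 0 1 = m := by rw [Program.run_nat R rfl]; rfl
  have g0 : (sizesProg.run R s).arr = s.arr := rfl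
  have hc1 : sizesProg.cost R s = 21 := rfl
  set P : Program := .setNat 4 (.const 0) (.read 0 (.const 1)) with hP
  have hc3 : P.cost R (sizesProg.run R s) = 4 := rfl
  have hcost : vectorProgram.cost R s = sizesProg.cost R s + (P.cost R (sizesProg.run R s) +
    (gramProg.cost R (P.run R (sizesProg.run R s)) +
      mainProg.cost R (gramProg.run R (P.run R (sizesProg.run R s))))) := rfl
  have hrun : vectorProgram.run R s =
    mainProg.run R (gramProg.run R (P.run R (sizesProg.run R s))) := rfl
  have n4 : (P.run R (sizesProg.run R s)).nat 4 0 = m := by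
    simp [hP, Program.run, NExp.eval, f0]
  have n3 : (P.run R (sizesProg.run R s)).nat 3 0 = N + N := by rw [Program.run_nat R rfl, f3]
  have n1 : (P.run R (sizesProg.run R s)).nat 1 0 = N + N + (N + N) := by
    rw [Program.run_nat R rfl, f1]
  have n2 : (P.run R (sizesProg.run R s)).nat 2 0 = N + N + (N + N) + (N + N + (N + N)) := by
    rw [Program.run_nat R rfl, f2]
  have n24 : (P.run R (sizesProg.run R s)).nat 24 0 = 0 := by rw [Program.run_nat R rfl, f24]
  have g : (P.run R (sizesProg.run R s)).arr = s.arr := rfl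
  rw [hc1, hc3] at hcost
  set s1 := P.run R (sizesProg.run R s)
  clear_value s1
  have e5 := accumulate_run R s1 (d := 5) (a := 3) (b := 3) (e := 4)
    (f := .mul (.read 2 (nv 19) (nv 17)) (.conj (.read 2 (nv 19) (nv 18)))) (by decide)
    (by decide) n3 n3 n4 (fun x y z => s1.arr 2 z x * star (s1.arr 2 z y))
    (fun s' _ ha _ _ _ => by simp [CExp.eval, NExp.eval, ha 2 (by decide)])
  -- The bounds are kept separate here: a common bound for `2 N` and `m` would give a term cubic in
  -- `m`.
  have hc2 := Program.cost_le R (ro := fun a => a == 3 || a == 4) (P := gramProg) rfl (s := s1)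
    (b := fun a => s1.nat a 0) (fun a _ => le_rfl)
  rw [Program.rootCost_eq_zero R (P := gramProg) rfl] at hc2
  obtain ⟨k1, k2⟩ := mainProg_spec R hN hH l hρ t (gramProg.run R s1)
    (by rw [Program.run_nat R rfl, n3]) (by rw [Program.run_nat R rfl, n1])
    (by rw [Program.run_nat R rfl, n2]) (by rw [Program.run_nat R rfl, n24])
    (by rw [Program.run_arr R rfl, g]; rfl) (by rw [Program.run_arr R rfl, g]; rfl)
    (fun i j => by
      rw [gramProg, e5]
      have hi := i.2
      have hj := j.2
      have h5 : s.arr 5 = 0 := input_arr_eq_zero _ _ _ _ _ _ (by decide)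
      have h2 : s.arr 2 = ofMatrix l := rfl
      simp only [g, h5, h2, Pi.zero_apply, zero_add]
      rw [if_pos (by omega), Finset.sum_range]
      simp only [ofMatrix_apply, Fermion.lindbladMatrix])
    (by rw [Program.run_arr R rfl, g]; rfl)
    (fun a ha ha' => by
      rw [Program.run_arr R (by simpa [gramProg, accumulate, Program.writesArr] using ha'), g]
      exact input_arr_eq_zero _ _ _ _ _ _ ha)
  refine ⟨?_, fun i j => by rw [hrun, k1]⟩
  obtain ⟨c, hc, hc'⟩ : ∃ c, gramProg.maxCost (fun a => s1.nat a 0) = 3 + s1.nat 3 0 * (1 +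
      (3 + s1.nat 3 0 * (1 + (3 + s1.nat 4 0 * c)))) ∧ c ≤ gramProg.maxCost fun _ => 1 :=
    ⟨_, rfl, show 1 + Program.maxCost (fun _ => 1) (.setArr 5 (nv 17) (nv 18) (.add
      (.read 5 (nv 17) (nv 18)) (.mul (.read 2 (nv 19) (nv 17)) (.conj (.read 2 (nv 19) (nv 18))))))
      ≤ _ by decide⟩
  rw [hc, n3, n4] at hc2
  rw [hcost]
  set G := gramProg.maxCost fun _ => 1
  set K := mainProg.maxCost (fun _ => 1) * 512 + 64
  have h1 : 1 ≤ N ^ 3 := Nat.one_le_pow _ _ hN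
  have h2 : N ≤ N ^ 3 := Nat.le_self_pow (by decide) N
  have h3 : N ^ 2 ≤ N ^ 3 := Nat.pow_le_pow_right hN (by decide)
  have h4 : m * N ^ 2 * c ≤ m * N ^ 2 * G := Nat.mul_le_mul_left _ hc'
  have h5 : 3 + (N + N) * (1 + (3 + (N + N) * (1 + (3 + m * c)))) =
      3 + 8 * N + 16 * N ^ 2 + 4 * (m * N ^ 2 * c) := by ring
  -- Here `52 = 21 + 4 + 3 + 8 + 16`: the sizes, the copy of `m`, and the overhead `3 + 8 N + 16 N ^
  -- 2` of the loops.
  calc _ ≤ 52 * N ^ 3 + (4 * (m * N ^ 2 * G) + K * N ^ 3) := by omega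
    _ ≤ _ := by
      have e : (52 + K + 4 * G) * (N ^ 3 + m * N ^ 2) = 52 * N ^ 3 +
        (4 * (m * N ^ 2 * G) + K * N ^ 3) + (52 * (m * N ^ 2) + K * (m * N ^ 2) + 4 * G * N ^ 3) := by
        ring
      rw [e]
      exact Nat.le_add_right _ _

end ComplexRAM

theorem theorem1 :
    ∃ (P Q : ComplexRAM.Program) (C : ℕ),
      ∀ (R : ComplexRAM.RootFinder) (N : ℕ), 1 ≤ N →
      ∀ (H : Matrix (Fin (2 * N)) (Fin (2 * N)) ℝ), Hᵀ = -H →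
      ∀ (m : ℕ) (l : Matrix (Fin m) (Fin (2 * N)) ℂ)
        (ρ : Fermion.Op N), Fermion.IsEvenGaussian ρ →
      ∀ (t : ℝ), 0 ≤ t →
        P.Computes R
          (ComplexRAM.input N 0 t (H.map Complex.ofReal) (Fermion.lindbladMatrix l)
            (Fermion.covariance ρ))
          (Fermion.covariance (Fermion.evolve H l t ρ))
          (C * N ^ 3) ∧
        Q.Computes R
          (ComplexRAM.input N m t (H.map Complex.ofReal) l (Fermion.covariance ρ))
          (Fermion.covariance (Fermion.evolve H l t ρ))
          (C * (N ^ 3 + m * N ^ 2)) := by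
  -- The constants are costs of fixed program texts; their sum serves both programs.
  set a := 21 + ComplexRAM.copyProg.maxCost (fun _ => 1) * 4 +
    (ComplexRAM.mainProg.maxCost (fun _ => 1) * 512 + 64)
  set b := 52 + (ComplexRAM.mainProg.maxCost (fun _ => 1) * 512 + 64) +
    4 * ComplexRAM.gramProg.maxCost (fun _ => 1)
  refine ⟨ComplexRAM.matrixProgram, ComplexRAM.vectorProgram, a + b, ?_⟩
  intro R N hN H hH m l ρ hρ t _
  have h1 := ComplexRAM.matrixProgram_computes R hN hH l hρ.1.2 t
  have h2 := ComplexRAM.vectorProgram_computes R hN hH l hρ.1.2 t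
  exact ⟨⟨h1.1.trans (Nat.mul_le_mul_right _ (Nat.le_add_right a b)), h1.2⟩,
    ⟨h2.1.trans (Nat.mul_le_mul_right _ (Nat.le_add_left b a)), h2.2⟩⟩
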